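/- Let $m\ge 0$ and let $W$ be the Coxeter group of type $H_m$: generators $s_1,\dots,s_m$, Coxeter graph the path $1,2,\dots,m$ whose bond $\{1,2\}$ has strength $5$ and whose other bonds have strength $3$. Let $W_c\subseteq W$ be the set of fully commutative elements, i.e. those that are not a reduced product $x_1 w_{ss'} x_2$ with $w_{ss'}$ the longest element of $\langle s,s'\rangle$ for generators $s,s'$ adjacent in the graph. Let $\mathcal A=\mathbb Z[v,v^{-1}]$, $\mathcal A^-=\mathbb Z[v^{-1}]$, $\delta=v+v^{-1}$, and let $TL(H_m)$ be the unital $\mathcal A$-algebra with generators $b_1,\dots,b_m$ and relations $b_i^2=\delta b_i$; $b_ib_j=b_jb_i$ if $|i-j|>1$; $b_ib_jb_i=b_i$ if $|i-j|=1$ and $i,j>1$; $b_ib_jb_ib_jb_i=3b_ib_jb_i-b_i$ if $\{i,j\}=\{1,2\}$. For $w\in W_c$ with reduced expression $s_{i_1}\cdots s_{i_r}$ put $b_w=b_{i_1}\cdots b_{i_r}$ (this is independent of the reduced expression), and let $\mathcal L_H$ be the $\mathcal A^-$-submodule of $TL(H_m)$ on the monomial basis $\{b_w: w\in W_c\}$.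 Let $w\in W_c$, take any reduced expression of $w$ and a letter $s_p$ in it, which we mark by a bar, and let $\widehat b$ be the monomial obtained from $b_w$ (written according to this expression) by deleting the corresponding letter $b_p$. Then $\widehat b\notin\mathcal L_H$ if and only if the expression can be brought, by commutations $s_is_j=s_js_i$ with $|i-j|>1$ (the bar moving with its letter), to one of the following forms, where $w_1,w_2,w_3$ are words in the generators: (i) $w_1\, s_1s_3\cdots s_{2k-1}\, s_2s_4\cdots \overline{s_{2k}}\, s_1s_3\cdots s_{2k-1}\, w_2$, where $p=2k>2$; (ii) $w_1\, s_1s_3\cdots s_{2k+1}\, s_2s_4\cdots s_{2k}\, s_1s_3\cdots s_{2k-1}\, w_2\, \overline{s_{2k}}\, s_{2k+1}\, w_3$, where $p=2k$ with $k\ge1$ and $s_{2k+1}$ commutes with every letter of $w_2$; (iii) $w_1\, s_{2k+1}\,\overline{s_{2k}}\, w_2\, s_1s_3\cdots s_{2k-1}\, s_2s_4\cdots s_{2k}\, s_1s_3\cdots s_{2k+1}\, w_3$, where $p=2k$ with $k\ge1$ and $s_{2k+1}$ commutes with every letter of $w_2$; (iv) $w_1\, s_q\,\overline{s_p}\, s_q\,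 w_2$, where $\{p,q\}=\{1,2\}$. -/

import Mathlib

open scoped LaurentPolynomial

noncomputable section

namespace TypeH

/-- The Coxeter matrix of type `H_m`: a path with nodes `1, 2, …, m` in which the bond joining
nodes `1` and `2` has strength `5` and every other bond has strength `3`.  The element `i : Fin m`
stands for the node `i + 1`. -/
def coxeterMatrix (m : ℕ) : CoxeterMatrix (Fin m) where
  M := Matrix.of fun i j : Fin m ↦
    if i = j then 1
    else if ((i : ℕ) = 0 ∧ (j : ℕ) = 1) ∨ ((i : ℕ) = 1 ∧ (j : ℕ) = 0) then 5
    else if (j : ℕ) + 1 = i ∨ (i : ℕ) + 1 = j then 3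
    else 2
  isSymm := by
    refine Matrix.IsSymm.ext fun i j => ?_
    simp only [Matrix.of_apply, eq_comm (a := j) (b := i)]
    grind
  diagonal := by simp
  off_diagonal := by
    intro i j h
    simp only [Matrix.of_apply]
    grind

/-- The Coxeter group of type `H_m`. -/
abbrev W (m : ℕ) : Type := (coxeterMatrix m).Group

/-- The Coxeter group of type `H_m` with its distinguished generators. -/
abbrev cs (m : ℕ) : CoxeterSystem (coxeterMatrix m) (W m) := (coxeterMatrix m).toCoxeterSystem

/-- `w` is complex: it is a reduced product `x₁ w_{ss'} x₂`, where `w_{ss'}`, the product of the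
alternating word in `s`, `s'` of length `m(s, s')`, is the longest element of the parabolic
subgroup generated by two generators `s`, `s'` that are adjacent in the Coxeter graph
(all bonds of the graph have finite strength). -/
def IsComplex {m : ℕ} (w : W m) : Prop :=
  ∃ (x₁ x₂ : W m) (s s' : Fin m),
    3 ≤ coxeterMatrix m s s' ∧
    w = x₁ * (cs m).wordProd (CoxeterSystem.braidWord (coxeterMatrix m) s s') * x₂ ∧
    (cs m).length w =
      (cs m).length x₁
        + (cs m).length ((cs m).wordProd (CoxeterSystem.braidWord (coxeterMatrix m) s s'))
        + (cs m).length x₂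

/-- The set `W_c` of elements that are not complex, i.e. of fully commutative elements. -/
def Wc (m : ℕ) : Set (W m) := {w | ¬ IsComplex w}

/-- The ring `𝒜 = ℤ[v, v⁻¹]`. -/
abbrev A : Type := ℤ[T;T⁻¹]

/-- The element `v` of `𝒜` is `T 1`, and `δ = v + v⁻¹`. -/
def δ : A := LaurentPolynomial.T 1 + LaurentPolynomial.T (-1)

/-- The subring `𝒜⁻ = ℤ[v⁻¹]` of `𝒜`. -/
abbrev Aminus : Subalgebra ℤ A := Algebra.adjoin ℤ {(LaurentPolynomial.T (-1) : A)}

/-- The free generator corresponding to `b_{i+1}`. -/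
abbrev gen {m : ℕ} (i : Fin m) : FreeAlgebra A (Fin m) := FreeAlgebra.ι A i

/-- The defining relations of the generalized Temperley–Lieb algebra `TL(H_m)`. -/
inductive Rel (m : ℕ) : FreeAlgebra A (Fin m) → FreeAlgebra A (Fin m) → Prop
  | square (i : Fin m) : Rel m (gen i * gen i) (δ • gen i)
  | commute (i j : Fin m) (h : (i : ℕ) + 1 < j ∨ (j : ℕ) + 1 < i) :
      Rel m (gen i * gen j) (gen j * gen i)
  | simpleBond (i j : Fin m) (hi : 1 ≤ (i : ℕ)) (hj : 1 ≤ (j : ℕ))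
      (h : (i : ℕ) + 1 = j ∨ (j : ℕ) + 1 = i) :
      Rel m (gen i * gen j * gen i) (gen i)
  | fiveBond (i j : Fin m)
      (h : ((i : ℕ) = 0 ∧ (j : ℕ) = 1) ∨ ((i : ℕ) = 1 ∧ (j : ℕ) = 0)) :
      Rel m (gen i * gen j * gen i * gen j * gen i) (3 * (gen i * gen j * gen i) - gen i)

/-- The generalized Temperley–Lieb algebra `TL(H_m)`: the unital associative `𝒜`-algebra given by
the generators `b_1, …, b_m` and the relations `Rel m`. -/
abbrev TL (m : ℕ) : Type := RingQuot (Rel m)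

/-- The generator `b_{i+1}` of `TL(H_m)`. -/
def b {m : ℕ} (i : Fin m) : TL m := RingQuot.mkAlgHom A (Rel m) (gen i)

/-- The monomial in the generators of `TL(H_m)` read off from a word. -/
def monomial {m : ℕ} (ω : List (Fin m)) : TL m := (ω.map b).prod

/-- The monomial basis `{b_w : w ∈ W_c}` of `TL(H_m)`: here `b_w` is the monomial of a reduced
expression of `w` (it is the same for all of them). -/
def monomialBasis (m : ℕ) : Set (TL m) :=
  {x | ∃ ω : List (Fin m),
    (cs m).IsReduced ω ∧ (cs m).wordProd ω ∈ Wc m ∧ x = monomial ω}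

/-- The lattice `ℒ_H`: the `𝒜⁻`-submodule of `TL(H_m)` on the monomial basis. -/
def lattice (m : ℕ) : Submodule Aminus (TL m) := Submodule.span Aminus (monomialBasis m)

/-- A letter together with a bar, present when the second component is `true`.  The letter is
written as the index `j` of the generator `s_j`, so that `j` runs from `1` to `m`. -/
abbrev Letter : Type := ℕ × Bool

/-- The word `s_{j_1} s_{j_2} ⋯` without bars. -/
def plain (u : List ℕ) : List Letter := u.map fun j => (j, false)

/-- The letter `s_j` with a bar. -/
def barred (j : ℕ) : Letter := (j, true)

/-- The word of indices of a word in the generators. -/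
def indices {m : ℕ} (ω : List (Fin m)) : List ℕ := ω.map fun i => (i : ℕ) + 1

/-- One commutation `s_i s_j = s_j s_i`, `|i - j| > 1`, of neighbouring letters.
The bar moves with its letter. -/
inductive CommStep : List Letter → List Letter → Prop
  | swap (u v : List Letter) (x y : Letter) (h : x.1 + 1 < y.1 ∨ y.1 + 1 < x.1) :
      CommStep (u ++ x :: y :: v) (u ++ y :: x :: v)

/-- Two words with a barred letter agree up to commutations. -/
def CommEquiv : List Letter → List Letter → Prop := Relation.ReflTransGen CommStep

/-- `s_1 s_3 ⋯ s_{2k-1}` -/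
def odds (k : ℕ) : List ℕ := (List.range k).map fun i => 2 * i + 1

/-- `s_2 s_4 ⋯ s_{2k}` -/
def evens (k : ℕ) : List ℕ := (List.range k).map fun i => 2 * i + 2

/-- `w = w₁ s_1 s_3 ⋯ s_{2k-1} s_2 s_4 ⋯ \overline{s_{2k}} s_1 s_3 ⋯ s_{2k-1} w₂`,
where `p = 2k > 2`. -/
def ParseI (p : ℕ) (ω : List Letter) : Prop :=
  ∃ (k : ℕ) (w₁ w₂ : List ℕ), p = 2 * k ∧ 2 < 2 * k ∧
    CommEquiv ω
      (plain w₁ ++ plain (odds k) ++ plain (evens (k - 1)) ++ [barred (2 * k)]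
        ++ plain (odds k) ++ plain w₂)

/-- The generator `s_j` commutes with every letter of the word `u`. -/
def CommutesWith (j : ℕ) (u : List ℕ) : Prop := ∀ x ∈ u, x + 1 ≠ j ∧ j + 1 ≠ x

/-- `w = w₁ s_1 s_3 ⋯ s_{2k+1} s_2 s_4 ⋯ s_{2k} s_1 s_3 ⋯ s_{2k-1} w₂ \overline{s_{2k}} s_{2k+1} w₃`,
where `p = 2k` and `s_{2k+1}` commutes with the letters of `w₂`. -/
def ParseII (p : ℕ) (ω : List Letter) : Prop :=
  ∃ (k : ℕ) (w₁ w₂ w₃ : List ℕ), p = 2 * k ∧ 1 ≤ k ∧ CommutesWith (2 * k + 1) w₂ ∧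
    CommEquiv ω
      (plain w₁ ++ plain (odds (k + 1)) ++ plain (evens k) ++ plain (odds k) ++ plain w₂
        ++ [barred (2 * k)] ++ plain [2 * k + 1] ++ plain w₃)

/-- `w = w₁ s_{2k+1} \overline{s_{2k}} w₂ s_1 s_3 ⋯ s_{2k-1} s_2 s_4 ⋯ s_{2k} s_1 s_3 ⋯ s_{2k+1} w₃`,
where `p = 2k` and `s_{2k+1}` commutes with the letters of `w₂`. -/
def ParseIII (p : ℕ) (ω : List Letter) : Prop :=
  ∃ (k : ℕ) (w₁ w₂ w₃ : List ℕ), p = 2 * k ∧ 1 ≤ k ∧ CommutesWith (2 * k + 1) w₂ ∧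
    CommEquiv ω
      (plain w₁ ++ plain [2 * k + 1] ++ [barred (2 * k)] ++ plain w₂ ++ plain (odds k)
        ++ plain (evens k) ++ plain (odds (k + 1)) ++ plain w₃)

/-- `w = w₁ s_q \overline{s_p} s_q w₂`, where `{p, q} = {1, 2}`. -/
def ParseIV (p : ℕ) (ω : List Letter) : Prop :=
  ∃ (q : ℕ) (w₁ w₂ : List ℕ), ({p, q} : Set ℕ) = {1, 2} ∧
    CommEquiv ω (plain w₁ ++ plain [q] ++ [barred p] ++ plain [q] ++ plain w₂)

end TypeH

end

/-! Represent TL(H_m) by diagrams: perfect matchings of m + 1 top and m + 1 bottom points whose arcs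
carry labels, a label k standing for xᵏ with x² = 3x − 1. A letter joins two neighbouring strands
and adds a new arc, with label 1 for b_1 and 0 otherwise; every loop that closes contributes δ times
a positive integer. The number of loops closed by a word decides whether its monomial lies in the
lattice.

(a) This number is unchanged by commutations and when i j i becomes i for neighbours i, j. By
Matsumoto's theorem, a word that is not a reduced word of a fully commutative element contains, up
to commutations, a square or one side of a bond relation. A word without loops has no square, so the
relations write its monomial as an integral combination of monomials of shorter words without loops;
by induction it lies in the lattice (`monomial_mem_lattice`).

(b) Words of fully commutative elements close no loop (`loops_eq_zero`). Hence the functional that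
reads off the diagrams with given arcs maps the lattice into 𝒜⁻, while for suitable arcs it takes a
value n δᵏ with n, k > 0 on δ times a given monomial. So δ times a monomial is never in the lattice
(`δ_smul_monomial_notMem`). Linear independence of the monomials is not needed.

(c) In each of the four forms, deleting the barred letter leaves δ times a product of generators: by
b_q² = δ b_q in form (iv), by `evalNat_odds_evens_odds` in the others.

(d) Conversely, let the word with one letter deleted close a loop, recorded by the letters at which
the loop turns (`Closed`). Two occurrences of its largest letter are joined on their right, and the
spacing of letters in a fully commutative word forces such a pair to surround the deleted letter
(`joined_right`). Following the strand to the left and back shows that the even letters on it are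
passed on both sides and sit in a ladder of interlocking pairs of odd letters (`even_cup`,
`exists_ladder`). Four patterns remain (`exists_pattern`), and sorting the letters by layers turns
them into the four forms. -/

namespace CoxeterSystem

/-! ### Signed reflections, the exchange property and Matsumoto's theorem -/

variable {B W : Type*} [Group W] {M : CoxeterMatrix B} (cs : CoxeterSystem M W)

open Classical in
/-- The action of a simple reflection on signed elements, which flips the sign at the
reflection itself. -/
noncomputable def signedStep (i : B) : Function.End (W × ZMod 2) := fun x ↦
  (cs.simple i * x.1 * cs.simple i, x.2 + if x.1 = cs.simple i then 1 else 0)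

/-- The composite of the signed actions of the letters of a word. -/
noncomputable def signedWord (ω : List B) : Function.End (W × ZMod 2) :=
  (ω.map cs.signedStep).prod

open Classical in
-- The sign flips once for each occurrence of the reflection in the right inversion sequence, so it
-- records the parity of the multiplicity.
theorem signedWord_apply (ω : List B) (x : W × ZMod 2) :
    cs.signedWord ω x =
      (cs.wordProd ω * x.1 * (cs.wordProd ω)⁻¹,
        x.2 + ((cs.rightInvSeq ω).count x.1 : ZMod 2)) := by
  induction ω with
  | nil => simp [signedWord, Function.End.one_def]
  | cons i ω ih =>
    have h : cs.signedWord (i :: ω) x = cs.signedStep i (cs.signedWord ω x) := by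
      simp [signedWord, Function.End.mul_def, Function.comp]
    rw [h, ih]
    have hc : (cs.wordProd ω * x.1 * (cs.wordProd ω)⁻¹ = cs.simple i) ↔
        (cs.wordProd ω)⁻¹ * cs.simple i * cs.wordProd ω = x.1 := by
      constructor
      · intro h; rw [← h]; group
      · intro h; rw [← h]; group
    ext
    · simp [signedStep, wordProd_cons, mul_assoc]
    · simp only [signedStep, rightInvSeq, List.count_cons, hc, beq_iff_eq]
      push_cast
      ring

open Classical in
-- The inversion sequence of this word of length 2 M i j has period M i j because (s_i s_j)^(M i j)
-- = 1, so every reflection occurs an even number of times.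
theorem count_rightInvSeq_alternatingWord (i j : B) (t : W) :
    ((cs.rightInvSeq (alternatingWord i j (2 * M i j))).count t : ZMod 2) = 0 := by
  have hrev : cs.rightInvSeq (alternatingWord i j (2 * M i j)) =
      (cs.leftInvSeq (alternatingWord i j (2 * M i j)).reverse).reverse := by
    rw [cs.leftInvSeq_reverse, List.reverse_reverse]
  have hr : (alternatingWord i j (2 * M i j)).reverse = alternatingWord j i (2 * M i j) := by
    apply List.ext_getElem
    · simp
    · intro k h1 h2
      simp only [length_alternatingWord, List.length_reverse] at h1 h2
      rw [List.getElem_reverse]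
      simp only [length_alternatingWord]
      rw [getElem_alternatingWord _ _ _ _ (by lia), getElem_alternatingWord _ _ _ _ h2]
      by_cases he : Even k
      · rw [if_neg, if_pos]
        · simpa [Nat.even_add] using he
        · have : 2 * M i j + (2 * M i j - 1 - k) = 2 * (2 * M i j - 1 - k) + (k + 1) := by lia
          rw [this]
          simp [Nat.even_add, Nat.even_add_one, he]
      · rw [if_pos, if_neg]
        · simpa [Nat.even_add] using he
        · have : 2 * M i j + (2 * M i j - 1 - k) = 2 * (2 * M i j - 1 - k) + (k + 1) := by lia
          rw [this]
          simp [Nat.even_add, Nat.even_add_one, he]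
  rw [hrev, List.count_reverse, hr]
  set l := cs.leftInvSeq (alternatingWord j i (2 * M i j)) with hl
  have hlen : l.length = 2 * M i j := by simp [hl]
  have hl2 : l = l.take (M i j) ++ l.take (M i j) := by
    conv_lhs => rw [← List.take_append_drop (M i j) l]
    congr 1
    apply List.ext_getElem
    · simp [hlen]; lia
    · intro k h1 h2
      simp only [List.length_drop, hlen] at h1
      rw [List.getElem_drop, List.getElem_take]
      rw [cs.getElem_leftInvSeq_alternatingWord j i (M i j) _ (by lia),
        cs.getElem_leftInvSeq_alternatingWord j i (M i j) _ (by lia)]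
      rw [prod_alternatingWord_eq_mul_pow, prod_alternatingWord_eq_mul_pow]
      have e1 : (2 * (M i j + k) + 1) / 2 = M i j + k := by lia
      have e2 : (2 * k + 1) / 2 = k := by lia
      have o1 : ¬ Even (2 * (M i j + k) + 1) := by simp
      have o2 : ¬ Even (2 * k + 1) := by simp
      rw [e1, e2, if_neg o1, if_neg o2, pow_add, cs.simple_mul_simple_pow, one_mul]
  rw [hl2, List.count_append]
  push_cast
  exact CharTwo.add_self_eq_zero _

theorem signedStep_isLiftable : M.IsLiftable cs.signedStep := by
  classical
  intro i j
  have key : ∀ n, (cs.signedStep i * cs.signedStep j) ^ n =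
      cs.signedWord (alternatingWord i j (2 * n)) := by
    intro n
    induction n with
    | zero => simp [alternatingWord, signedWord]
    | succ n ih =>
      rw [pow_succ, ih, show 2 * (n + 1) = 2 * n + 1 + 1 by ring, alternatingWord_succ,
        alternatingWord_succ]
      simp [signedWord]
  rw [key]
  funext x
  rw [signedWord_apply, count_rightInvSeq_alternatingWord, prod_alternatingWord_eq_mul_pow]
  simp [Function.End.one_def]

open Classical in
-- The signed action descends to the group, so the parity is a function of the element alone.
theorem count_rightInvSeq_eq_of_wordProd_eq {ω ω' : List B}
    (h : cs.wordProd ω = cs.wordProd ω') (t : W) :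
    ((cs.rightInvSeq ω).count t : ZMod 2) = ((cs.rightInvSeq ω').count t : ZMod 2) := by
  have hlift : ∀ ω, cs.signedWord ω = cs.lift ⟨_, cs.signedStep_isLiftable⟩ (cs.wordProd ω) := by
    intro ω
    simp [signedWord, wordProd, map_list_prod, Function.comp_def]
  have := congrArg (fun f : Function.End (W × ZMod 2) ↦ (f (t, 0)).2)
    ((hlift ω).trans ((congrArg _ h).trans (hlift ω').symm))
  simpa [signedWord_apply] using this

/-- The exchange property. -/
theorem exists_eraseIdx_of_isRightDescent {ω : List B} {i : B}
    (h : cs.IsRightDescent (cs.wordProd ω) i) :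
    ∃ k < ω.length, cs.wordProd ω * cs.simple i = cs.wordProd (ω.eraseIdx k) := by
  classical
  obtain ⟨α, hα, hw⟩ := cs.exists_isReduced (cs.wordProd ω * cs.simple i)
  have hprod : cs.wordProd (α.concat i) = cs.wordProd ω := by
    rw [wordProd_concat, ← hw, simple_mul_simple_cancel_right]
  have hred : cs.IsReduced (α.concat i) := by
    rw [IsReduced, hprod]
    rw [isRightDescent_iff] at h
    rw [← h, hw, hα.eq]
    simp
  have hcount := cs.count_rightInvSeq_eq_of_wordProd_eq hprod (cs.simple i)
  rw [List.count_eq_one_of_mem hred.nodup_rightInvSeq (by rw [rightInvSeq_concat]; simp)] at hcount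
  -- In the reduced word ending in i the reflection s_i occurs exactly once; by parity it cannot be
  -- absent from the sequence of ω.
  have hmem : cs.simple i ∈ cs.rightInvSeq ω := by
    by_contra hn
    rw [List.count_eq_zero_of_not_mem hn] at hcount
    simp at hcount
  obtain ⟨k, hk, hki⟩ := List.mem_iff_getElem.mp hmem
  refine ⟨k, by simpa using hk, ?_⟩
  rw [← cs.wordProd_mul_getD_rightInvSeq, List.getD_eq_getElem _ _ hk, hki]

open Classical in
-- Without repetitions every member has odd multiplicity, hence also occurs for a reduced word of
-- the same element, which therefore cannot be shorter.
theorem isReduced_of_nodup_rightInvSeq {ω : List B} (h : (cs.rightInvSeq ω).Nodup) :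
    cs.IsReduced ω := by
  obtain ⟨α, hα, hw⟩ := cs.exists_isReduced (cs.wordProd ω)
  refine le_antisymm (cs.length_wordProd_le ω) ?_
  rw [hw, hα.eq, ← cs.length_rightInvSeq ω, ← cs.length_rightInvSeq α]
  refine (List.subperm_of_subset h fun t ht ↦ ?_).length_le
  by_contra hn
  have hcount := cs.count_rightInvSeq_eq_of_wordProd_eq hw t
  rw [List.count_eq_one_of_mem h ht, List.count_eq_zero_of_not_mem hn] at hcount
  simp at hcount

/-- Alternating words in two distinct generators are reduced as long as they are not longer than
the order of the product of the generators. -/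
def AlternatingReduced : Prop :=
  ∀ i j : B, i ≠ j → M i j ≠ 0 ∧ ∀ n ≤ M i j, cs.IsReduced (alternatingWord i j n)

variable {cs}

/-- Induction on n: exchange for the descent j deletes a letter from γ followed by an alternating
tail. Deleting from the tail would write a reduced alternating word with too few letters, so the
letter comes from γ and j is appended to the tail. -/
theorem exists_append_alternatingWord (H : cs.AlternatingReduced) {w : W} (n : ℕ) {i j : B}
    (hij : i ≠ j) (hi : cs.IsRightDescent w i) (hj : cs.IsRightDescent w j) (hn : n ≤ M i j) :
    ∃ γ : List B, cs.wordProd (γ ++ alternatingWord i j n) = w ∧ γ.length + n = cs.length w := by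
  induction n generalizing i j with
  | zero =>
    obtain ⟨α, hα, hw⟩ := cs.exists_isReduced w
    exact ⟨α, by simp [alternatingWord, hw], by rw [hw, hα.eq]; rfl⟩
  | succ n ih =>
    obtain ⟨γ, hγ, hlen⟩ := ih hij.symm hj hi (by rw [M.symmetric]; lia)
    obtain ⟨k, hk, hkw⟩ := cs.exists_eraseIdx_of_isRightDescent (hγ ▸ hj)
    rw [isRightDescent_iff] at hj
    have hwj : w = cs.wordProd ((γ ++ alternatingWord j i n).eraseIdx k) * cs.simple j := by
      rw [← hkw, hγ, simple_mul_simple_cancel_right]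
    by_cases hkγ : k < γ.length
    · rw [List.eraseIdx_append_of_lt_length hkγ] at hwj
      refine ⟨γ.eraseIdx k, ?_, ?_⟩
      · rw [alternatingWord_succ, List.concat_eq_append, ← List.append_assoc, wordProd_append,
          wordProd_singleton, ← hwj]
      · have := List.length_eraseIdx_add_one hkγ
        lia
    · exfalso
      rw [List.eraseIdx_append_of_length_le (by lia)] at hkw
      have hred := (H i j hij).2 (n + 1) hn
      have : cs.wordProd (alternatingWord i j (n + 1)) =
          cs.wordProd ((alternatingWord j i n).eraseIdx (k - γ.length)) := by
        rw [wordProd_append, wordProd_append, mul_assoc] at hkw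
        rw [alternatingWord_succ, wordProd_concat]
        exact mul_left_cancel hkw
      have h1 := cs.length_wordProd_le ((alternatingWord j i n).eraseIdx (k - γ.length))
      rw [← this, hred.eq] at h1
      have := List.length_eraseIdx_le (alternatingWord j i n) (k - γ.length)
      simp at h1 this
      lia

variable (M) in
/-- A braid move applied inside a word. -/
inductive BraidStep : List B → List B → Prop
  | mk (u v : List B) (i j : B) :
      BraidStep (u ++ braidWord M i j ++ v) (u ++ braidWord M j i ++ v)

theorem BraidStep.append {ω ω' : List B} (h : BraidStep M ω ω') (v : List B) :
    BraidStep M (ω ++ v) (ω' ++ v) := by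
  obtain ⟨u, v', i, j⟩ := h
  have := BraidStep.mk (M := M) u (v' ++ v) i j
  simpa [List.append_assoc] using this

theorem BraidStep.trans_append {ω ω' : List B} (h : Relation.ReflTransGen (BraidStep M) ω ω')
    (v : List B) : Relation.ReflTransGen (BraidStep M) (ω ++ v) (ω' ++ v) :=
  h.lift (· ++ v) (fun _ _ h ↦ h.append v)

theorem isReduced_of_append_left {u v : List B} (h : cs.IsReduced (u ++ v)) : cs.IsReduced u := by
  simpa using h.take u.length

theorem isReduced_of_append_right {u v : List B} (h : cs.IsReduced (u ++ v)) : cs.IsReduced v := by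
  simpa using h.drop u.length

/-- Matsumoto's theorem: two reduced words for the same element are connected by braid moves. -/
theorem braidStep_of_wordProd_eq (H : cs.AlternatingReduced) (n : ℕ) {α β : List B}
    (hn : α.length = n) (hα : cs.IsReduced α) (hβ : cs.IsReduced β)
    (h : cs.wordProd α = cs.wordProd β) : Relation.ReflTransGen (BraidStep M) α β := by
  induction n generalizing α β with
  | zero =>
    have hβ0 : β.length = 0 := by rw [← hβ.eq, ← h, hα.eq, hn]
    rw [List.length_eq_zero_iff.mp hn, List.length_eq_zero_iff.mp hβ0]
  | succ n ih =>
    have hlen : β.length = n + 1 := by rw [← hβ.eq, ← h, hα.eq, hn]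
    obtain rfl | ⟨α, i, rfl⟩ := List.eq_nil_or_concat α
    · simp at hn
    obtain rfl | ⟨β, j, rfl⟩ := List.eq_nil_or_concat β
    · simp at hlen
    simp only [List.concat_eq_append, List.length_append, List.length_singleton,
      Nat.add_right_cancel_iff] at hn hlen hα hβ h ⊢
    have hα' := isReduced_of_append_left hα
    have hβ' := isReduced_of_append_left hβ
    have same : ∀ (k : B) {α β : List B}, α.length = n → cs.IsReduced (α ++ [k]) →
        cs.IsReduced (β ++ [k]) → cs.wordProd (α ++ [k]) = cs.wordProd (β ++ [k]) →
        Relation.ReflTransGen (BraidStep M) (α ++ [k]) (β ++ [k]) := by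
      intro k α β h1 h2 h3 h4
      refine BraidStep.trans_append (ih h1 (isReduced_of_append_left h2)
        (isReduced_of_append_left h3) ?_) [k]
      simpa [wordProd_append] using h4
    by_cases hij : i = j
    · subst hij
      exact same i hn hα hβ h
    have desc : ∀ {γ : List B} {k : B}, cs.IsReduced (γ ++ [k]) →
        cs.IsRightDescent (cs.wordProd (γ ++ [k])) k := by
      intro γ k hγ
      rw [IsRightDescent, hγ.eq, wordProd_append, wordProd_singleton,
        simple_mul_simple_cancel_right, (isReduced_of_append_left hγ).eq]
      simp
    have di := desc hα
    have dj := desc hβ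
    rw [← h] at dj
    obtain ⟨γ, hγ, hγl⟩ := exists_append_alternatingWord H (M i j) hij di dj le_rfl
    change cs.wordProd (γ ++ braidWord M i j) = _ at hγ
    have hM : M i j ≠ 0 := (H i j hij).1
    have hγ' : cs.wordProd (γ ++ braidWord M j i) = cs.wordProd (α ++ [i]) := by
      rw [wordProd_append, wordProd_braidWord_eq, ← wordProd_append, hγ]
    have r1 : cs.IsReduced (γ ++ braidWord M i j) := by
      rw [IsReduced, hγ, ← hγl]; simp
    have r2 : cs.IsReduced (γ ++ braidWord M j i) := by
      rw [IsReduced, hγ', ← hγl]; simp [M.symmetric i j]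
    have tail : ∀ i j : B, M i j ≠ 0 →
        ∃ ρ, braidWord M i j = ρ ++ [j] := by
      intro i j hM
      obtain ⟨k, hk⟩ := Nat.exists_eq_succ_of_ne_zero hM
      exact ⟨alternatingWord j i k, by simp [braidWord, hk, alternatingWord_succ]⟩
    obtain ⟨ρ, hρ⟩ := tail i j hM
    obtain ⟨σ, hσ⟩ := tail j i (by rwa [M.symmetric])
    -- The two sides of the braid after γ end in i and in j. Each outer step joins words with the
    -- same last letter, so induction applies, and the middle step is a single braid move.
    have s1 : Relation.ReflTransGen (BraidStep M) (α ++ [i]) (γ ++ braidWord M j i) := by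
      rw [hσ, ← List.append_assoc] at r2 hγ' ⊢
      exact same i hn hα r2 hγ'.symm
    have s2 : Relation.ReflTransGen (BraidStep M) (γ ++ braidWord M j i) (γ ++ braidWord M i j) :=
      .single (by simpa using BraidStep.mk (M := M) γ [] j i)
    have s3 : Relation.ReflTransGen (BraidStep M) (γ ++ braidWord M i j) (β ++ [j]) := by
      have hl : (γ ++ braidWord M i j).length = n + 1 := by
        rw [← r1.eq, hγ, hα.eq]; simp [hn]
      rw [hρ, ← List.append_assoc] at r1 hγ hl ⊢
      exact same j (by simpa [← add_assoc] using hl) r1 hβ (hγ.trans h)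
    exact s1.trans (s2.trans s3)

end CoxeterSystem

/-! ### Reducedness of alternating words in type H -/

noncomputable section

namespace CoxeterSystem

variable {B W : Type*} [Group W] {M : CoxeterMatrix B} {cs : CoxeterSystem M W}

/-- The inversions of the full alternating word are a generator times powers of the product with
exponents below its order, hence distinct; shorter alternating words are suffixes of it. -/
theorem isReduced_alternatingWord {i j : B} {n : ℕ}
    (h : orderOf (cs.simple i * cs.simple j) = M i j) (hn : n ≤ M i j) :
    cs.IsReduced (alternatingWord i j n) := by
  classical
  have suffix : ∀ p, alternatingWord i j n <:+ alternatingWord i j (n + p) := by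
    intro p
    induction p with
    | zero => exact List.suffix_refl _
    | succ p ih =>
      rw [← add_assoc, alternatingWord_succ']
      exact ih.trans (List.suffix_cons _ _)
  suffices hfull : cs.IsReduced (alternatingWord i j (M i j)) by
    obtain ⟨p, hp⟩ := Nat.exists_eq_add_of_le hn
    obtain ⟨t, ht⟩ := suffix p
    rw [← hp] at ht
    rw [← ht] at hfull
    exact isReduced_of_append_right hfull
  have key : ∀ a b : B, orderOf (cs.simple b * cs.simple a) = M i j →
      cs.IsReduced ((alternatingWord a b (2 * M i j)).take (M i j)) := by
    intro a b ho
    rw [← isReduced_reverse_iff]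
    apply isReduced_of_nodup_rightInvSeq
    rw [rightInvSeq_reverse, List.nodup_reverse, List.nodup_iff_injective_getElem]
    intro ⟨k, hk⟩ ⟨l, hl⟩ hkl
    simp only [length_leftInvSeq, List.length_take, length_alternatingWord] at hk hl
    simp only [leftInvSeq_take, List.getElem_take] at hkl
    rw [getElem_leftInvSeq_alternatingWord _ _ _ _ _ (by lia),
      getElem_leftInvSeq_alternatingWord _ _ _ _ _ (by lia), prod_alternatingWord_eq_mul_pow,
      prod_alternatingWord_eq_mul_pow, if_neg (by simp), if_neg (by simp),
      show (2 * k + 1) / 2 = k by lia, show (2 * l + 1) / 2 = l by lia] at hkl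
    have := pow_injOn_Iio_orderOf (x := cs.simple b * cs.simple a) (x₁ := k) (x₂ := l)
      (by simp [ho]; lia) (by simp [ho]; lia) (mul_left_cancel hkl)
    simpa using this
  have hsymm : orderOf (cs.simple j * cs.simple i) = M i j := by
    rw [← h, ← orderOf_inv]
    simp
  by_cases hM0 : M i j = 0
  · rw [hM0]; simp [alternatingWord, IsReduced]
  by_cases he : Even (M i j)
  · have := key i j hsymm
    rwa [listTake_alternatingWord _ _ _ _ (by lia), if_pos he] at this
  · have := key j i h
    rwa [listTake_alternatingWord _ _ _ _ (by lia), if_neg he] at this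

end CoxeterSystem

namespace TypeH

variable {m : ℕ}

theorem coxeterMatrix_apply (i j : Fin m) : coxeterMatrix m i j =
    if i = j then 1
    else if ((i : ℕ) = 0 ∧ (j : ℕ) = 1) ∨ ((i : ℕ) = 1 ∧ (j : ℕ) = 0) then 5
    else if (j : ℕ) + 1 = i ∨ (i : ℕ) + 1 = j then 3
    else 2 := rfl

/-- The Cartan matrix of type `H_m` over the field with five elements, in which `3` is a root of
`x ^ 2 = x + 1`. -/
def cartan (i j : Fin m) : ZMod 5 :=
  if i = j then 2
  else if ((i : ℕ) = 0 ∧ (j : ℕ) = 1) ∨ ((i : ℕ) = 1 ∧ (j : ℕ) = 0) then -3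
  else if (j : ℕ) + 1 = i ∨ (i : ℕ) + 1 = j then -1
  else 0

/-- The reflections of the representation given by `cartan`. -/
def cartanReflection (i : Fin m) : Function.End (Fin m → ZMod 5) :=
  fun f k ↦ f k - cartan i k * f i

/-- Modulo 5 the number 3 can play the role of the golden ratio 2 cos(π/5), so the relation of the
bond of strength 5 becomes a finite computation. -/
theorem cartanReflection_isLiftable : (coxeterMatrix m).IsLiftable cartanReflection := by
  intro i j
  have self : ∀ i : Fin m, cartan i i = 2 := fun i ↦ by simp [cartan]
  have symm : cartan j i = cartan i j := by
    simp only [cartan]; grind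
  have mul_apply : ∀ (φ ψ : Function.End (Fin m → ZMod 5)) f, (φ * ψ) f = φ (ψ f) :=
    fun _ _ _ ↦ rfl
  have one_apply : ∀ f, (1 : Function.End (Fin m → ZMod 5)) f = f := fun _ ↦ rfl
  rw [coxeterMatrix_apply]
  by_cases hij : i = j
  · subst hij
    rw [if_pos rfl, pow_one]
    funext f k
    simp only [mul_apply, one_apply, cartanReflection, self]
    ring
  rw [if_neg hij]
  split_ifs with h1 h2
  · have hc : cartan i j = -3 := by simp [cartan, hij, h1]
    funext f k
    simp only [pow_succ, pow_zero, mul_apply, one_apply, cartanReflection, self, symm, hc]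
    ring_nf
    reduce_mod_char
  · have hc : cartan i j = -1 := by simp [cartan, hij, h1, h2]
    funext f k
    simp only [pow_succ, pow_zero, mul_apply, one_apply, cartanReflection, self, symm, hc]
    ring
  · have hc : cartan i j = 0 := by simp [cartan, hij, h1, h2]
    funext f k
    simp only [pow_succ, pow_zero, mul_apply, one_apply, cartanReflection, self, symm, hc]
    ring

theorem simple_ne_simple {i j : Fin m} (hij : i ≠ j) : (cs m).simple i ≠ (cs m).simple j := by
  intro h
  -- On the i-th unit vector, the two reflections have i-th coordinates −1 and 1.
  have := congrArg (fun w ↦ (cs m).lift ⟨_, cartanReflection_isLiftable⟩ w (Pi.single i 1) i) h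
  rw [CoxeterSystem.lift_apply_simple, CoxeterSystem.lift_apply_simple] at this
  simp [cartanReflection, cartan, hij.symm] at this
  exact absurd this (by decide)

/-- The strengths 2, 3, 5 are prime, so the order of s_i s_j is the full strength as soon as s_i ≠
s_j. No faithful representation is needed. -/
theorem alternatingReduced : (cs m).AlternatingReduced := by
  intro i j hij
  have hprime : (coxeterMatrix m i j).Prime := by
    rw [coxeterMatrix_apply, if_neg hij]
    split_ifs <;> norm_num
  refine ⟨hprime.ne_zero, fun n hn ↦ CoxeterSystem.isReduced_alternatingWord ?_ hn⟩
  have := Fact.mk hprime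
  refine orderOf_eq_prime ((cs m).simple_mul_simple_pow i j) fun h ↦ simple_ne_simple hij ?_
  rw [← (cs m).inv_simple j]
  exact eq_inv_of_mul_eq_one_left h

end TypeH

end

/-! ### Words up to commutations; squares and braids -/

noncomputable section

namespace TypeH

variable {m : ℕ}

/-- The indices `i` and `j` are distant in the Coxeter graph. -/
def Distant (i j : Fin m) : Prop := (i : ℕ) + 1 < j ∨ (j : ℕ) + 1 < i

theorem Distant.symm {i j : Fin m} (h : Distant i j) : Distant j i := Or.symm h

/-- One commutation of neighbouring letters in a word in the generators. -/
inductive WordStep : List (Fin m) → List (Fin m) → Prop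
  | swap (u v : List (Fin m)) (i j : Fin m) (h : Distant i j) :
      WordStep (u ++ i :: j :: v) (u ++ j :: i :: v)

/-- Two words agree up to commutations. -/
def WordEquiv : List (Fin m) → List (Fin m) → Prop := Relation.ReflTransGen WordStep

theorem WordStep.append {α β : List (Fin m)} (h : WordStep α β) (u v : List (Fin m)) :
    WordStep (u ++ α ++ v) (u ++ β ++ v) := by
  obtain ⟨u', v', i, j, h⟩ := h
  simpa using WordStep.swap (u ++ u') (v' ++ v) i j h

theorem WordEquiv.append {α β : List (Fin m)} (h : WordEquiv α β) (u v : List (Fin m)) :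
    WordEquiv (u ++ α ++ v) (u ++ β ++ v) :=
  Relation.ReflTransGen.lift (fun ω ↦ u ++ ω ++ v) (fun _ _ h ↦ h.append u v) _ _ h

theorem WordEquiv.eq_of_step {X : Type*} (F : List (Fin m) → X)
    (hF : ∀ u v i j, Distant i j → F (u ++ i :: j :: v) = F (u ++ j :: i :: v))
    {α β : List (Fin m)} (h : WordEquiv α β) : F α = F β := by
  induction h with
  | refl => rfl
  | tail _ h ih =>
    obtain ⟨u, v, i, j, h⟩ := h
    exact ih.trans (hF u v i j h)

theorem distant_iff_coxeterMatrix_eq_two {i j : Fin m} :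
    coxeterMatrix m i j = 2 ↔ Distant i j := by
  rw [coxeterMatrix_apply, Distant]
  have := Fin.ext_iff (a := i) (b := j)
  grind

theorem simple_mul_simple_comm {i j : Fin m} (h : Distant i j) :
    (cs m).simple i * (cs m).simple j = (cs m).simple j * (cs m).simple i := by
  have h2 := (cs m).simple_mul_simple_pow i j
  rw [distant_iff_coxeterMatrix_eq_two.mpr h, pow_two] at h2
  rw [← inv_inv ((cs m).simple i * (cs m).simple j), ← eq_inv_of_mul_eq_one_left h2,
    mul_inv_rev, (cs m).inv_simple, (cs m).inv_simple]

theorem WordEquiv.wordProd_eq {α β : List (Fin m)} (h : WordEquiv α β) :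
    (cs m).wordProd α = (cs m).wordProd β := by
  refine h.eq_of_step _ fun u v i j hij ↦ ?_
  rw [CoxeterSystem.wordProd_append, CoxeterSystem.wordProd_append]
  simp only [CoxeterSystem.wordProd_cons]
  rw [← mul_assoc ((cs m).simple i), simple_mul_simple_comm hij, mul_assoc]

theorem WordEquiv.length_eq {α β : List (Fin m)} (h : WordEquiv α β) :
    α.length = β.length := h.eq_of_step _ fun u v i j _ ↦ by simp

theorem WordEquiv.isReduced {α β : List (Fin m)} (h : WordEquiv α β) (hα : (cs m).IsReduced α) :
    (cs m).IsReduced β := by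
  rw [CoxeterSystem.IsReduced, ← h.wordProd_eq, hα.eq, h.length_eq]

/-- The word contains, up to commutations, one side of a braid relation of a bond. -/
def HasBraid (ω : List (Fin m)) : Prop :=
  ∃ u v i j, 3 ≤ coxeterMatrix m i j ∧
    WordEquiv ω (u ++ CoxeterSystem.braidWord (coxeterMatrix m) i j ++ v)

/-- The word contains, up to commutations, a square of a generator. -/
def HasSquare (ω : List (Fin m)) : Prop :=
  ∃ u v i, WordEquiv ω (u ++ [i, i] ++ v)

theorem HasBraid.append {ω : List (Fin m)} (h : HasBraid ω) (t : List (Fin m)) :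
    HasBraid (ω ++ t) := by
  obtain ⟨u, v, i, j, hM, h⟩ := h
  exact ⟨u, v ++ t, i, j, hM, by simpa using h.append [] t⟩

theorem HasSquare.append {ω : List (Fin m)} (h : HasSquare ω) (t : List (Fin m)) :
    HasSquare (ω ++ t) := by
  obtain ⟨u, v, i, h⟩ := h
  exact ⟨u, v ++ t, i, by simpa using h.append [] t⟩

/-- A braid move on a distant pair is a commutation and one with i = j changes nothing; the first
other move on the way exhibits a side of a bond relation. -/
theorem wordEquiv_or_hasBraid_of_braidStep {α β : List (Fin m)}
    (h : Relation.ReflTransGen (CoxeterSystem.BraidStep (coxeterMatrix m)) α β) :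
    WordEquiv α β ∨ HasBraid α := by
  induction h using Relation.ReflTransGen.head_induction_on with
  | refl => exact .inl .refl
  | head hstep _ ih =>
    obtain ⟨u, v, i, j⟩ := hstep
    by_cases h3 : 3 ≤ coxeterMatrix m i j
    · exact .inr ⟨u, v, i, j, h3, .refl⟩
    have hcomm : WordEquiv (u ++ CoxeterSystem.braidWord (coxeterMatrix m) i j ++ v)
        (u ++ CoxeterSystem.braidWord (coxeterMatrix m) j i ++ v) := by
      by_cases hij : i = j
      · subst hij; exact .refl
      · have h2 : coxeterMatrix m i j = 2 := by
          rw [coxeterMatrix_apply] at h3 ⊢; grind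
        have h2' : coxeterMatrix m j i = 2 := by
          rw [CoxeterMatrix.symmetric]; exact h2
        have := WordStep.swap u v i j (distant_iff_coxeterMatrix_eq_two.mp h2)
        simp only [CoxeterSystem.braidWord, h2, h2', CoxeterSystem.alternatingWord,
          List.concat_eq_append, List.nil_append, List.append_assoc,
          List.cons_append]
        exact .single this
    rcases ih with ih | ⟨u', v', i', j', h3', ih⟩
    · exact .inl (hcomm.trans ih)
    · exact .inr ⟨u', v', i', j', h3', hcomm.trans ih⟩

theorem wordEquiv_or_hasBraid {α β : List (Fin m)} (hα : (cs m).IsReduced α)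
    (hβ : (cs m).IsReduced β) (h : (cs m).wordProd α = (cs m).wordProd β) :
    WordEquiv α β ∨ HasBraid α :=
  wordEquiv_or_hasBraid_of_braidStep
    (CoxeterSystem.braidStep_of_wordProd_eq alternatingReduced _ rfl hα hβ h)

/-- A word that is not a reduced word of a fully commutative element contains, up to commutations,
a square or one side of a braid relation. -/
theorem fullyCommutative_or_hasSquare_or_hasBraid (ω : List (Fin m)) :
    ((cs m).IsReduced ω ∧ (cs m).wordProd ω ∈ Wc m) ∨ HasSquare ω ∨ HasBraid ω := by
  have reduced : (cs m).IsReduced ω → (cs m).wordProd ω ∈ Wc m ∨ HasBraid ω := by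
    intro hω
    by_contra! hcon
    obtain ⟨hW, hB⟩ := hcon
    simp only [Wc, Set.mem_ofPred_eq, not_not] at hW
    obtain ⟨x₁, x₂, i, j, h3, hw, hlen⟩ := hW
    obtain ⟨u, hu, rfl⟩ := (cs m).exists_isReduced x₁
    obtain ⟨v, hv, rfl⟩ := (cs m).exists_isReduced x₂
    have hij : i ≠ j := by
      rintro rfl
      simp at h3
    have hb : (cs m).IsReduced (CoxeterSystem.braidWord (coxeterMatrix m) i j) :=
      (alternatingReduced i j hij).2 _ le_rfl
    have hprod : (cs m).wordProd ω =
        (cs m).wordProd (u ++ CoxeterSystem.braidWord (coxeterMatrix m) i j ++ v) := by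
      rw [hw, CoxeterSystem.wordProd_append, CoxeterSystem.wordProd_append]
    have hred : (cs m).IsReduced (u ++ CoxeterSystem.braidWord (coxeterMatrix m) i j ++ v) := by
      rw [CoxeterSystem.IsReduced, ← hprod, hlen, hu.eq, hv.eq, hb.eq]
      simp [add_assoc]
    rcases wordEquiv_or_hasBraid hω hred hprod with h | h
    · exact hB ⟨u, v, i, j, h3, h⟩
    · exact hB h
  induction ω using List.reverseRecOn with
  | nil =>
    have h : (cs m).IsReduced ([] : List (Fin m)) := by simp [CoxeterSystem.IsReduced]
    rcases reduced h with h' | h'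
    · exact .inl ⟨h, h'⟩
    · exact .inr (.inr h')
  | append_singleton ω i ih =>
    by_cases hred : (cs m).IsReduced (ω ++ [i])
    · rcases reduced hred with h' | h'
      · exact .inl ⟨hred, h'⟩
      · exact .inr (.inr h')
    right
    by_cases hω : (cs m).IsReduced ω
    -- If ω is reduced and ω i is not, then ω has the same product as some reduced word α i. If
    -- these agree up to commutations, ω i contains i i; otherwise ω contains a braid.
    · have hdesc : (cs m).IsRightDescent ((cs m).wordProd ω) i := by
        by_contra hd
        rw [CoxeterSystem.not_isRightDescent_iff] at hd
        apply hred
        rw [CoxeterSystem.IsReduced, CoxeterSystem.wordProd_append,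
          CoxeterSystem.wordProd_singleton, hd, hω.eq]
        simp
      obtain ⟨α, hα, hαw⟩ := (cs m).exists_isReduced ((cs m).wordProd ω * (cs m).simple i)
      have hprod : (cs m).wordProd ω = (cs m).wordProd (α ++ [i]) := by
        rw [CoxeterSystem.wordProd_append, CoxeterSystem.wordProd_singleton, ← hαw,
          CoxeterSystem.simple_mul_simple_cancel_right]
      have hαi : (cs m).IsReduced (α ++ [i]) := by
        rw [CoxeterSystem.isRightDescent_iff] at hdesc
        rw [CoxeterSystem.IsReduced, ← hprod, ← hdesc, hαw, hα.eq]
        simp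
      rcases wordEquiv_or_hasBraid hω hαi hprod with h | h
      · exact .inl ⟨α, [], i, by simpa using h.append [] [i]⟩
      · exact .inr (h.append [i])
    · have red' : (cs m).IsReduced ω → (cs m).wordProd ω ∈ Wc m ∨ HasBraid ω :=
        fun h ↦ absurd h hω
      rcases ih red' with h | h | h
      · exact absurd h.1 hω
      · exact .inl (h.append [i])
      · exact .inr (h.append [i])

theorem b_mul_self (i : Fin m) : (b i * b i : TL m) = δ • b i := by
  have := RingQuot.mkAlgHom_rel A (Rel.square i)
  simpa [b] using this

theorem b_mul_b_comm {i j : Fin m} (h : Distant i j) : (b i * b j : TL m) = b j * b i := by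
  have := RingQuot.mkAlgHom_rel A (Rel.commute i j h)
  simpa [b] using this

theorem b_mul_b_mul_b {i j : Fin m} (h : coxeterMatrix m i j = 3) :
    (b i * b j * b i : TL m) = b i := by
  rw [coxeterMatrix_apply] at h
  have := RingQuot.mkAlgHom_rel A (Rel.simpleBond i j (by grind) (by grind) (by grind))
  simpa [b] using this

theorem b_five {i j : Fin m} (h : coxeterMatrix m i j = 5) :
    (b i * b j * b i * b j * b i : TL m) = 3 * (b i * b j * b i) - b i := by
  rw [coxeterMatrix_apply] at h
  have := RingQuot.mkAlgHom_rel A (Rel.fiveBond i j (by grind))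
  simpa [b, map_ofNat] using this

theorem monomial_append (u v : List (Fin m)) : monomial (u ++ v) = monomial u * monomial v := by
  simp [monomial]

theorem monomial_cons (i : Fin m) (v : List (Fin m)) : monomial (i :: v) = b i * monomial v := by
  simp [monomial]

theorem WordEquiv.monomial_eq {α β : List (Fin m)} (h : WordEquiv α β) :
    monomial α = monomial β := by
  refine h.eq_of_step _ fun u v i j hij ↦ ?_
  simp only [monomial_append, monomial_cons]
  rw [← mul_assoc (b i), b_mul_b_comm hij, mul_assoc]

end TypeH

end

/-! ### Labelled matchings and their cut operators -/

noncomputable section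

namespace TypeH

/-- A perfect matching of a set of points whose arcs carry natural numbers as labels. -/
@[ext]
structure Matching (P : Type*) where
  /-- The other end of the arc at a point. -/
  mate : P → P
  /-- The label of the arc at a point. -/
  label : P → ℕ
  mate_mate (x : P) : mate (mate x) = x
  mate_ne (x : P) : mate x ≠ x
  label_mate (x : P) : label (mate x) = label x

namespace Matching

variable {P : Type*} [DecidableEq P]

/-- Join the arcs at `a` and `c` and put in a new arc from `a` to `c` with label `e`. -/
def cut (S : Matching P) (a c : P) (h : a ≠ c) (e : ℕ) : Matching P where
  mate x := if x = a then c else if x = c then a else if x = S.mate a then S.mate c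
    else if x = S.mate c then S.mate a else S.mate x
  label x := if x = a ∨ x = c then e
    else if x = S.mate a ∨ x = S.mate c then S.label a + S.label c else S.label x
  mate_mate x := by
    have h1 := S.mate_mate
    have h2 := S.mate_ne
    grind
  mate_ne x := by
    have h1 := S.mate_mate
    have h2 := S.mate_ne
    grind
  label_mate x := by
    have h1 := S.mate_mate
    have h2 := S.mate_ne
    have h3 := S.label_mate
    grind

/-- Increase the label of the arc at `a` by `k`. -/
def addLabel (S : Matching P) (a : P) (k : ℕ) : Matching P where
  mate := S.mate
  label x := if x = a ∨ x = S.mate a then S.label x + k else S.label x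
  mate_mate := S.mate_mate
  mate_ne := S.mate_ne
  label_mate x := by
    have h1 := S.mate_mate
    have h3 := S.label_mate
    grind

theorem addLabel_zero (S : Matching P) (a : P) : S.addLabel a 0 = S := by
  ext x
  · rfl
  · simp [addLabel]

theorem addLabel_addLabel (S : Matching P) (a : P) (k l : ℕ) :
    (S.addLabel a k).addLabel a l = S.addLabel a (k + l) := by
  ext x
  · rfl
  · simp only [addLabel]; grind

theorem cut_comm (S : Matching P) (a c : P) (h : a ≠ c) (e : ℕ) :
    S.cut a c h e = S.cut c a h.symm e := by
  have h1 := S.mate_mate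
  ext x
  · simp only [cut]; grind
  · simp only [cut]; grind

theorem cut_cut_comm (S : Matching P) {a c a' c' : P} (h : a ≠ c) (h' : a' ≠ c')
    (h1 : a ≠ a') (h2 : a ≠ c') (h3 : c ≠ a') (h4 : c ≠ c') (e e' : ℕ) :
    (S.cut a c h e).cut a' c' h' e' = (S.cut a' c' h' e').cut a c h e := by
  have i1 := S.mate_mate
  have i2 := S.mate_ne
  have i3 := S.label_mate
  ext x
  · simp only [cut]; grind (splits := 40)
  · simp only [cut]; grind (splits := 40)

/-- A zigzag is pulled straight: the arc from a to c is restored, and the labels e, e' end up on the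
strand through d. -/
theorem cut_cut_of_mate_eq (S : Matching P) {a c d : P} (h : a ≠ c) (h' : c ≠ d)
    (h1 : a ≠ d) (e e' : ℕ) (hm : S.mate a = c) (hl : S.label a = e) :
    (S.cut c d h' e').cut a c h e = S.addLabel d (e + e') := by
  have i1 := S.mate_mate
  have i2 := S.mate_ne
  have i3 := S.label_mate
  ext x
  · simp only [cut, addLabel]; grind
  · simp only [cut, addLabel]; grind

theorem cut_cut_self (S : Matching P) {a c : P} (h : a ≠ c) (e : ℕ) :
    (S.cut a c h e).cut a c h e = S.cut a c h e := by
  have i1 := S.mate_mate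
  have i2 := S.mate_ne
  ext x
  · simp only [cut]; grind
  · simp only [cut]; grind

@[simp]
theorem cut_mate_left (S : Matching P) {a c : P} (h : a ≠ c) (e : ℕ) :
    (S.cut a c h e).mate a = c := by simp [cut]

@[simp]
theorem cut_label_left (S : Matching P) {a c : P} (h : a ≠ c) (e : ℕ) :
    (S.cut a c h e).label a = e := by simp [cut]

end Matching

/-- The value of a closed loop with label `k` is `loopCoeff k` times `δ`. -/
def loopCoeff : ℕ → ℕ
  | 0 => 1
  | k + 1 => Nat.fib (2 * k + 1)

theorem loopCoeff_pos (k : ℕ) : 0 < loopCoeff k := by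
  cases k with
  | zero => simp [loopCoeff]
  | succ k => exact Nat.fib_pos.mpr (by lia)

theorem fib_add_four (n : ℕ) : Nat.fib (n + 4) + Nat.fib n = 3 * Nat.fib (n + 2) := by
  have h2 := Nat.fib_add_two (n := n)
  have h3 := Nat.fib_add_two (n := n + 1)
  have h4 := Nat.fib_add_two (n := n + 2)
  simp only [add_assoc] at h2 h3 h4
  norm_num at h2 h3 h4
  lia

/-- Fibonacci numbers of odd index satisfy the recursion that x² = 3x − 1 imposes. The initial
values 1, 1 make a loop with label 0 or 1 worth δ, as b_i² = δ b_i requires. -/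
theorem loopCoeff_add_two (k : ℕ) :
    (loopCoeff (k + 2) : A) = 3 * loopCoeff (k + 1) - loopCoeff k := by
  have : loopCoeff (k + 2) + loopCoeff k = 3 * loopCoeff (k + 1) := by
    cases k with
    | zero => rfl
    | succ k => exact fib_add_four (2 * k + 1)
  rw [eq_sub_iff_add_eq]
  have h := congrArg (Nat.cast : ℕ → A) this
  push_cast at h
  exact h

namespace Matching

variable {P : Type*} [DecidableEq P]

/-- The scalar that splits off when the arcs at `a` and `c` are joined. -/
def factor (S : Matching P) (a c : P) : A := if S.mate a = c then loopCoeff (S.label a) * δ else 1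

/-- The functions on matchings that satisfy the linear recursion of the labels on every arc. -/
def recursive (P : Type*) [DecidableEq P] : Submodule A (Matching P → A) where
  carrier := {F | ∀ S x, F (S.addLabel x 2) = 3 * F (S.addLabel x 1) - F S}
  zero_mem' := by simp
  add_mem' := by
    intro F G hF hG S x
    simp only [Pi.add_apply, hF S x, hG S x]
    ring
  smul_mem' := by
    intro r F hF S x
    simp only [Pi.smul_apply, hF S x, smul_eq_mul]
    ring

/-- A label either disappears into a loop that closes, where it acts through `loopCoeff`, or
survives on some arc. The linear recursion persists in both cases, so `cutOp` preserves `recursive`.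
-/
theorem cut_addLabel (S : Matching P) {a c : P} (h : a ≠ c) (e : ℕ) (x : P) :
    (∀ k, (S.addLabel x k).cut a c h e = S.cut a c h e ∧
      (S.addLabel x k).factor a c = loopCoeff (S.label a + k) * δ) ∨
    ∃ y, ∀ k, (S.addLabel x k).cut a c h e = (S.cut a c h e).addLabel y k ∧
      (S.addLabel x k).factor a c = S.factor a c := by
  have i1 := S.mate_mate
  have i2 := S.mate_ne
  have i3 := S.label_mate
  by_cases hac : S.mate a = c ∧ (x = a ∨ x = c)
  · left
    intro k
    constructor
    · ext y
      · rfl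
      · simp only [cut, addLabel]; grind (splits := 40)
    · simp only [factor, addLabel]; grind
  · right
    by_cases hxa : x = a ∨ x = S.mate a
    · refine ⟨S.mate a, fun k ↦ ⟨?_, ?_⟩⟩
      · ext y
        · rfl
        · simp only [cut, addLabel]; grind (splits := 40)
      · simp only [factor, addLabel]; grind
    · by_cases hxc : x = c ∨ x = S.mate c
      · refine ⟨S.mate c, fun k ↦ ⟨?_, ?_⟩⟩
        · ext y
          · rfl
          · simp only [cut, addLabel]; grind (splits := 40)
        · simp only [factor, addLabel]; grind
      · refine ⟨x, fun k ↦ ⟨?_, ?_⟩⟩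
        · ext y
          · rfl
          · simp only [cut, addLabel]; grind (splits := 40)
        · simp only [factor, addLabel]; grind

/-- The operator on functions given by `cut`. -/
def cutOp (a c : P) (h : a ≠ c) (e : ℕ) : Module.End A (recursive P) where
  toFun F := ⟨fun S ↦ S.factor a c * F.1 (S.cut a c h e), by
    intro S x
    rcases S.cut_addLabel h e x with hx | ⟨y, hx⟩
    · have h0 := hx 0
      rw [addLabel_zero] at h0
      simp only [(hx 1).1, (hx 2).1, (hx 1).2, (hx 2).2, h0.2, add_zero, loopCoeff_add_two]
      ring
    · simp only [(hx 1).1, (hx 2).1, (hx 1).2, (hx 2).2, F.2 _ y]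
      ring⟩
  map_add' F G := by
    ext S : 2
    simp [mul_add]
  map_smul' r F := by
    ext S : 2
    simp [mul_left_comm]

theorem cutOp_apply (a c : P) (h : a ≠ c) (e : ℕ) (F : recursive P) (S : Matching P) :
    (cutOp a c h e F).1 S = S.factor a c * F.1 (S.cut a c h e) := rfl

theorem cutOp_symm (a c : P) (h : a ≠ c) (e : ℕ) : cutOp a c h e = cutOp c a h.symm e := by
  ext F S : 3
  rw [cutOp_apply, cutOp_apply, S.cut_comm]
  congr 1
  have i1 := S.mate_mate
  have i3 := S.label_mate
  simp only [factor]
  grind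

theorem cutOp_mul_self (a c : P) (h : a ≠ c) {e : ℕ} (he : e ≤ 1) :
    cutOp a c h e * cutOp a c h e = δ • cutOp a c h e := by
  ext F S : 3
  have hf : (S.cut a c h e).factor a c = δ := by
    have : loopCoeff e = 1 := by interval_cases e <;> rfl
    simp [factor, this]
  change S.factor a c * ((S.cut a c h e).factor a c * F.1 ((S.cut a c h e).cut a c h e)) =
    δ * (S.factor a c * F.1 (S.cut a c h e))
  rw [cut_cut_self, hf]
  ring

theorem cutOp_comm {a c a' c' : P} (h : a ≠ c) (h' : a' ≠ c')
    (h1 : a ≠ a') (h2 : a ≠ c') (h3 : c ≠ a') (h4 : c ≠ c') (e e' : ℕ) :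
    cutOp a c h e * cutOp a' c' h' e' = cutOp a' c' h' e' * cutOp a c h e := by
  ext F S : 3
  change S.factor a c * ((S.cut a c h e).factor a' c' * F.1 ((S.cut a c h e).cut a' c' h' e')) =
    S.factor a' c' * ((S.cut a' c' h' e').factor a c * F.1 ((S.cut a' c' h' e').cut a c h e))
  rw [cut_cut_comm S h h' h1 h2 h3 h4, ← mul_assoc, ← mul_assoc]
  congr 1
  have i1 := S.mate_mate
  have i2 := S.mate_ne
  have i3 := S.label_mate
  simp only [factor, cut]
  grind (splits := 40)

/-- No loop closes while a zigzag is straightened. -/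
theorem factor_cut_of_mate_eq (S : Matching P) {a c d : P} (h' : c ≠ d)
    (h1 : a ≠ d) (e' : ℕ) (hm : S.mate a = c) :
    S.factor c d * (S.cut c d h' e').factor a c = 1 := by
  have i1 := S.mate_mate
  have i2 := S.mate_ne
  simp only [factor, cut]
  grind

theorem cutOp_mul_cutOp_apply {a c d : P} (h : a ≠ c) (h' : c ≠ d) (h1 : a ≠ d) (e e' : ℕ)
    (F : recursive P) {S : Matching P} (hm : S.mate a = c) (hl : S.label a = e) :
    (cutOp c d h' e' (cutOp a c h e F)).1 S = F.1 (S.addLabel d (e + e')) := by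
  rw [cutOp_apply, cutOp_apply, cut_cut_of_mate_eq S h h' h1 e e' hm hl, ← mul_assoc,
    factor_cut_of_mate_eq S h' h1 e' hm, one_mul]

theorem cutOp_mul_mul {a c d : P} (h : a ≠ c) (h' : c ≠ d) (h1 : a ≠ d) :
    cutOp a c h 0 * cutOp c d h' 0 * cutOp a c h 0 = cutOp a c h 0 := by
  ext F S : 3
  change S.factor a c * (cutOp c d h' 0 (cutOp a c h 0 F)).1 (S.cut a c h 0) = _
  rw [cutOp_mul_cutOp_apply h h' h1 0 0 F (by simp) (by simp), addLabel_zero, cutOp_apply]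

/-- Each passage back and forth returns to the same arcs with one more label at d, so the relation
becomes the recursion imposed in `recursive`. -/
theorem cutOp_five {a c d : P} (h : a ≠ c) (h' : c ≠ d) (h1 : a ≠ d) {e e' : ℕ}
    (he : e + e' = 1) :
    cutOp a c h e * cutOp c d h' e' * cutOp a c h e * cutOp c d h' e' * cutOp a c h e =
      3 * (cutOp a c h e * cutOp c d h' e' * cutOp a c h e) - cutOp a c h e := by
  have hthree : (3 : Module.End A (recursive P)) = (3 : A) • 1 := by
    ext F : 1
    simp [Module.End.ofNat_apply]
    norm_cast
  rw [hthree, smul_mul_assoc, one_mul]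
  ext F S : 3
  change S.factor a c * (cutOp c d h' e' (cutOp a c h e (cutOp c d h' e' (cutOp a c h e F)))).1
      (S.cut a c h e) =
    3 * (S.factor a c * (cutOp c d h' e' (cutOp a c h e F)).1 (S.cut a c h e)) -
      S.factor a c * F.1 (S.cut a c h e)
  set U := S.cut a c h e with hU
  have hm : U.mate a = c := by simp [hU]
  have hl : U.label a = e := by simp [hU]
  have hd : a ≠ U.mate d := by
    intro hd
    have i1 := U.mate_mate d
    rw [← hd, hm] at i1
    exact h' i1
  have hl' : (U.addLabel d 1).label a = e := by simp [addLabel, h1, hd, hl]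
  rw [cutOp_mul_cutOp_apply h h' h1 e e' _ hm hl, cutOp_mul_cutOp_apply h h' h1 e e' F hm hl, he,
    cutOp_mul_cutOp_apply h h' h1 e e' F (S := U.addLabel d 1) hm hl', he, addLabel_addLabel, F.2 U d]
  ring

end Matching

end TypeH

end

/-! ### The diagram representation of TL(H_m) and the functionals that detect δ -/

noncomputable section

namespace TypeH

variable {m : ℕ}

/-- The end points of the strands: `m + 1` at the top and `m + 1` at the bottom. -/
abbrev Pt (m : ℕ) : Type := Fin (m + 1) × Bool

/-- The left leg of the letter `i`. -/
abbrev leftLeg (i : Fin m) : Pt m := (i.castSucc, true)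

/-- The right leg of the letter `i`. -/
abbrev rightLeg (i : Fin m) : Pt m := (i.succ, true)

theorem leftLeg_ne_rightLeg (i : Fin m) : leftLeg i ≠ rightLeg i := by
  simp [Fin.ext_iff]

/-- The label of the arcs of `b_{i+1}`. -/
def arcLabel (i : Fin m) : ℕ := if (i : ℕ) = 0 then 1 else 0

/-- The operator of `b_{i+1}`. -/
def genOp (i : Fin m) : Module.End A (Matching.recursive (Pt m)) :=
  Matching.cutOp (leftLeg i) (rightLeg i) (leftLeg_ne_rightLeg i) (arcLabel i)

namespace Matching

theorem cutOp_mul_mul_of_eq {P : Type*} [DecidableEq P] {a c c' d : P} (h : a ≠ c) (h' : c' ≠ d)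
    (h1 : a ≠ d) (e1 : c = c') :
    cutOp a c h 0 * cutOp c' d h' 0 * cutOp a c h 0 = cutOp a c h 0 := by
  subst e1
  exact cutOp_mul_mul h h' h1

theorem cutOp_five_of_eq {P : Type*} [DecidableEq P] {a c c' d : P} (h : a ≠ c) (h' : c' ≠ d)
    (h1 : a ≠ d) {e e' : ℕ} (he : e + e' = 1) (e1 : c = c') :
    cutOp a c h e * cutOp c' d h' e' * cutOp a c h e * cutOp c' d h' e' * cutOp a c h e =
      3 * (cutOp a c h e * cutOp c' d h' e' * cutOp a c h e) - cutOp a c h e := by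
  subst e1
  exact cutOp_five h h' h1 he

end Matching

open Matching in
theorem genOp_rel {x y : FreeAlgebra A (Fin m)} (h : Rel m x y) :
    FreeAlgebra.lift A genOp x = FreeAlgebra.lift A genOp y := by
  cases h with
  | square i =>
    simp only [map_mul, map_smul, FreeAlgebra.lift_ι_apply]
    exact cutOp_mul_self _ _ _ (by simp only [arcLabel]; split_ifs <;> simp)
  | commute i j h =>
    simp only [map_mul, FreeAlgebra.lift_ι_apply]
    apply cutOp_comm <;> simp [Fin.ext_iff] <;> lia
  | simpleBond i j hi hj h =>
    simp only [map_mul, FreeAlgebra.lift_ι_apply]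
    have ei : arcLabel i = 0 := by simp [arcLabel]; lia
    have ej : arcLabel j = 0 := by simp [arcLabel]; lia
    simp only [genOp, ei, ej]
    rcases h with h | h
    · exact cutOp_mul_mul_of_eq _ _ (by simp [Fin.ext_iff]; lia) (by simp [Fin.ext_iff, h])
    · rw [cutOp_symm (leftLeg i), cutOp_symm (leftLeg j)]
      exact cutOp_mul_mul_of_eq _ _ (by simp [Fin.ext_iff]; lia) (by simp [Fin.ext_iff, h])
  | fiveBond i j h =>
    simp only [map_mul, map_sub, map_ofNat, FreeAlgebra.lift_ι_apply]
    have he : arcLabel i + arcLabel j = 1 := by simp only [arcLabel]; grind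
    simp only [genOp]
    rcases h with h | h
    · exact cutOp_five_of_eq _ _ (by simp [Fin.ext_iff]; lia) he (by simp [Fin.ext_iff, h])
    · rw [cutOp_symm (leftLeg i), cutOp_symm (leftLeg j)]
      exact cutOp_five_of_eq _ _ (by simp [Fin.ext_iff]; lia) he (by simp [Fin.ext_iff, h])

/-- The representation of `TL(H_m)` on functions of matchings. -/
def tlRep (m : ℕ) : TL m →ₐ[A] Module.End A (Matching.recursive (Pt m)) :=
  RingQuot.liftAlgHom A ⟨FreeAlgebra.lift A genOp, fun _ _ h ↦ genOp_rel h⟩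

theorem tlRep_b (i : Fin m) : tlRep m (b i) = genOp i := by
  simp [tlRep, b]

/-- The action of a letter on a matching. -/
def act (i : Fin m) (S : Matching (Pt m)) : Matching (Pt m) :=
  S.cut (leftLeg i) (rightLeg i) (leftLeg_ne_rightLeg i) (arcLabel i)

/-- The matching after reading a word. -/
def run : List (Fin m) → Matching (Pt m) → Matching (Pt m)
  | [], S => S
  | i :: ω, S => run ω (act i S)

open Classical in
/-- The number of loops closed while reading a word. -/
def loops : List (Fin m) → Matching (Pt m) → ℕ
  | [], _ => 0
  | i :: ω, S => (if S.mate (leftLeg i) = rightLeg i then 1 else 0) + loops ω (act i S)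

/-- The integer is the product of the coefficients of the closed loops; its value plays no role
beyond its being positive. -/
theorem tlRep_monomial (ω : List (Fin m)) (F : Matching.recursive (Pt m)) (S : Matching (Pt m)) :
    ∃ n : ℕ, 0 < n ∧ (tlRep m (monomial ω) F).1 S = n * δ ^ loops ω S * F.1 (run ω S) := by
  induction ω generalizing S with
  | nil => exact ⟨1, one_pos, by simp [monomial, loops, run]⟩
  | cons i ω ih =>
    obtain ⟨n, hn, h⟩ := ih (act i S)
    rw [monomial_cons, map_mul, tlRep_b]
    have : (genOp i * tlRep m (monomial ω)) F = genOp i (tlRep m (monomial ω) F) := rfl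
    rw [this, genOp, Matching.cutOp_apply]
    change ∃ k : ℕ, 0 < k ∧ _ * (tlRep m (monomial ω) F).1 (act i S) = _
    rw [h]
    by_cases hc : S.mate (leftLeg i) = rightLeg i
    · refine ⟨loopCoeff (S.label (leftLeg i)) * n, Nat.mul_pos (loopCoeff_pos _) hn, ?_⟩
      simp only [Matching.factor, hc, if_true, loops, run, pow_add, pow_one]
      push_cast
      ring
    · exact ⟨n, hn, by simp [Matching.factor, hc, loops, run]⟩

/-- The sum of all labels; every arc counts twice. -/
def totalLabel (S : Matching (Pt m)) : ℕ := ∑ x, S.label x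

theorem totalLabel_addLabel (S : Matching (Pt m)) (x : Pt m) (k : ℕ) :
    totalLabel (S.addLabel x k) = totalLabel S + 2 * k := by
  have h : ∀ y, (S.addLabel x k).label y =
      S.label y + ((if y = x then k else 0) + (if y = S.mate x then k else 0)) := by
    intro y
    have := S.mate_ne x
    simp only [Matching.addLabel]
    grind
  simp only [totalLabel, h, Finset.sum_add_distrib, Finset.sum_ite_eq', Finset.mem_univ, if_true]
  ring

open Classical in
/-- The function that picks out the matchings with the given arcs. -/
def indicator (f : Pt m → Pt m) : Matching.recursive (Pt m) :=
  -- Each arc counts twice in `totalLabel`, so one more label raises the Fibonacci index by two,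
  -- which fits the recursion. The shift by one keeps the weight positive.
  ⟨fun S ↦ if S.mate = f then (Nat.fib (totalLabel S + 1) : A) else 0, by
    intro S x
    have h : ∀ k, (S.addLabel x k).mate = S.mate := fun _ ↦ rfl
    simp only [h, totalLabel_addLabel]
    split_ifs
    · have := congrArg (Nat.cast : ℕ → A) (fib_add_four (totalLabel S + 1))
      rw [eq_sub_iff_add_eq]
      push_cast at this
      convert this using 4
    · simp⟩

/-- The matching of the empty word. -/
def initial (m : ℕ) : Matching (Pt m) where
  mate x := (x.1, !x.2)
  label _ := 0
  mate_mate x := by simp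
  mate_ne x := by simp [Prod.ext_iff]
  label_mate _ := rfl

theorem exists_polynomial_of_mem_Aminus {a : A} (h : a ∈ Aminus) :
    ∃ p : Polynomial ℤ, a = Polynomial.aeval (LaurentPolynomial.T (-1) : A) p := by
  have h' : a ∈ Algebra.adjoin ℤ {(LaurentPolynomial.T (-1) : A)} := h
  simp only [Algebra.adjoin_singleton_eq_range_aeval] at h'
  obtain ⟨p, hp⟩ := h'
  exact ⟨p, hp.symm⟩

/-- δ is fixed by v ↔ v⁻¹. If n δᵏ were a polynomial in v⁻¹, it would equal a polynomial p in v, and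
n (v² + 1)ᵏ = vᵏ p(v) fails at v = 0. -/
theorem natCast_mul_δ_pow_notMem {n k : ℕ} (hn : 0 < n) (hk : 0 < k) :
    (n : A) * δ ^ k ∉ Aminus := by
  intro h
  obtain ⟨p, hp⟩ := exists_polynomial_of_mem_Aminus h
  have h1 := congrArg (LaurentPolynomial.invert (R := ℤ)) hp
  have hinv : LaurentPolynomial.invert (R := ℤ) δ = δ := by
    rw [δ, map_add, LaurentPolynomial.invert_T, LaurentPolynomial.invert_T, neg_neg, add_comm]
  have hp' : LaurentPolynomial.invert (R := ℤ)
      (Polynomial.aeval (LaurentPolynomial.T (-1) : A) p) = Polynomial.toLaurent p := by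
    have : ((LaurentPolynomial.invert (R := ℤ)).toAlgHom.comp
        (Polynomial.aeval (LaurentPolynomial.T (-1) : A))) = Polynomial.toLaurentAlg := by
      ext
      simp
    exact DFunLike.congr_fun this p
  rw [hp', map_mul, map_pow, hinv, map_natCast] at h1
  have hδ : LaurentPolynomial.T 1 * δ = Polynomial.toLaurent (Polynomial.X ^ 2 + 1 : Polynomial ℤ) := by
    rw [δ, mul_add, ← LaurentPolynomial.T_add, ← LaurentPolynomial.T_add, map_add, map_pow,
      Polynomial.toLaurent_X, LaurentPolynomial.T_pow]
    simp
  have h2 : Polynomial.toLaurent ((n : Polynomial ℤ) * (Polynomial.X ^ 2 + 1) ^ k) =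
      Polynomial.toLaurent (Polynomial.X ^ k * p) := by
    rw [map_mul, map_mul, map_pow, map_pow, ← hδ, ← h1, mul_pow, map_natCast,
      Polynomial.toLaurent_X]
    ring
  have h3 := congrArg (Polynomial.eval 0) (Polynomial.toLaurent_injective h2)
  simp [hk.ne'] at h3
  lia

/-- The functional on `TL(H_m)` that picks out the monomials with the given arcs. -/
def functional (f : Pt m → Pt m) : TL m →ₗ[A] A where
  toFun x := (tlRep m x (indicator f)).1 (initial m)
  map_add' x y := by simp
  map_smul' r x := by simp

theorem functional_monomial (f : Pt m → Pt m) (ω : List (Fin m)) :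
    ∃ n : ℕ, 0 < n ∧ functional f (monomial ω) =
      n * δ ^ loops ω (initial m) * (indicator f).1 (run ω (initial m)) :=
  tlRep_monomial ω (indicator f) (initial m)

/-- Positive powers of v can only come from loops. A fully commutative monomial closes none, so the
functional takes a natural number on it. -/
theorem functional_mem_Aminus (hloop : ∀ ω : List (Fin m), (cs m).IsReduced ω →
    (cs m).wordProd ω ∈ Wc m → loops ω (initial m) = 0) (f : Pt m → Pt m) {x : TL m}
    (hx : x ∈ lattice m) : functional f x ∈ Aminus := by
  induction hx using Submodule.span_induction with
  | mem x hx =>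
    obtain ⟨ω, h1, h2, rfl⟩ := hx
    obtain ⟨n, -, h⟩ := functional_monomial f ω
    rw [h, hloop ω h1 h2, pow_zero, mul_one]
    refine mul_mem (natCast_mem _ n) ?_
    simp only [indicator]
    split_ifs
    · exact natCast_mem _ _
    · exact zero_mem _
  | zero => simp
  | add x y _ _ hx hy => rw [map_add]; exact add_mem hx hy
  | smul a x _ hx =>
    have : functional f (a • x) = (a : A) * functional f x := by
      rw [← smul_eq_mul, ← map_smul]; rfl
    rw [this]
    exact mul_mem a.2 hx

/-- A multiple of a monomial by `δ` does not lie in the lattice. -/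
theorem δ_smul_monomial_notMem (hloop : ∀ ω : List (Fin m), (cs m).IsReduced ω →
    (cs m).wordProd ω ∈ Wc m → loops ω (initial m) = 0) (ω : List (Fin m)) :
    δ • monomial ω ∉ lattice m := by
  intro hx
  -- The functional for the arcs of the word itself does not vanish on its monomial.
  have h := functional_mem_Aminus hloop (run ω (initial m)).mate hx
  obtain ⟨n, hn, hf⟩ := functional_monomial (run ω (initial m)).mate ω
  rw [map_smul, hf] at h
  simp only [indicator, if_true, smul_eq_mul] at h
  refine natCast_mul_δ_pow_notMem (n := n * Nat.fib (totalLabel (run ω (initial m)) + 1))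
    (k := loops ω (initial m) + 1) (Nat.mul_pos hn (Nat.fib_pos.mpr (by lia))) (by lia) ?_
  convert h using 1
  push_cast
  ring

end TypeH

end

/-! ### Invariance of the number of loops -/

noncomputable section

namespace TypeH

variable {m : ℕ}

theorem Matching.mate_cut_cut_of_mate_eq {P : Type*} [DecidableEq P] (S : Matching P) {a c d : P}
    (h : a ≠ c) (h' : c ≠ d) (h1 : a ≠ d) (e e' : ℕ) (hm : S.mate a = c) :
    S.mate c ≠ d ∧ (S.cut c d h' e').mate a ≠ c ∧
      ((S.cut c d h' e').cut a c h e).mate = S.mate := by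
  have i1 := S.mate_mate
  have i2 := S.mate_ne
  refine ⟨?_, ?_, ?_⟩
  · grind
  · simp only [cut]; grind
  · ext x : 1
    simp only [cut]; grind

theorem mate_act_congr {S S' : Matching (Pt m)} (h : S.mate = S'.mate) (i : Fin m) :
    (act i S).mate = (act i S').mate := by
  ext x : 1
  simp only [act, Matching.cut, h]

theorem loops_congr (ω : List (Fin m)) {S S' : Matching (Pt m)} (h : S.mate = S'.mate) :
    loops ω S = loops ω S' := by
  induction ω generalizing S S' with
  | nil => rfl
  | cons i ω ih => simp only [loops, h, ih (mate_act_congr h i)]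

theorem loops_append (u v : List (Fin m)) (S : Matching (Pt m)) :
    loops (u ++ v) S = loops u S + loops v (run u S) := by
  induction u generalizing S with
  | nil => simp [loops, run]
  | cons i u ih => simp only [List.cons_append, loops, run, ih, add_assoc]

theorem mate_act_leftLeg (S : Matching (Pt m)) (i : Fin m) :
    (act i S).mate (leftLeg i) = rightLeg i := by simp [act]

theorem act_comm (S : Matching (Pt m)) {i j : Fin m} (h : Distant i j) :
    act i (act j S) = act j (act i S) := by
  unfold Distant at h
  apply Matching.cut_cut_comm <;> simp [Fin.ext_iff] <;> lia

/-- The two equivalences together say that two disjoint cuts close equally many loops in either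
order. -/
theorem Matching.mate_cut_of_distinct {P : Type*} [DecidableEq P] (S : Matching P) {a c a' c' : P}
    (h : a ≠ c) (h' : a' ≠ c') (h1 : a ≠ a') (h2 : a ≠ c') (h3 : c ≠ a') (h4 : c ≠ c') (e e' : ℕ) :
    (S.mate a = c ∧ (S.cut a c h e).mate a' = c' ↔ S.mate a' = c' ∧ (S.cut a' c' h' e').mate a = c)
    ∧ (S.mate a = c ∨ (S.cut a c h e).mate a' = c' ↔
      S.mate a' = c' ∨ (S.cut a' c' h' e').mate a = c) := by
  have i1 := S.mate_mate
  have i2 := S.mate_ne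
  simp only [cut]
  grind (splits := 40)

theorem loops_comm (S : Matching (Pt m)) {i j : Fin m} (h : Distant i j) (v : List (Fin m)) :
    loops (i :: j :: v) S = loops (j :: i :: v) S := by
  simp only [loops, act_comm S h, ← add_assoc]
  congr 1
  unfold Distant at h
  have key := S.mate_cut_of_distinct (leftLeg_ne_rightLeg i) (leftLeg_ne_rightLeg j)
    (by simp [Fin.ext_iff]; lia) (by simp [Fin.ext_iff]; lia) (by simp [Fin.ext_iff]; lia)
    (by simp [Fin.ext_iff]; lia) (arcLabel i) (arcLabel j)
  change (S.mate (leftLeg i) = rightLeg i ∧ (act i S).mate (leftLeg j) = rightLeg j ↔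
    S.mate (leftLeg j) = rightLeg j ∧ (act j S).mate (leftLeg i) = rightLeg i) ∧
    (S.mate (leftLeg i) = rightLeg i ∨ (act i S).mate (leftLeg j) = rightLeg j ↔
    S.mate (leftLeg j) = rightLeg j ∨ (act j S).mate (leftLeg i) = rightLeg i) at key
  obtain ⟨k1, k2⟩ := key
  split_ifs <;> first | rfl | (exfalso; tauto)

theorem WordEquiv.loops_eq {α β : List (Fin m)} (h : WordEquiv α β) (S : Matching (Pt m)) :
    loops α S = loops β S := by
  refine h.eq_of_step (fun ω ↦ loops ω S) fun u v i j hij ↦ ?_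
  simp only [loops_append, loops_comm _ hij]

theorem loops_pos_of_square (u v : List (Fin m)) (i : Fin m) (S : Matching (Pt m)) :
    0 < loops (u ++ [i, i] ++ v) S := by
  simp [loops_append, loops, mate_act_leftLeg]

/-- After the first i, the letters j i pull a zigzag straight: no loop closes and the arcs return to
what they were. -/
theorem loops_adjacent {i j : Fin m} (h : (i : ℕ) + 1 = j ∨ (j : ℕ) + 1 = i)
    (v : List (Fin m)) (S : Matching (Pt m)) :
    loops (i :: j :: i :: v) S = loops (i :: v) S := by
  have hm := mate_act_leftLeg S i
  simp only [loops]
  generalize act i S = U at hm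
  have hm' : U.mate (rightLeg i) = leftLeg i := by rw [← hm, U.mate_mate]
  obtain ⟨k1, k2, k3⟩ : U.mate (leftLeg j) ≠ rightLeg j ∧
      (act j U).mate (leftLeg i) ≠ rightLeg i ∧ (act i (act j U)).mate = U.mate := by
    rcases h with h | h
    · have e : leftLeg j = rightLeg i := by simp [Fin.ext_iff, h]
      have n1 : leftLeg i ≠ rightLeg j := by simp [Fin.ext_iff]; lia
      have n2 := leftLeg_ne_rightLeg j
      have key := U.mate_cut_cut_of_mate_eq (leftLeg_ne_rightLeg i) (e ▸ n2) n1 (arcLabel i)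
        (arcLabel j) hm
      simpa only [act, e] using key
    · have e : rightLeg j = leftLeg i := by simp [Fin.ext_iff, h]
      have n1 : rightLeg i ≠ leftLeg j := by simp [Fin.ext_iff]; lia
      have n2 := (leftLeg_ne_rightLeg j).symm
      obtain ⟨q1, q2, q3⟩ := U.mate_cut_cut_of_mate_eq (leftLeg_ne_rightLeg i).symm (e ▸ n2) n1
        (arcLabel i) (arcLabel j) hm'
      have hact : act j U = U.cut (leftLeg i) (leftLeg j) (e ▸ n2) (arcLabel j) := by
        simp only [act]
        rw [U.cut_comm]
        simp only [e]
      have hact' : ∀ V, act i V = V.cut (rightLeg i) (leftLeg i) (leftLeg_ne_rightLeg i).symm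
        (arcLabel i) := fun V ↦ V.cut_comm _ _ _ _
      rw [hact', hact]
      refine ⟨fun hc ↦ q1 ?_, fun hc ↦ q2 ?_, q3⟩
      · rw [← e, ← hc, U.mate_mate]
      · rw [← hc, Matching.mate_mate]
  simp [k1, k2, loops_congr v k3]

theorem loops_append_adjacent {i j : Fin m} (h : (i : ℕ) + 1 = j ∨ (j : ℕ) + 1 = i)
    (u v : List (Fin m)) (S : Matching (Pt m)) :
    loops (u ++ i :: j :: i :: v) S = loops (u ++ i :: v) S := by
  rw [loops_append, loops_append, loops_adjacent h]

theorem mul_five_relation {S R : Type*} [CommRing S] [Ring R] [Algebra S R] {x y : R} (u z : R)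
    (h : x * y * x * y * x = 3 * (x * y * x) - x) :
    u * (x * (y * (x * (y * (x * z))))) =
      (3 : S) • (u * (x * (y * (x * z)))) + (-1 : S) • (u * (x * z)) := by
  have h' := congrArg (fun t ↦ u * (t * z)) h
  have h3 : (3 : S) • (u * (x * (y * (x * z)))) = u * (3 * (x * (y * (x * z)))) := by
    rw [Algebra.smul_def, map_ofNat, ← Nat.cast_ofNat, ← mul_assoc, Nat.cast_comm, mul_assoc]
  rw [h3, neg_smul, one_smul]
  simpa only [mul_assoc, sub_eq_add_neg, add_mul, mul_add, neg_mul, mul_neg] using h'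

/-- A monomial whose word closes no loop lies in the lattice. -/
theorem monomial_mem_lattice (ω : List (Fin m)) (h : loops ω (initial m) = 0) :
    monomial ω ∈ lattice m := by
  induction hn : ω.length using Nat.strong_induction_on generalizing ω with
  | _ n ih =>
    rcases fullyCommutative_or_hasSquare_or_hasBraid ω with hω | ⟨u, v, i, hω⟩ |
      ⟨u, v, i, j, hM, hω⟩
    · exact Submodule.subset_span ⟨ω, hω.1, hω.2, rfl⟩
    · rw [hω.loops_eq] at h
      exact absurd h (loops_pos_of_square u v i _).ne'
    -- Both bond relations lead to words in which some i j i has been shortened to i. These close no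
    -- loop either, and the coefficients 1, 3, −1 lie in 𝒜⁻.
    · have hlen := hω.length_eq
      rw [hω.loops_eq] at h
      rw [hω.monomial_eq]
      have hcases : (coxeterMatrix m i j = 3 ∨ coxeterMatrix m i j = 5) ∧
          ((j : ℕ) + 1 = i ∨ (i : ℕ) + 1 = j) := by
        have := Fin.ext_iff (a := i) (b := j)
        rw [coxeterMatrix_apply] at hM ⊢
        grind
      obtain ⟨hc | hc, hadj⟩ := hcases
      · simp only [CoxeterSystem.braidWord, hc, CoxeterSystem.alternatingWord,
          List.concat_eq_append, List.nil_append, List.append_assoc, List.cons_append] at h hlen ⊢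
        have e : monomial (u ++ j :: i :: j :: v) = monomial (u ++ j :: v) := by
          rw [CoxeterMatrix.symmetric] at hc
          simp only [monomial_append, monomial_cons]
          rw [← mul_assoc (b j), ← mul_assoc (b j * b i), b_mul_b_mul_b hc]
        rw [e]
        rw [loops_append_adjacent hadj] at h
        exact ih _ (by simp at hlen ⊢; lia) _ h rfl
      · simp only [CoxeterSystem.braidWord, hc, CoxeterSystem.alternatingWord,
          List.concat_eq_append, List.nil_append, List.append_assoc, List.cons_append] at h hlen ⊢
        have e : monomial (u ++ j :: i :: j :: i :: j :: v) =
            (3 : Aminus) • monomial (u ++ j :: i :: j :: v) +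
              (-1 : Aminus) • monomial (u ++ j :: v) := by
          rw [CoxeterMatrix.symmetric] at hc
          simp only [monomial_append, monomial_cons]
          exact mul_five_relation (R := TL m) (x := b j) (y := b i) _ _ (b_five hc)
        rw [loops_append_adjacent hadj] at h
        have h' := h
        rw [loops_append_adjacent hadj] at h'
        have m1 := ih _ (by simp at hlen ⊢; lia) _ h rfl
        have m2 := ih _ (by simp at hlen ⊢; lia) _ h' rfl
        rw [e]
        exact add_mem (Submodule.smul_mem _ _ m1) (Submodule.smul_mem _ _ m2)

end TypeH

end

/-! ### Spacing of letters in fully commutative words -/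

noncomputable section

namespace TypeH

/-- The positions `q < q'` carry consecutive occurrences of the letter `i`. -/
structure Consecutive (L : ℤ → ℕ) (i : ℕ) (q q' : ℤ) : Prop where
  lt : q < q'
  left : L q = i
  right : L q' = i
  between : ∀ s, q < s → s < q' → L s ≠ i

/-- A word in the letters `1, 2, …`, written as a function on positions with `0` for the empty
positions, in which the occurrences of letters are spaced as in a fully commutative element. -/
structure Spaced (L : ℤ → ℕ) : Prop where
  -- Without a neighbour between them, two equal letters could be moved together; with a single
  -- neighbour they would form a side of a bond relation, unless the bond is {1, 2}.
  exists_adjacent : ∀ {i q q'}, 1 ≤ i → Consecutive L i q q' →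
    ∃ s, q < s ∧ s < q' ∧ 1 ≤ L s ∧ (L s = i + 1 ∨ L s + 1 = i) ∧
      ((i ≤ 2 ∧ L s ≤ 2) ∨
        ∃ s', s' ≠ s ∧ q < s' ∧ s' < q' ∧ 1 ≤ L s' ∧ (L s' = i + 1 ∨ L s' + 1 = i))
  -- This excludes 1 2 1 2 1. The other side 2 1 2 1 2 of the relation is not needed.
  no_alternating : ∀ {a q o q' e}, Consecutive L 1 a o → Consecutive L 1 o e → L q = 2 → L q' = 2 →
    a < q → q < o → o < q' → q' < e → (∀ s, a < s → s < e → L s = 2 → s = q ∨ s = q') →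
    (∀ s, q < s → s < q' → L s ≠ 3) → False

/-- The reversed word. -/
def flip (L : ℤ → ℕ) (t : ℤ) : ℕ := L (-t)

theorem Consecutive.flip {L : ℤ → ℕ} {i : ℕ} {q q' : ℤ} (h : Consecutive L i q q') :
    Consecutive (flip L) i (-q') (-q) where
  lt := by have := h.lt; lia
  left := by simp [TypeH.flip, h.right]
  right := by simp [TypeH.flip, h.left]
  between s h1 h2 := h.between (-s) (by lia) (by lia)

theorem flip_flip (L : ℤ → ℕ) : flip (flip L) = L := by
  ext t
  simp [flip]

theorem Consecutive.of_flip {L : ℤ → ℕ} {i : ℕ} {q q' : ℤ} (h : Consecutive (TypeH.flip L) i q q') :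
    Consecutive L i (-q') (-q) := by
  have := h.flip
  rwa [flip_flip] at this

theorem Spaced.flip {L : ℤ → ℕ} (hL : Spaced L) : Spaced (flip L) where
  exists_adjacent hi h := by
    obtain ⟨s, h1, h2, h3, h4, h5⟩ := hL.exists_adjacent hi h.of_flip
    refine ⟨-s, by lia, by lia, by simpa [TypeH.flip] using h3, by simpa [TypeH.flip] using h4, ?_⟩
    rcases h5 with h5 | ⟨s', k1, k2, k3, k4, k5⟩
    · exact .inl (by simpa [TypeH.flip] using h5)
    · exact .inr ⟨-s', by lia, by lia, by lia, by simpa [TypeH.flip] using k4,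
        by simpa [TypeH.flip] using k5⟩
  no_alternating {a q o q' e} h1 h2 hq hq' l1 l2 l3 l4 hu h3 :=
    hL.no_alternating h2.of_flip h1.of_flip hq' hq (by lia) (by lia) (by lia) (by lia)
      (fun s k1 k2 k3 ↦ by
        have := hu (-s) (by lia) (by lia) (by simpa [TypeH.flip] using k3)
        lia)
      (fun s k1 k2 ↦ by simpa [TypeH.flip] using h3 (-s) (by lia) (by lia))

section

variable {L : ℤ → ℕ}

/-- The first later position of the letter `i`. -/
theorem exists_first_after {i : ℕ} {q s : ℤ} (h : q < s) (hs : L s = i) :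
    ∃ t, q < t ∧ t ≤ s ∧ L t = i ∧ ∀ r, q < r → r < t → L r ≠ i := by
  obtain ⟨t, ht, hmin⟩ := Int.exists_least_of_bdd (P := fun t ↦ q < t ∧ L t = i)
    ⟨q, fun z hz ↦ hz.1.le⟩ ⟨s, h, hs⟩
  exact ⟨t, ht.1, hmin s ⟨h, hs⟩, ht.2, fun r h1 h2 h3 ↦ by have := hmin r ⟨h1, h3⟩; lia⟩

/-- The last earlier position of the letter `i`. -/
theorem exists_last_before {i : ℕ} {q s : ℤ} (h : s < q) (hs : L s = i) :
    ∃ t, s ≤ t ∧ t < q ∧ L t = i ∧ ∀ r, t < r → r < q → L r ≠ i := by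
  obtain ⟨t, ht, hmax⟩ := Int.exists_greatest_of_bdd (P := fun t ↦ t < q ∧ L t = i)
    ⟨q, fun z hz ↦ hz.1.le⟩ ⟨s, h, hs⟩
  exact ⟨t, hmax s ⟨h, hs⟩, ht.1, ht.2, fun r h1 h2 h3 ↦ by have := hmax r ⟨h2, h3⟩; lia⟩

theorem exists_consecutive {i : ℕ} {s s' : ℤ} (h : s < s') (hs : L s = i) (hs' : L s' = i) :
    ∃ t ≤ s', Consecutive L i s t := by
  obtain ⟨t, h1, h2, h3, h4⟩ := exists_first_after h hs'
  exact ⟨t, h2, h1, hs, h3, h4⟩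

namespace Spaced

/-- Otherwise two letters d + 1 lie in between, and by induction on the distance there is a d
between consecutive ones, a contradiction. -/
theorem exists_pred (hL : Spaced L) {d : ℕ} (hd : 2 ≤ d) {q q' : ℤ} (h : Consecutive L d q q') :
    ∃ s, q < s ∧ s < q' ∧ L s + 1 = d := by
  induction hn : (q' - q).toNat using Nat.strong_induction_on generalizing q q' d with
  | _ n ih =>
    by_contra! hcon
    obtain ⟨s, h1, h2, h3, h4, h5⟩ := hL.exists_adjacent (by lia) h
    have hs : L s = d + 1 := h4.resolve_right (hcon s h1 h2)
    rcases h5 with h5 | ⟨s', k1, k2, k3, k4, k5⟩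
    · lia
    have hs' : L s' = d + 1 := k5.resolve_right (hcon s' k2 k3)
    rcases lt_or_gt_of_ne k1 with hlt | hlt
    · obtain ⟨t, ht, hc⟩ := exists_consecutive hlt hs' hs
      obtain ⟨r, r1, r2, r3⟩ := ih _ (by lia) (by lia) hc rfl
      exact h.between r (by lia) (by lia) (by lia)
    · obtain ⟨t, ht, hc⟩ := exists_consecutive hlt hs hs'
      obtain ⟨r, r1, r2, r3⟩ := ih _ (by lia) (by lia) hc rfl
      exact h.between r (by lia) (by lia) (by lia)

theorem succ_unique (hL : Spaced L) {d : ℕ} (hd : 1 ≤ d) {q q' : ℤ} (h : Consecutive L d q q') {s s' : ℤ}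
    (h1 : q < s) (h2 : s < q') (h1' : q < s') (h2' : s' < q') (hs : L s = d + 1)
    (hs' : L s' = d + 1) : s = s' := by
  by_contra hne
  wlog hlt : s < s' generalizing s s'
  · exact this h1' h2' h1 h2 hs' hs (Ne.symm hne) (by lia)
  obtain ⟨t, ht, hc⟩ := exists_consecutive hlt hs hs'
  obtain ⟨r, r1, r2, r3⟩ := hL.exists_pred (by lia) hc
  exact h.between r (by lia) (by lia) (by lia)

theorem exists_succ_of_one (hL : Spaced L) {q q' : ℤ} (h : Consecutive L 1 q q') :
    ∃ s, q < s ∧ s < q' ∧ L s = 2 := by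
  obtain ⟨s, h1, h2, h3, h4, -⟩ := hL.exists_adjacent le_rfl h
  exact ⟨s, h1, h2, by lia⟩

theorem one_unique (hL : Spaced L) {q q' : ℤ} (h : Consecutive L 2 q q') {s s' : ℤ}
    (h1 : q < s) (h2 : s < q') (h1' : q < s') (h2' : s' < q') (hs : L s = 1)
    (hs' : L s' = 1) : s = s' := by
  by_contra hne
  wlog hlt : s < s' generalizing s s'
  · exact this h1' h2' h1 h2 hs' hs (Ne.symm hne) (by lia)
  obtain ⟨t, ht, hc⟩ := exists_consecutive hlt hs hs'
  obtain ⟨r, r1, r2, r3⟩ := hL.exists_succ_of_one hc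
  exact h.between r (by lia) (by lia) (by lia)

/-- The first of at least two occurrences of `c - 1`, and the next one. -/
theorem exists_two_pred (hL : Spaced L) {c : ℕ} (hc : 3 ≤ c) {q q' : ℤ} (h : Consecutive L c q q')
    (hno : ∀ s, q < s → s < q' → L s ≠ c + 1) :
    ∃ f g, q < f ∧ g < q' ∧ Consecutive L (c - 1) f g ∧
      ∀ s, q < s → s < f → L s ≠ c - 1 := by
  obtain ⟨s, h1, h2, h3, h4, h5⟩ := hL.exists_adjacent (by lia) h
  have hs : L s = c - 1 := by have := hno s h1 h2; lia
  rcases h5 with h5 | ⟨s', k1, k2, k3, k4, k5⟩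
  · lia
  have hs' : L s' = c - 1 := by have := hno s' k2 k3; lia
  obtain ⟨f, f1, f2, f3, f4⟩ := exists_first_after h1 hs
  obtain ⟨f', e1, e2, e3, e4⟩ := exists_first_after k2 hs'
  have hff : f = f' := by
    by_contra hne
    rcases lt_or_gt_of_ne hne with hlt | hlt
    · exact e4 f f1 hlt f3
    · exact f4 f' e1 hlt e3
  subst hff
  obtain ⟨z, hz1, hz2, hz3⟩ : ∃ z, f < z ∧ z < q' ∧ L z = c - 1 := by
    by_cases hf : f = s
    · exact ⟨s', by lia, k3, hs'⟩
    · exact ⟨s, by lia, h2, hs⟩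
  obtain ⟨g, g1, g2⟩ := exists_consecutive hz1 f3 hz3
  exact ⟨f, g, f1, by lia, g2, f4⟩

/-- Induction on c. For c ≥ 3 two consecutive letters c − 1 lie between the two c, and the outer
letters c − 1 force a c − 2 on either side of these by `exists_pred`. For c = 2 the outer letters
complete a forbidden 1 2 1 2 1. -/
theorem pred_not_both_sides (hL : Spaced L) {c : ℕ} (hc : 2 ≤ c) {q q' : ℤ} (h : Consecutive L c q q')
    (hno : ∀ s, q < s → s < q' → L s ≠ c + 1) {a e : ℤ} (ha : a < q) (hLa : L a = c - 1)
    (he : q' < e) (hLe : L e = c - 1) : False := by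
  induction c, hc using Nat.le_induction generalizing q q' a e with
  | base =>
    obtain ⟨o, o1, o2, o3⟩ := hL.exists_pred le_rfl h
    have o3' : L o = 1 := by lia
    obtain ⟨a', a1, a2, a3, a4⟩ := exists_last_before ha hLa
    obtain ⟨e', e1, e2, e3, e4⟩ := exists_first_after he hLe
    norm_num at a3 a4 e3 e4
    have hne : ∀ s, q ≤ s → s ≤ q' → s ≠ o → L s ≠ 1 := by
      intro s s1 s2 s3 s4
      have hsq : s ≠ q := fun hh ↦ by rw [hh, h.left] at s4; lia
      have hsq' : s ≠ q' := fun hh ↦ by rw [hh, h.right] at s4; lia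
      exact s3 (hL.one_unique h (by lia) (by lia) o1 o2 s4 o3')
    have c1 : Consecutive L 1 a' o := ⟨by lia, a3, o3', fun s s1 s2 ↦ by
      by_cases hs : s < q
      · exact a4 s s1 hs
      · exact hne s (by lia) (by lia) (by lia)⟩
    have c2 : Consecutive L 1 o e' := ⟨by lia, o3', e3, fun s s1 s2 ↦ by
      by_cases hs : q' < s
      · exact e4 s hs s2
      · exact hne s (by lia) (by lia) (by lia)⟩
    refine hL.no_alternating c1 c2 h.left h.right (by lia) o1 o2 (by lia) ?_ hno
    intro s s1 s2 s3
    have hso : s ≠ o := fun hh ↦ by rw [hh] at s3; lia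
    rcases lt_or_gt_of_ne hso with hlt | hlt
    · exact .inl (hL.succ_unique le_rfl c1 s1 hlt (by lia) o1 s3 h.left)
    · exact .inr (hL.succ_unique le_rfl c2 hlt s2 o2 (by lia) s3 h.right)
  | succ c hc ih =>
    simp only [Nat.add_sub_cancel] at hLa hLe
    obtain ⟨f, g, f1, f2, f3, f4⟩ := hL.exists_two_pred (by lia) h hno
    simp only [Nat.add_sub_cancel] at f3 f4
    obtain ⟨a', a1, a2, a3, a4⟩ := exists_last_before ha hLa
    have hfg := f3.lt
    have c1 : Consecutive L c a' f := ⟨by lia, a3, f3.left, fun s s1 s2 ↦ by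
      by_cases hs : s < q
      · exact a4 s s1 hs
      · by_cases hs' : s = q
        · rw [hs', h.left]; lia
        · exact f4 s (by lia) s2⟩
    obtain ⟨e', e1, e2⟩ := exists_consecutive (by lia : g < e) f3.right hLe
    obtain ⟨x, x1, x2, x3⟩ := hL.exists_pred hc c1
    obtain ⟨y, y1, y2, y3⟩ := hL.exists_pred hc e2
    exact ih f3 (fun s s1 s2 ↦ h.between s (by lia) (by lia)) x2 (by lia) y1 (by lia)

end Spaced

/-- The left end of the consecutive occurrences of `c` at `q` and later is crowded: there is an
earlier `c - 1`, or there is a `c - 2` before the first later `c - 1`. -/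
def CrowdedLeft (L : ℤ → ℕ) (c : ℕ) (q : ℤ) : Prop :=
  (∃ t < q, L t + 1 = c) ∨
    3 ≤ c ∧ ∃ t f, t < f ∧ q < f ∧ L t + 2 = c ∧ L f + 1 = c ∧ ∀ s, q < s → s < f → L s + 1 ≠ c

/-- For c ≥ 3, crowding at an end places a c − 2 on that side of two consecutive letters c − 1
between q and q'; at both ends this contradicts `pred_not_both_sides` for c − 1. For c = 2 that
lemma applies directly. -/
theorem Spaced.not_crowded_both (hL : Spaced L) {c : ℕ} (hc : 2 ≤ c) {q q' : ℤ}
    (h : Consecutive L c q q') (hno : ∀ s, q < s → s < q' → L s ≠ c + 1) (hl : CrowdedLeft L c q)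
    (hr : CrowdedLeft (TypeH.flip L) c (-q')) : False := by
  rcases Nat.lt_or_ge c 3 with hc3 | hc3
  · obtain ⟨a, ha, hLa⟩ := hl.resolve_right (by lia)
    obtain ⟨e, he, hLe⟩ := hr.resolve_right (by lia)
    exact hL.pred_not_both_sides hc h hno ha (by lia) (e := -e) (by lia) (by simp only [TypeH.flip] at hLe; lia)
  have left : ∀ {L : ℤ → ℕ} {q q' : ℤ}, Spaced L → Consecutive L c q q' → CrowdedLeft L c q →
      (∀ s, q < s → s < q' → L s ≠ c + 1) → ∃ t f, t < f ∧ q < f ∧ f < q' ∧ L t + 2 = c ∧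
      L f + 1 = c ∧ ∀ s, q < s → s < f → L s + 1 ≠ c := by
    intro L q q' hL h hl hno
    obtain ⟨f, g, f1, f2, f3, f4⟩ := hL.exists_two_pred hc3 h hno
    have f5 := f3.left
    have f6 := f3.lt
    rcases hl with ⟨a, ha, hLa⟩ | ⟨-, t, f', t1, t2, t3, t4, t5⟩
    · have ha3 : L a = c - 1 := by lia
      obtain ⟨a', a1, a2, a3, a4⟩ := exists_last_before ha ha3
      have c1 : Consecutive L (c - 1) a' f := ⟨by lia, a3, f3.left, fun s s1 s2 ↦ by
        by_cases hs : s < q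
        · exact a4 s s1 hs
        · by_cases hs' : s = q
          · rw [hs', h.left]; lia
          · exact f4 s (by lia) s2⟩
      obtain ⟨x, x1, x2, x3⟩ := hL.exists_pred (by lia) c1
      exact ⟨x, f, x2, f1, by lia, by lia, by lia, fun s s1 s2 ↦ by have := f4 s s1 s2; lia⟩
    · have : f' ≤ f := by
        by_contra hlt
        exact t5 f f1 (by lia) (by lia)
      exact ⟨t, f', t1, t2, by lia, t3, t4, t5⟩
  obtain ⟨t, f, t1, t2, t2', t3, t4, t5⟩ := left hL h hl hno
  obtain ⟨y, g, y1, y2, y2', y3, y4, y5⟩ := left hL.flip h.flip hr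
    (fun s s1 s2 ↦ hno (-s) (by lia) (by lia))
  simp only [TypeH.flip] at y3 y4 y5
  obtain ⟨f0, g0, f1, f2, f3, f4⟩ := hL.exists_two_pred hc3 h hno
  have f5 := f3.left
  have f6 := f3.lt
  have hf : f0 = f := by
    have h1 := t5 f0 f1
    have h2 := f4 f t2
    lia
  subst hf
  have hg : g0 ≤ -g := by
    by_contra hlt
    have := y5 (-g0) (by lia) (by lia)
    rw [neg_neg, f3.right] at this
    lia
  have hy : ∃ z, g0 < z ∧ L z + 2 = c := by
    by_cases hgg : g0 = -g
    · exact ⟨-y, by lia, y3⟩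
    · have hg' : L (-g) = c - 1 := by lia
      obtain ⟨e', e1, e2⟩ := exists_consecutive (by lia : g0 < -g) f3.right hg'
      obtain ⟨z, z1, z2, z3⟩ := hL.exists_pred (by lia) e2
      exact ⟨z, z1, by lia⟩
  obtain ⟨z, z1, z2⟩ := hy
  refine hL.pred_not_both_sides (by lia) f3 (fun s s1 s2 ↦ ?_) t1 (by lia) z1 (by lia)
  have := h.between s (by lia) (by lia)
  lia

end

end TypeH

end

/-! ### Closed strands in a word with one letter removed -/

noncomputable section

namespace TypeH

/-- The letter at position `s` touches the column `x`. -/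
def Touches (L : ℤ → ℕ) (s : ℤ) (x : ℕ) : Prop := 1 ≤ L s ∧ (L s = x ∨ L s + 1 = x)

/-- The last position before `t` that touches the column `x` lies in `U`. -/
def PrevIn (L : ℤ → ℕ) (U : Set ℤ) (t : ℤ) (x : ℕ) : Prop :=
  ∃ s ∈ U, s < t ∧ Touches L s x ∧ ∀ r, s < r → r < t → ¬ Touches L r x

/-- The first position after `t` that touches the column `x` lies in `U`. -/
def NextIn (L : ℤ → ℕ) (U : Set ℤ) (t : ℤ) (x : ℕ) : Prop :=
  ∃ s ∈ U, t < s ∧ Touches L s x ∧ ∀ r, t < r → r < s → ¬ Touches L r x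

/-- The two sides of the letters of a word that are passed by closed strands: the strands close
upwards at the positions of `Cap` and downwards at those of `Cup`. -/
structure Closed (L : ℤ → ℕ) (Cap Cup : Set ℤ) : Prop where
  one_le_cap : ∀ t ∈ Cap, 1 ≤ L t
  one_le_cup : ∀ t ∈ Cup, 1 ≤ L t
  cap : ∀ t ∈ Cap, PrevIn L Cup t (L t) ∧ PrevIn L Cup t (L t + 1)
  cup : ∀ t ∈ Cup, NextIn L Cap t (L t) ∧ NextIn L Cap t (L t + 1)

theorem NextIn.flip {L : ℤ → ℕ} {U : Set ℤ} {t : ℤ} {x : ℕ} (h : NextIn L U t x) :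
    PrevIn (flip L) {s | -s ∈ U} (-t) x := by
  obtain ⟨s, h1, h2, h3, h4⟩ := h
  refine ⟨-s, by simpa using h1, by lia, by simpa [Touches, TypeH.flip] using h3, fun r r1 r2 ↦ ?_⟩
  exact h4 (-r) (by lia) (by lia)

theorem PrevIn.flip {L : ℤ → ℕ} {U : Set ℤ} {t : ℤ} {x : ℕ} (h : PrevIn L U t x) :
    NextIn (flip L) {s | -s ∈ U} (-t) x := by
  obtain ⟨s, h1, h2, h3, h4⟩ := h
  refine ⟨-s, by simpa using h1, by lia, by simpa [Touches, TypeH.flip] using h3, fun r r1 r2 ↦ ?_⟩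
  exact h4 (-r) (by lia) (by lia)

theorem Closed.flip {L : ℤ → ℕ} {Cap Cup : Set ℤ} (h : Closed L Cap Cup) :
    Closed (flip L) {s | -s ∈ Cup} {s | -s ∈ Cap} where
  one_le_cap t ht := h.one_le_cup _ ht
  one_le_cup t ht := h.one_le_cap _ ht
  cap t ht := by
    have := h.cup _ ht
    have h1 := this.1.flip
    have h2 := this.2.flip
    rw [neg_neg] at h1 h2
    exact ⟨h1, h2⟩
  cup t ht := by
    have := h.cap _ ht
    have h1 := this.1.flip
    have h2 := this.2.flip
    rw [neg_neg] at h1 h2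
    exact ⟨h1, h2⟩

/-- The word with the letter at position `P` removed. -/
def blank (L : ℤ → ℕ) (P t : ℤ) : ℕ := if t = P then 0 else L t

theorem blank_of_ne {L : ℤ → ℕ} {P t : ℤ} (h : t ≠ P) : blank L P t = L t := if_neg h

theorem of_blank {L : ℤ → ℕ} {P t : ℤ} {c : ℕ} (h : blank L P t = c) (hc : 1 ≤ c) :
    t ≠ P ∧ L t = c := by
  unfold blank at h
  split_ifs at h with h1
  · lia
  · exact ⟨h1, h⟩

theorem flip_blank (L : ℤ → ℕ) (P : ℤ) : flip (blank L P) = blank (flip L) (-P) := by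
  ext t
  simp [flip, blank, neg_eq_iff_eq_neg]

section

variable {L : ℤ → ℕ} {P : ℤ} {Cap Cup : Set ℤ}

/-- This and the next three lemmas follow a strand from its turn at a letter c to the next turn: the
left leg runs in column c, touched by c and c − 1 only, the right leg in column c + 1, touched by c
+ 1 and c only. -/
theorem Closed.cap_left (h : Closed (blank L P) Cap Cup) {t : ℤ} (ht : t ∈ Cap) {c : ℕ}
    (hc : L t = c) : ∃ s ∈ Cup, s < t ∧ s ≠ P ∧ 1 ≤ L s ∧ (L s = c ∨ L s + 1 = c) ∧
      ∀ r, s < r → r < t → r ≠ P → 1 ≤ L r → L r ≠ c ∧ L r + 1 ≠ c := by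
  have ht1 := of_blank rfl (h.one_le_cap t ht)
  obtain ⟨s, h1, h2, h3, h4⟩ := (h.cap t ht).1
  have hs := of_blank rfl h3.1
  simp only [Touches] at h3 h4
  rw [← ht1.2, ← hs.2, hc] at h3
  refine ⟨s, h1, h2, hs.1, h3.1, h3.2, fun r r1 r2 r3 r4 ↦ ?_⟩
  have := h4 r r1 r2
  rw [← ht1.2, hc, blank_of_ne r3] at this
  tauto

theorem Closed.cap_right (h : Closed (blank L P) Cap Cup) {t : ℤ} (ht : t ∈ Cap) {c : ℕ}
    (hc : L t = c) : ∃ s ∈ Cup, s < t ∧ s ≠ P ∧ (L s = c + 1 ∨ L s = c) ∧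
      ∀ r, s < r → r < t → r ≠ P → L r ≠ c + 1 ∧ L r ≠ c := by
  have ht1 := of_blank rfl (h.one_le_cap t ht)
  have hpos := h.one_le_cap t ht
  obtain ⟨s, h1, h2, h3, h4⟩ := (h.cap t ht).2
  have hs := of_blank rfl h3.1
  simp only [Touches] at h3 h4
  rw [← ht1.2, ← hs.2, hc] at h3
  refine ⟨s, h1, h2, hs.1, by lia, fun r r1 r2 r3 ↦ ?_⟩
  have := h4 r r1 r2
  rw [← ht1.2, hc] at hpos
  rw [← ht1.2, hc, blank_of_ne r3] at this
  lia

theorem Closed.cup_left (h : Closed (blank L P) Cap Cup) {t : ℤ} (ht : t ∈ Cup) {c : ℕ}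
    (hc : L t = c) : ∃ s ∈ Cap, t < s ∧ s ≠ P ∧ 1 ≤ L s ∧ (L s = c ∨ L s + 1 = c) ∧
      ∀ r, t < r → r < s → r ≠ P → 1 ≤ L r → L r ≠ c ∧ L r + 1 ≠ c := by
  have ht1 := of_blank rfl (h.one_le_cup t ht)
  obtain ⟨s, h1, h2, h3, h4⟩ := (h.cup t ht).1
  have hs := of_blank rfl h3.1
  simp only [Touches] at h3 h4
  rw [← ht1.2, ← hs.2, hc] at h3
  refine ⟨s, h1, h2, hs.1, h3.1, h3.2, fun r r1 r2 r3 r4 ↦ ?_⟩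
  have := h4 r r1 r2
  rw [← ht1.2, hc, blank_of_ne r3] at this
  tauto

theorem Closed.cup_right (h : Closed (blank L P) Cap Cup) {t : ℤ} (ht : t ∈ Cup) {c : ℕ}
    (hc : L t = c) : ∃ s ∈ Cap, t < s ∧ s ≠ P ∧ (L s = c + 1 ∨ L s = c) ∧
      ∀ r, t < r → r < s → r ≠ P → L r ≠ c + 1 ∧ L r ≠ c := by
  have ht1 := of_blank rfl (h.one_le_cup t ht)
  have hpos := h.one_le_cup t ht
  obtain ⟨s, h1, h2, h3, h4⟩ := (h.cup t ht).2
  have hs := of_blank rfl h3.1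
  simp only [Touches] at h3 h4
  rw [← ht1.2, ← hs.2, hc] at h3
  refine ⟨s, h1, h2, hs.1, by lia, fun r r1 r2 r3 ↦ ?_⟩
  have := h4 r r1 r2
  rw [← ht1.2, hc] at hpos
  rw [← ht1.2, hc, blank_of_ne r3] at this
  lia

theorem Closed.cap_pos (h : Closed (blank L P) Cap Cup) {t : ℤ} (ht : t ∈ Cap) :
    t ≠ P ∧ 1 ≤ L t := by
  have h1 := h.one_le_cap t ht
  have := of_blank rfl h1
  exact ⟨this.1, by rw [this.2]; exact h1⟩

theorem Closed.cup_pos (h : Closed (blank L P) Cap Cup) {t : ℤ} (ht : t ∈ Cup) :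
    t ≠ P ∧ 1 ≤ L t := by
  have h1 := h.one_le_cup t ht
  have := of_blank rfl h1
  exact ⟨this.1, by rw [this.2]; exact h1⟩

theorem Closed.flip_blank (h : Closed (blank L P) Cap Cup) :
    Closed (blank (TypeH.flip L) (-P)) {s | -s ∈ Cup} {s | -s ∈ Cap} := by
  rw [← TypeH.flip_blank]
  exact h.flip

/-- The left leg of q runs to the first c − 1 after q, which `hP` guarantees is not the removed
letter. From there the strand runs back in column c − 1 and turns at a c − 1, which then precedes q,
or at a c − 2: the two ways of being crowded. -/
theorem crowdedLeft_of_closed (hL : Spaced L) (h : Closed (blank L P) Cap Cup) {c : ℕ} (hc : 2 ≤ c)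
    {q q' : ℤ} (hq : q ∈ Cup) (hqq : Consecutive L c q q')
    (hP : L P + 1 = c → q < P → P < q' → ∃ s, q < s ∧ s < P ∧ L s + 1 = c) :
    CrowdedLeft L c q := by
  obtain ⟨x, x1, x2, x3⟩ := hL.exists_pred hc hqq
  obtain ⟨f, f1, f2, f3, f4⟩ := exists_first_after x1 (rfl : L x = L x)
  have hfP : f ≠ P := by
    rintro rfl
    obtain ⟨s, s1, s2, s3⟩ := hP (by lia) f1 (by lia)
    exact f4 s s1 s2 (by lia)
  obtain ⟨s, s0, s1, s2, s3, s4, s5⟩ := h.cup_left hq hqq.left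
  have hsf : s ≤ f := by
    by_contra hlt
    exact (s5 f f1 (by lia) hfP (by lia)).2 (by lia)
  have hs : L s + 1 = c := s4.resolve_left fun hs ↦ hqq.between s s1 (by lia) hs
  obtain rfl : s = f := by
    by_contra hne
    exact f4 s s1 (by lia) (by lia)
  obtain ⟨y, y0, y1, y2, y3, y4, y5⟩ := h.cap_left s0 (rfl : L s = L s)
  rcases y4 with y4 | y4
  · refine .inl ⟨y, ?_, by lia⟩
    by_contra hlt
    have : y ≠ q := by
      rintro rfl
      have := hqq.left
      lia
    exact f4 y (by lia) y1 (by lia)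
  · exact .inr ⟨by lia, y, s, y1, s1, by lia, hs, fun r r1 r2 ↦ by have := f4 r r1 r2; lia⟩

/-- Two consecutive occurrences that are joined on their right side surround the removed letter. -/
theorem joined_right (hL : Spaced L) (h : Closed (blank L P) Cap Cup) {c : ℕ}
    {q q' : ℤ} (hq : q ∈ Cup) (hq' : q' ∈ Cap) (hc : L q = c) (hc' : L q' = c) (hlt : q < q')
    (hno : ∀ r, q < r → r < q' → r ≠ P → L r ≠ c + 1 ∧ L r ≠ c) :
    q < P ∧ P < q' ∧ (L P = c + 1 ∨ L P + 1 = c ∧ 2 ≤ c ∧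
      ((∀ s, q < s → s < P → L s + 1 ≠ c) ∨ ∀ s, P < s → s < q' → L s + 1 ≠ c)) := by
  by_contra hcon
  have hpos : 1 ≤ c := by rw [← hc]; exact (h.cup_pos hq).2
  have hno' : ∀ r, q < r → r < q' → L r ≠ c + 1 := by
    intro r r1 r2 r3
    by_cases hr : r = P
    · subst hr
      exact hcon ⟨r1, r2, .inl r3⟩
    · exact (hno r r1 r2 hr).1 r3
  obtain ⟨e, e1, e2⟩ := exists_consecutive hlt hc hc'
  have e3 := e2.lt
  have hc2 : 2 ≤ c := by
    by_contra hc2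
    obtain rfl : c = 1 := by lia
    obtain ⟨s, s1, s2, s3⟩ := hL.exists_succ_of_one e2
    exact hno' s s1 (by lia) s3
  by_cases he : e = q'
  · subst he
    -- If the claim fails, P is neither the first nor the last c − 1 between q and q', so both ends
    -- are crowded.
    have cond : ∀ (h1 : L P + 1 = c) (h2 : q < P) (h3 : P < e),
        (∃ s, q < s ∧ s < P ∧ L s + 1 = c) ∧ ∃ s, P < s ∧ s < e ∧ L s + 1 = c := by
      intro h1 h2 h3
      by_contra hh
      refine hcon ⟨h2, h3, .inr ⟨h1, hc2, ?_⟩⟩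
      by_contra! hh'
      exact hh hh'
    refine hL.not_crowded_both hc2 e2 hno'
      (crowdedLeft_of_closed hL h hc2 hq e2 fun h1 h2 h3 ↦ (cond h1 h2 h3).1)
      (crowdedLeft_of_closed hL.flip h.flip_blank hc2 (q := -e) (q' := -q) (by simpa using hq')
        e2.flip fun h1 h2 h3 ↦ ?_)
    obtain ⟨s, s1, s2, s3⟩ := (cond (by simpa [flip] using h1) (by lia) (by lia)).2
    exact ⟨-s, by lia, by lia, by simpa [flip] using s3⟩
  -- Another c between q and q' can only be the removed letter. Then the consecutive pair q, P is
  -- crowded on both sides, on the right by a c − 1 between P and q'.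
  · have heP : e = P := by
      by_contra hne
      exact (hno e e2.lt (by lia) hne).2 e2.right
    subst heP
    obtain ⟨g, g1, g2⟩ := exists_consecutive (by lia : e < q') e2.right hc'
    obtain ⟨x, x1, x2, x3⟩ := hL.exists_pred hc2 g2
    exact hL.not_crowded_both hc2 e2 (fun r r1 r2 ↦ hno' r r1 (by lia))
      (crowdedLeft_of_closed hL h hc2 hq e2 fun h1 h2 h3 ↦ by lia)
      (.inl ⟨-x, by lia, by simpa [flip] using x3⟩)

/-- A closed strand of a spaced word with one letter removed, with the largest letter `c`. -/
theorem exists_joined_of_max (h : Closed (blank L P) Cap Cup) {c : ℕ}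
    (hmax : ∀ t, t ∈ Cap ∨ t ∈ Cup → L t ≤ c) (hc : ∃ t, (t ∈ Cap ∨ t ∈ Cup) ∧ L t = c) :
    ∃ q q', q ∈ Cup ∧ q' ∈ Cap ∧ L q = c ∧ L q' = c ∧ q < q' ∧
      ∀ r, q < r → r < q' → r ≠ P → L r ≠ c + 1 ∧ L r ≠ c := by
  obtain ⟨t, ht | ht, htc⟩ := hc
  -- By maximality the right leg cannot turn at c + 1, so it turns at c.
  · obtain ⟨s, s1, s2, s3, s4, s5⟩ := h.cap_right ht htc
    have := hmax s (.inr s1)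
    exact ⟨s, t, s1, ht, by lia, htc, s2, s5⟩
  · obtain ⟨s, s1, s2, s3, s4, s5⟩ := h.cup_right ht htc
    have := hmax s (.inl s1)
    exact ⟨t, s, ht, s1, htc, by lia, s2, s5⟩

theorem exists_max {M : ℕ} (hM : ∀ t, L t ≤ M)
    (hne : ∃ t, t ∈ Cap ∨ t ∈ Cup) : ∃ c, (∀ t, t ∈ Cap ∨ t ∈ Cup → L t ≤ c) ∧
      ∃ t, (t ∈ Cap ∨ t ∈ Cup) ∧ L t = c := by
  classical
  obtain ⟨t, ht⟩ := hne
  have hex : ∃ c, ∀ t, t ∈ Cap ∨ t ∈ Cup → L t ≤ c := ⟨M, fun t _ ↦ hM t⟩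
  refine ⟨Nat.find hex, Nat.find_spec hex, ?_⟩
  by_contra! hcon
  have h0 : 0 < Nat.find hex := by
    have h1 := Nat.find_spec hex t ht
    have h2 := hcon t ht
    lia
  refine Nat.find_min hex (m := Nat.find hex - 1) (by lia) fun t ht ↦ ?_
  have h1 := Nat.find_spec hex t ht
  have h2 := hcon t ht
  lia

/-- A spaced word carries no closed strands. -/
theorem Spaced.not_closed (hL : Spaced L) (hP : L P = 0) {M : ℕ} (hM : ∀ t, L t ≤ M)
    (h : Closed L Cap Cup) (hne : ∃ t, t ∈ Cap ∨ t ∈ Cup) : False := by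
  have hb : blank L P = L := by
    ext t
    by_cases ht : t = P
    · simp [blank, ht, hP]
    · exact blank_of_ne ht
  rw [← hb] at h
  obtain ⟨c, h1, h2⟩ := exists_max hM hne
  obtain ⟨q, q', a1, a2, a3, a4, a5, a6⟩ := exists_joined_of_max h h1 h2
  have := joined_right hL h a1 a2 a3 a4 a5 a6
  lia

/-- The occurrences of even letters at most `L P` lie in `Cup` only if they lie in `Cap`. -/
theorem even_cup (hL : Spaced L) (h : Closed (blank L P) Cap Cup) (j : ℕ) (hj : 2 * j + 2 ≤ L P)
    {t : ℤ} (ht : t ∈ Cup) (htj : L t = 2 * j + 2) :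
    t ∈ Cap ∧ ∃ a d, Consecutive L (2 * j + 1) a d ∧ a < t ∧ t < d ∧
      (1 ≤ j → ∃ y ∈ Cup, L y = 2 * j ∧ a < y ∧ y < d ∧
        ∀ s, a < s → s < d → L s = 2 * j → s = y) := by
  induction j generalizing t with
  -- From the 2 at t the strand goes left to a 1, back in column 1, touched by the letter 1 only, to
  -- the preceding 1, and returns in column 2 to the only 2 between these, which is t.
  | zero =>
    obtain ⟨s, s0, s1, s2, s3, s4, s5⟩ := h.cup_left ht htj
    have hs1 : L s = 1 := by
      rcases s4 with s4 | s4
      · exfalso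
        obtain ⟨e, e1, e2⟩ := exists_consecutive s1 htj s4
        obtain ⟨x, x1, x2, x3⟩ := hL.exists_pred (by lia) e2
        have hx : x ≠ P := by rintro rfl; lia
        exact (s5 x x1 (by lia) hx (by lia)).2 (by lia)
      · lia
    obtain ⟨y, y0, y1, y2, y3, y4, y5⟩ := h.cap_left s0 hs1
    have hy1 : L y = 1 := by lia
    have hcons : Consecutive L 1 y s := ⟨y1, hy1, hs1, fun r r1 r2 r3 ↦ by
      have hr : r ≠ P := by rintro rfl; lia
      exact (y5 r r1 r2 hr (by lia)).1 r3⟩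
    have hyt : y < t := by
      by_contra hlt
      have : y ≠ t := by rintro rfl; lia
      exact (s5 y (by lia) y1 y2 (by lia)).2 (by lia)
    obtain ⟨w, w0, w1, w2, w3, w4⟩ := h.cup_right y0 hy1
    have hwt : w ≤ t := by
      by_contra hlt
      exact (w4 t hyt (by lia) (h.cup_pos ht).1).1 htj
    have hw : L w = 2 := w3.resolve_right (hcons.between w w1 (by lia))
    have : w = t := hL.succ_unique le_rfl hcons w1 (by lia) hyt s1 hw htj
    subst this
    exact ⟨w0, y, s, hcons, w1, s1, by lia⟩
  | succ j ih =>
    -- The same round trip: from t to a 2j + 3, to a 2j + 2 that is passed on both sides by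
    -- induction, to the preceding 2j + 3 and back to t.
    obtain ⟨s, s0, s1, s2, s3, s4, s5⟩ := h.cup_left ht htj
    have hs1 : L s = 2 * j + 3 := by
      rcases s4 with s4 | s4
      · exfalso
        obtain ⟨e, e1, e2⟩ := exists_consecutive s1 htj s4
        obtain ⟨x, x1, x2, x3⟩ := hL.exists_pred (by lia) e2
        have hx : x ≠ P := by rintro rfl; lia
        exact (s5 x x1 (by lia) hx (by lia)).2 (by lia)
      · lia
    obtain ⟨y, y0, y1, y2, y3, y4, y5⟩ := h.cap_left s0 hs1
    have hy1 : L y = 2 * j + 2 := by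
      rcases y4 with y4 | y4
      · exfalso
        obtain ⟨e, e1, e2⟩ := exists_consecutive y1 y4 hs1
        obtain ⟨x, x1, x2, x3⟩ := hL.exists_pred (by lia) e2
        have hx : x ≠ P := by rintro rfl; lia
        exact (y5 x x1 (by lia) hx (by lia)).2 (by lia)
      · lia
    obtain ⟨hycap, -⟩ := ih (by lia) y0 hy1
    obtain ⟨z, z0, z1, z2, z3, z4⟩ := h.cap_right hycap hy1
    have hz : L z = 2 * j + 3 := by
      -- Two letters 2j + 2 joined on the right would surround the removed letter, which would then
      -- be 2j + 1 or 2j + 3; but L P ≥ 2j + 4.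
      refine z3.resolve_right fun z3 ↦ ?_
      have := joined_right hL h z0 hycap z3 hy1 z1 z4
      lia
    have hcons : Consecutive L (2 * j + 3) z s := ⟨by lia, hz, hs1, fun r r1 r2 r3 ↦ by
      have hr : r ≠ P := by rintro rfl; lia
      have hry : r ≠ y := by rintro rfl; lia
      rcases lt_or_gt_of_ne hry with hlt | hlt
      · exact (z4 r r1 hlt hr).1 (by lia)
      · exact (y5 r hlt r2 hr (by lia)).1 r3⟩
    have hzt : z < t := by
      by_contra hlt
      have : z ≠ t := by rintro rfl; lia
      exact (s5 z (by lia) (by lia) z2 (by lia)).2 (by lia)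
    obtain ⟨w, w0, w1, w2, w3, w4⟩ := h.cup_right z0 hz
    have hwt : w ≤ t := by
      by_contra hlt
      exact (w4 t hzt (by lia) (h.cup_pos ht).1).1 (by lia)
    have hw : L w = 2 * j + 3 + 1 := w3.resolve_right (hcons.between w w1 (by lia))
    have : w = t := hL.succ_unique (by lia) hcons w1 (by lia) hzt s1 hw (by lia)
    subst this
    refine ⟨w0, z, s, hcons, w1, s1, fun _ ↦ ⟨y, y0, by lia, z1, y1, fun r r1 r2 r3 ↦ ?_⟩⟩
    have hr : r ≠ P := by rintro rfl; lia
    by_contra hry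
    rcases lt_or_gt_of_ne hry with hlt | hlt
    · exact (z4 r r1 hlt hr).2 (by lia)
    · exact (y5 r hlt r2 hr (by lia)).2 (by lia)

theorem even_cap (hL : Spaced L) (h : Closed (blank L P) Cap Cup) (j : ℕ) (hj : 2 * j + 2 ≤ L P)
    {t : ℤ} (ht : t ∈ Cap) (htj : L t = 2 * j + 2) : t ∈ Cup := by
  have := (even_cup hL.flip h.flip_blank j (by simpa [flip] using hj) (t := -t) (by simpa using ht)
    (by simpa [flip] using htj)).1
  simpa using this

/-- Interlocking pairs of odd letters: the position `β i` carries the only letter `2 i + 2` between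
the consecutive occurrences `α i`, `γ i` of `2 i + 1`, and also the only one between the
consecutive occurrences of `2 i + 3` if `i < j`. -/
structure Ladder (L : ℤ → ℕ) (j : ℕ) (α β γ : ℕ → ℤ) : Prop where
  consecutive : ∀ i ≤ j, Consecutive L (2 * i + 1) (α i) (γ i)
  even : ∀ i ≤ j, L (β i) = 2 * i + 2
  lt : ∀ i ≤ j, α i < β i
  lt' : ∀ i ≤ j, β i < γ i
  succ_lt : ∀ i < j, α (i + 1) < β i
  succ_lt' : ∀ i < j, β i < γ (i + 1)
  unique : ∀ i < j, ∀ s, α (i + 1) < s → s < γ (i + 1) → L s = 2 * i + 2 → s = β i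

theorem Ladder.extend {j : ℕ} {α β γ : ℕ → ℤ} (h : Ladder L j α β γ) {a t d : ℤ}
    (hc : Consecutive L (2 * (j + 1) + 1) a d) (ht : L t = 2 * (j + 1) + 2) (h1 : a < t) (h2 : t < d)
    (h3 : a < β j) (h4 : β j < d) (hu : ∀ s, a < s → s < d → L s = 2 * j + 2 → s = β j) :
    ∃ α' β' γ', Ladder L (j + 1) α' β' γ' ∧ β' (j + 1) = t := by
  refine ⟨fun i ↦ if i ≤ j then α i else a, fun i ↦ if i ≤ j then β i else t,
    fun i ↦ if i ≤ j then γ i else d, ⟨?_, ?_, ?_, ?_, ?_, ?_, ?_⟩, by simp⟩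
  · intro i hi
    by_cases hij : i ≤ j
    · simp only [hij, if_true]; exact h.consecutive i hij
    · obtain rfl : i = j + 1 := by lia
      simpa using hc
  · intro i hi
    by_cases hij : i ≤ j
    · simp only [hij, if_true]; exact h.even i hij
    · obtain rfl : i = j + 1 := by lia
      simpa using ht
  · intro i hi
    by_cases hij : i ≤ j
    · simp only [hij, if_true]; exact h.lt i hij
    · simpa only [hij, if_false] using h1
  · intro i hi
    by_cases hij : i ≤ j
    · simp only [hij, if_true]; exact h.lt' i hij
    · simpa only [hij, if_false] using h2
  · intro i hi
    by_cases hij : i + 1 ≤ j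
    · simp only [hij, if_true, (by lia : i ≤ j)]; exact h.succ_lt i hij
    · obtain rfl : i = j := by lia
      simpa using h3
  · intro i hi
    by_cases hij : i + 1 ≤ j
    · simp only [hij, if_true, (by lia : i ≤ j)]; exact h.succ_lt' i hij
    · obtain rfl : i = j := by lia
      simpa using h4
  · intro i hi
    by_cases hij : i + 1 ≤ j
    · simp only [hij, if_true, (by lia : i ≤ j)]; exact h.unique i hij
    · obtain rfl : i = j := by lia
      simpa using hu

theorem exists_ladder (hL : Spaced L) (h : Closed (blank L P) Cap Cup) (j : ℕ)
    (hj : 2 * j + 2 ≤ L P) {t : ℤ} (ht : t ∈ Cup) (htj : L t = 2 * j + 2) :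
    ∃ α β γ, Ladder L j α β γ ∧ β j = t := by
  induction j generalizing t with
  | zero =>
    obtain ⟨-, a, d, h1, h2, h3, -⟩ := even_cup hL h 0 hj ht htj
    refine ⟨fun _ ↦ a, fun _ ↦ t, fun _ ↦ d, ⟨?_, ?_, ?_, ?_, ?_, ?_, ?_⟩, rfl⟩
    · intro i hi; obtain rfl : i = 0 := by lia
      exact h1
    · intro i hi; obtain rfl : i = 0 := by lia
      exact htj
    · exact fun _ _ ↦ h2
    · exact fun _ _ ↦ h3
    · intro i hi; lia
    · intro i hi; lia
    · intro i hi; lia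
  | succ j ih =>
    obtain ⟨-, a, d, h1, h2, h3, h4⟩ := even_cup hL h (j + 1) hj ht htj
    obtain ⟨y, y0, y1, y2, y3, y4⟩ := h4 (by lia)
    obtain ⟨α, β, γ, hlad, rfl⟩ := ih (by lia) y0 y1
    exact hlad.extend h1 htj h2 h3 y2 y3 y4

end

end TypeH

end

/-! ### The four patterns around the removed letter -/

noncomputable section

namespace TypeH

variable {L : ℤ → ℕ} {P : ℤ} {Cap Cup : Set ℤ}

/-- The pattern `s_q s_p s_q` with `{p, q} = {1, 2}` around the position `P`. -/
def BondPattern (L : ℤ → ℕ) (P : ℤ) : Prop :=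
  ∃ q q', q < P ∧ P < q' ∧
    ((Consecutive L 1 q q' ∧ L P = 2 ∧ ∀ s, q < s → s < q' → L s = 2 → s = P) ∨
     (Consecutive L 2 q q' ∧ L P = 1 ∧ (∀ s, q < s → s < q' → L s = 1 → s = P) ∧
        ∀ s, q < s → s < q' → L s ≠ 3))

/-- The pattern of `ParseI`. -/
def TopPattern (L : ℤ → ℕ) (P : ℤ) : Prop :=
  ∃ j α β γ, 1 ≤ j ∧ Ladder L j α β γ ∧ β j = P

/-- The pattern of `ParseIII`. -/
structure SidePattern (L : ℤ → ℕ) (P : ℤ) (j : ℕ) (α β γ : ℕ → ℤ) (q q' : ℤ) : Prop where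
  ladder : Ladder L j α β γ
  letter : L P = 2 * j + 2
  consecutive : Consecutive L (2 * j + 3) q q'
  no_succ : ∀ s, q < s → s < q' → L s ≠ 2 * j + 4
  lt : q < P
  lt_top : P < β j
  top_lt : β j < q'
  pred : ∀ s, q < s → s < q' → L s = 2 * j + 2 → s = P ∨ s = β j
  no_before : ∀ s < P, L s ≠ 2 * j + 2 ∧ L s ≠ 2 * j + 1

/-- P is the first c − 1 after q, so the right end remains crowded and the left end is not: no c − 1
or c − 2 precedes P. The left leg of q therefore runs past P to a later c − 1. If c − 1 is even,
this letter is the top of a ladder; if c − 1 is odd, the strand has no way to continue. -/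
theorem sidePattern_of_joined (hL : Spaced L) (h : Closed (blank L P) Cap Cup) {c : ℕ} (hc3 : 3 ≤ c)
    {q q' : ℤ} (hq : q ∈ Cup) (hq' : q' ∈ Cap) (hcons : Consecutive L c q q')
    (hno : ∀ s, q < s → s < q' → L s ≠ c + 1) (hPc : L P + 1 = c) (h1 : q < P) (h2 : P < q')
    (hfirst : ∀ s, q < s → s < P → L s + 1 ≠ c) :
    ∃ j α β γ, SidePattern L P j α β γ q q' := by
  obtain ⟨f, g, f1, g1, hfg, f2⟩ := hL.exists_two_pred hc3 hcons hno
  have hf3 := hfg.left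
  have hg3 := hfg.right
  have hlt := hfg.lt
  obtain rfl : f = P := by
    have i1 := hfirst f f1
    have i2 := f2 P h1
    lia
  have hcrowd : ¬ CrowdedLeft L c q := fun hl ↦
    hL.not_crowded_both (by lia) hcons hno hl
      (crowdedLeft_of_closed hL.flip h.flip_blank (by lia) (q := -q') (q' := -q)
        (by simpa using hq') hcons.flip fun _ _ _ ↦
          ⟨-g, by lia, by lia, by simp only [flip, neg_neg]; lia⟩)
  have hA : ∀ t < f, L t + 1 ≠ c := by
    intro t ht htc
    rcases lt_trichotomy t q with hlt | rfl | hlt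
    · exact hcrowd (.inl ⟨t, hlt, htc⟩)
    · have := hcons.left
      lia
    · exact hfirst t hlt ht htc
  have hB : ∀ t < f, L t + 2 ≠ c := fun t ht htc ↦
    hcrowd (.inr ⟨hc3, t, f, ht, h1, htc, hPc, hfirst⟩)
  obtain ⟨t, t0, t1, t2, t3, t4, t5⟩ := h.cup_left hq hcons.left
  have htg : t ≤ g := by
    by_contra hlt'
    exact (t5 g (by lia) (by lia) (by lia) (by lia)).2 (by lia)
  have ht : L t + 1 = c := t4.resolve_left (hcons.between t t1 (by lia))
  have hft : f < t := by
    by_contra hlt'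
    exact hA t (by lia) ht
  have hbetween : ∀ s, s < t → L s + 1 = c → s = f := by
    intro s s1 s2
    by_contra hne
    rcases lt_or_gt_of_ne hne with hlt' | hlt'
    · exact hA s hlt' s2
    · exact (t5 s (by lia) s1 hne (by lia)).2 s2
  rcases Nat.even_or_odd' (L t) with ⟨k, hk | hk⟩
  · obtain ⟨j, rfl⟩ : ∃ j, k = j + 1 := ⟨k - 1, by lia⟩
    have hcj : c = 2 * j + 3 := by lia
    subst hcj
    have htcup := even_cap hL h j (by lia) t0 (by lia)
    obtain ⟨α, β, γ, hlad, hβ⟩ := exists_ladder hL h j (by lia) htcup (by lia)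
    obtain ⟨w, w0, w1, w2, w3, w4⟩ := h.cup_right htcup (c := 2 * j + 2) (by lia)
    have hw : L w = 2 * j + 3 := by
      refine w3.resolve_right fun w3 ↦ ?_
      have := joined_right hL h htcup w0 (c := 2 * j + 2) (by lia) w3 w1 w4
      lia
    have hq'3 := hcons.right
    have hwq : w = q' := by
      have i1 := hcons.between w (by lia)
      have i2 := w4 q' (by lia)
      have i3 := (h.cap_pos hq').1
      lia
    subst hwq
    refine ⟨j, α, β, γ, hlad, by lia, hcons, hno, h1, by lia, by lia, fun s s1 s2 s3 ↦ ?_,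
      fun s hs ↦ ⟨?_, ?_⟩⟩
    · rcases lt_trichotomy s t with hlt' | rfl | hlt'
      · exact .inl (hbetween s hlt' (by lia))
      · exact .inr hβ.symm
      · exact absurd s3 (w4 s hlt' s2 (by lia)).2
    · have := hA s hs
      lia
    · have := hB s hs
      lia
  · obtain ⟨i, rfl⟩ : ∃ i, k = i + 1 := by
      refine ⟨k - 1, ?_⟩
      by_contra hk0
      lia
    -- From t the strand runs back to an even c − 2, which is passed on both sides. Its right leg
    -- upwards would have to turn at an unremoved c − 1 before t or at a c − 2 before P, and neither
    -- exists.
    exfalso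
    obtain ⟨z, z0, z1, z2, z3, z4, z5⟩ := h.cap_left t0 (rfl : L t = L t)
    have hz : L z = 2 * i + 2 := by
      rcases z4 with z4 | z4
      · exact absurd (hbetween z z1 (by lia)) z2
      · lia
    obtain ⟨hzcap, -⟩ := even_cup hL h i (by lia) z0 hz
    obtain ⟨w, w0, w1, w2, w3, w4⟩ := h.cap_right hzcap hz
    rcases w3 with w3 | w3
    · exact w2 (hbetween w (by lia) (by lia))
    · obtain ⟨k1, k2, -⟩ := joined_right hL h w0 hzcap w3 hz w1 w4
      exact hB w k1 (by lia)

/-- For even c the letter at q' would be passed on both sides, and by maximality its right leg would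
lead to a later c; this pair would again surround P, which lies before q'. So c is odd, the left leg
of q leads to the top of a ladder, and q, P, q' extend it by one step. -/
theorem topPattern_of_joined (hL : Spaced L) (h : Closed (blank L P) Cap Cup) {c : ℕ}
    (hmax : ∀ t, t ∈ Cap ∨ t ∈ Cup → L t ≤ c) {q q' : ℤ} (hq : q ∈ Cup) (hq' : q' ∈ Cap)
    (hcons : Consecutive L c q q') (hP : L P = c + 1) (h1 : q < P) (h2 : P < q') (hc : 2 ≤ c) :
    TopPattern L P := by
  rcases Nat.even_or_odd' c with ⟨k, rfl | rfl⟩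
  · obtain ⟨j, rfl⟩ : ∃ j, k = j + 1 := ⟨k - 1, by lia⟩
    exfalso
    have hcup := even_cap hL h j (by lia) hq' hcons.right
    obtain ⟨w, w0, w1, w2, w3, w4⟩ := h.cup_right hcup hcons.right
    have := hmax w (.inl w0)
    have := joined_right hL h hcup w0 hcons.right (w3.resolve_left (by lia)) w1 w4
    lia
  · obtain ⟨j, rfl⟩ : ∃ j, k = j + 1 := ⟨k - 1, by lia⟩
    obtain ⟨t, t0, t1, t2, t3, t4, t5⟩ := h.cup_left hq hcons.left
    obtain ⟨x, x1, x2, x3⟩ := hL.exists_pred hc hcons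
    have htx : t ≤ x := by
      by_contra hlt
      exact (t5 x x1 (by lia) (by rintro rfl; lia) (by lia)).2 x3
    have ht : L t = 2 * j + 2 := by
      have := t4.resolve_left (hcons.between t t1 (by lia))
      lia
    have hcup := even_cap hL h j (by lia) t0 ht
    obtain ⟨α, β, γ, hlad, rfl⟩ := exists_ladder hL h j (by lia) hcup ht
    obtain ⟨w, w0, w1, w2, w3, w4⟩ := h.cup_right hcup ht
    have hw : L w = 2 * j + 3 := by
      refine w3.resolve_right fun w3 ↦ ?_
      have := joined_right hL h hcup w0 ht w3 w1 w4
      lia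
    have hq'3 := hcons.right
    have hwq : w = q' := by
      have i1 := hcons.between w (by lia)
      have i2 := w4 q' (by lia)
      have i3 := (h.cap_pos hq').1
      lia
    subst hwq
    obtain ⟨α', β', γ', hlad', hβ⟩ := hlad.extend hcons (t := P) (by lia) h1 h2 t1 w1
      fun s s1 s2 s3 ↦ by
        have hsP : s ≠ P := by rintro rfl; lia
        by_contra hne
        rcases lt_or_gt_of_ne hne with hlt | hlt
        · exact (t5 s s1 hlt hsP (by lia)).2 (by lia)
        · exact (w4 s hlt s2 hsP).2 s3
    exact ⟨j + 1, α', β', γ', by lia, hlad', hβ⟩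

/-- If a spaced word with one letter removed carries closed strands, then the letter lies in one
of four patterns. -/
theorem exists_pattern (hL : Spaced L) {M : ℕ} (hM : ∀ t, L t ≤ M)
    (h : Closed (blank L P) Cap Cup) (hne : ∃ t, t ∈ Cap ∨ t ∈ Cup) :
    TopPattern L P ∨ (∃ j α β γ q q', SidePattern (flip L) (-P) j α β γ q q') ∨
      (∃ j α β γ q q', SidePattern L P j α β γ q q') ∨ BondPattern L P := by
  obtain ⟨c, hmax, hc⟩ := exists_max hM hne
  obtain ⟨q, q', hq, hq', c1, c2, hlt, hno⟩ := exists_joined_of_max h hmax hc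
  obtain ⟨h1, h2, hP⟩ := joined_right hL h hq hq' c1 c2 hlt hno
  have hcons : Consecutive L c q q' := ⟨hlt, c1, c2, fun s s1 s2 s3 ↦ by
    by_cases hs : s = P
    · subst hs
      lia
    · exact (hno s s1 s2 hs).2 s3⟩
  have hpos := (h.cup_pos hq).2
  rcases hP with hP | ⟨hP, hc2, hfl⟩
  · rcases Nat.lt_or_ge c 2 with hc | hc
    · obtain rfl : c = 1 := by lia
      exact .inr (.inr (.inr ⟨q, q', h1, h2, .inl ⟨hcons, hP, fun s s1 s2 s3 ↦
        hL.succ_unique le_rfl hcons s1 s2 h1 h2 s3 hP⟩⟩))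
    · exact .inl (topPattern_of_joined hL h hmax hq hq' hcons hP h1 h2 hc)
  · have hno' : ∀ s, q < s → s < q' → L s ≠ c + 1 := by
      intro s s1 s2 s3
      by_cases hs : s = P
      · subst hs
        lia
      · exact (hno s s1 s2 hs).1 s3
    rcases Nat.lt_or_ge c 3 with hc | hc
    · obtain rfl : c = 2 := by lia
      have hP1 : L P = 1 := by lia
      exact .inr (.inr (.inr ⟨q, q', h1, h2, .inr ⟨hcons, hP1, fun s s1 s2 s3 ↦
        hL.one_unique hcons s1 s2 h1 h2 s3 hP1, hno'⟩⟩))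
    · rcases hfl with hf | hl
      · obtain ⟨j, α, β, γ, hS⟩ :=
          sidePattern_of_joined hL h hc hq hq' hcons hno' hP h1 h2 hf
        exact .inr (.inr (.inl ⟨j, α, β, γ, q, q', hS⟩))
      · obtain ⟨j, α, β, γ, hS⟩ := sidePattern_of_joined hL.flip h.flip_blank hc
          (q := -q') (q' := -q) (by simpa using hq') (by simpa using hq) hcons.flip
          (fun s s1 s2 ↦ hno' (-s) (by lia) (by lia)) (by simpa [flip] using hP) (by lia) (by lia)
          (fun s s1 s2 ↦ hl (-s) (by lia) (by lia))
        exact .inr (.inl ⟨j, α, β, γ, _, _, hS⟩)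

end TypeH

end

/-! ### Sorting words by commutations -/

noncomputable section

namespace TypeH

/-- The letters commute and are different. -/
def LetterDistant (x y : Letter) : Prop := x.1 + 1 < y.1 ∨ y.1 + 1 < x.1

theorem LetterDistant.symm {x y : Letter} (h : LetterDistant x y) : LetterDistant y x := Or.symm h

theorem CommStep.append {α β : List Letter} (h : CommStep α β) (u v : List Letter) :
    CommStep (u ++ α ++ v) (u ++ β ++ v) := by
  obtain ⟨u', v', x, y, h⟩ := h
  simpa using CommStep.swap (u ++ u') (v' ++ v) x y h

theorem CommEquiv.congr {α β : List Letter} (h : CommEquiv α β) (u v : List Letter) :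
    CommEquiv (u ++ α ++ v) (u ++ β ++ v) :=
  Relation.ReflTransGen.lift (fun ω ↦ u ++ ω ++ v) (fun _ _ h ↦ h.append u v) _ _ h

theorem CommEquiv.append {α β α' β' : List Letter} (h : CommEquiv α β) (h' : CommEquiv α' β') :
    CommEquiv (α ++ α') (β ++ β') := by
  have h1 := h.congr [] α'
  have h2 := h'.congr β []
  simp only [List.nil_append, List.append_nil] at h1 h2
  exact h1.trans h2

theorem CommEquiv.refl (α : List Letter) : CommEquiv α α := Relation.ReflTransGen.refl

theorem CommEquiv.cons {α β : List Letter} (x : Letter) (h : CommEquiv α β) :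
    CommEquiv (x :: α) (x :: β) := (CommEquiv.refl [x]).append h

theorem CommEquiv.reverse {α β : List Letter} (h : CommEquiv α β) :
    CommEquiv α.reverse β.reverse := by
  refine Relation.ReflTransGen.lift List.reverse ?_ _ _ h
  rintro _ _ ⟨u, v, x, y, h⟩
  change CommStep _ _
  simpa using CommStep.swap v.reverse u.reverse y x h.symm

theorem commEquiv_cons_append {x : Letter} {α : List Letter} (h : ∀ y ∈ α, LetterDistant x y)
    (β : List Letter) : CommEquiv (x :: α ++ β) (α ++ x :: β) := by
  induction α with
  | nil => exact .refl _
  | cons y α ih =>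
    have h1 : CommEquiv (x :: y :: (α ++ β)) (y :: x :: (α ++ β)) :=
      .single (CommStep.swap [] (α ++ β) x y (h y (by simp)))
    exact h1.trans ((ih fun z hz ↦ h z (by simp [hz])).cons y)

theorem commEquiv_of_perm {α β : List Letter} (h : α.Perm β) (hα : α.Pairwise LetterDistant) :
    CommEquiv α β := by
  induction h with
  | nil => exact .refl _
  | cons x _ ih => exact (ih (List.pairwise_cons.mp hα).2).cons x
  | swap x y l =>
    have := (List.pairwise_cons.mp hα).1 x (by simp)
    exact .single (CommStep.swap [] l y x this)
  | trans h1 _ ih1 ih2 =>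
    exact (ih1 hα).trans (ih2 ((h1.pairwise_iff fun h ↦ h.symm).mp hα))

theorem commEquiv_filter {X : Type*} (f : X → Letter) (p : X → Bool) (u : List X)
    (h : u.Pairwise fun x y ↦ p x = false → p y = true → LetterDistant (f x) (f y)) :
    CommEquiv (u.map f) ((u.filter p ++ u.filter fun x ↦ !p x).map f) := by
  induction u with
  | nil => exact .refl _
  | cons x u ih =>
    rw [List.pairwise_cons] at h
    have ih' := ih h.2
    cases hx : p x with
    | true => simpa [hx] using ih'.cons (f x)
    | false =>
      refine (ih'.cons (f x)).trans ?_
      have := commEquiv_cons_append (x := f x) (α := (u.filter p).map f) (by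
        intro y hy
        obtain ⟨z, hz, rfl⟩ := List.mem_map.mp hy
        rw [List.mem_filter] at hz
        exact h.1 z hz.1 hx hz.2) ((u.filter fun x ↦ !p x).map f)
      change CommEquiv _ _
      simpa [hx] using this

/-- A word can be sorted by a rank that is monotone on pairs of letters that do not commute. -/
theorem commEquiv_sort {X : Type*} (f : X → Letter) (rank : X → ℕ) (N : ℕ) (u : List X)
    (hN : ∀ x ∈ u, rank x < N)
    (h : u.Pairwise fun x y ↦ rank x ≤ rank y ∨ LetterDistant (f x) (f y)) :
    CommEquiv (u.map f) (((List.range N).flatMap fun r ↦ u.filter fun x ↦ rank x = r).map f) := by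
  induction N generalizing u with
  | zero =>
    cases u with
    | nil => exact .refl _
    | cons x u => exact absurd (hN x (by simp)) (by lia)
  | succ N ih =>
    have h1 := commEquiv_filter f (fun x ↦ rank x < N) u (h.imp fun {x y} hxy h1 h2 ↦ by
      simp only [decide_eq_false_iff_not, decide_eq_true_eq] at h1 h2
      exact hxy.resolve_left (by lia))
    refine h1.trans ?_
    have h2 := ih (u.filter fun x ↦ rank x < N) (fun x hx ↦ by simpa using (List.mem_filter.mp hx).2)
      (h.filter _)
    rw [List.range_succ, List.flatMap_append, List.map_append, List.map_append]
    refine CommEquiv.append ?_ ?_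
    · have : ((List.range N).flatMap fun r ↦ u.filter fun x ↦ rank x = r) =
          (List.range N).flatMap fun r ↦
            (u.filter fun x ↦ rank x < N).filter fun x ↦ rank x = r := by
        refine List.flatMap_congr fun r hr ↦ ?_
        rw [List.filter_filter]
        refine List.filter_congr fun x _ ↦ ?_
        have := List.mem_range.mp hr
        grind
      rw [this]
      exact h2
    · have : (u.filter fun x ↦ !decide (rank x < N)) = u.filter fun x ↦ rank x = N := by
        refine List.filter_congr fun x hx ↦ ?_
        have := hN x hx
        simp only [← decide_not, decide_eq_decide]
        lia
      simp only [this, List.flatMap_cons, List.flatMap_nil, List.append_nil]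
      exact .refl _

/-- Distinct letters of equal parity commute, so a layer may be listed by increasing index. -/
theorem commEquiv_layer {X : Type*} {u : List X} (hu : u.Nodup) (f : X → Letter) (p : X → Bool)
    (k c : ℕ) (α : ℕ → X) (hmem : ∀ t, t ∈ u ∧ p t = true ↔ ∃ i < k, t = α i)
    (hf : ∀ i < k, f (α i) = (2 * i + c, false)) :
    CommEquiv ((u.filter p).map f) (plain ((List.range k).map fun i ↦ 2 * i + c)) := by
  have hmap : ((List.range k).map α).map f = plain ((List.range k).map fun i ↦ 2 * i + c) := by
    simp only [plain, List.map_map]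
    refine List.map_congr_left fun i hi ↦ ?_
    simpa using hf i (by simpa using hi)
  have hpair : (plain ((List.range k).map fun i ↦ 2 * i + c)).Pairwise LetterDistant := by
    simp only [plain, List.map_map, List.pairwise_map]
    refine List.pairwise_lt_range.imp fun {a b} hab ↦ ?_
    simp [LetterDistant]
    lia
  have hperm : (u.filter p).Perm ((List.range k).map α) := by
    rw [List.perm_ext_iff_of_nodup (hu.filter _)]
    · intro t
      rw [List.mem_filter, hmem]
      simp [eq_comm]
    · refine List.Nodup.map_on ?_ List.nodup_range
      intro i hi i' hi' h
      have h1 := hf i (by simpa using hi)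
      have h2 := hf i' (by simpa using hi')
      rw [h, h2] at h1
      simp at h1
      lia
  have hperm' := hperm.map f
  rw [hmap] at hperm'
  exact commEquiv_of_perm hperm' ((hperm'.pairwise_iff fun h ↦ h.symm).mpr hpair)

theorem filter_eq_singleton {X : Type*} {u : List X} (hu : u.Nodup) (p : X → Bool) (x : X)
    (hmem : ∀ t, t ∈ u ∧ p t = true ↔ t = x) : u.filter p = [x] := by
  rw [← List.perm_singleton, List.perm_ext_iff_of_nodup (hu.filter _) (by simp)]
  intro t
  rw [List.mem_filter, hmem]
  simp

/-- The letter at a position, with a bar at `P`. -/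
def letterAt (L : ℤ → ℕ) (P t : ℤ) : Letter := (L t, decide (t = P))

theorem map_letterAt_eq_plain {L : ℤ → ℕ} {P : ℤ} {u : List ℤ} (h : P ∉ u) :
    u.map (letterAt L P) = plain (u.map L) := by
  simp only [plain, List.map_map]
  refine List.map_congr_left fun t ht ↦ ?_
  have : t ≠ P := fun h' ↦ h (h' ▸ ht)
  simp [letterAt, this]

end TypeH

end

/-! ### The layers of a ladder and form (i) -/

noncomputable section

namespace TypeH

variable {L : ℤ → ℕ} {P : ℤ}

/-- The list of the positions that carry letters, in increasing order. -/
structure Enumerates (L : ℤ → ℕ) (u : List ℤ) : Prop where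
  sorted : u.Pairwise (· < ·)
  mem_iff : ∀ t, t ∈ u ↔ 1 ≤ L t

theorem Enumerates.nodup {u : List ℤ} (hu : Enumerates L u) : u.Nodup :=
  hu.sorted.imp fun h ↦ h.ne

theorem Enumerates.commEquiv_sort {u : List ℤ} (hu : Enumerates L u) (rank : ℤ → ℕ) (N : ℕ)
    (hN : ∀ t, 1 ≤ L t → rank t < N)
    (h : ∀ x y, x < y → 1 ≤ L x → 1 ≤ L y → L x ≤ L y + 1 → L y ≤ L x + 1 → rank x ≤ rank y) :
    CommEquiv (u.map (letterAt L P)) (((List.range N).flatMap fun r ↦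
      u.filter fun x ↦ rank x = r).map (letterAt L P)) := by
  refine TypeH.commEquiv_sort _ rank N u (fun t ht ↦ hN t ((hu.mem_iff t).mp ht)) ?_
  refine hu.sorted.imp_of_mem fun {x y} hx hy hxy ↦ ?_
  by_cases hd : LetterDistant (letterAt L P x) (letterAt L P y)
  · exact .inr hd
  · refine .inl (h x y hxy ((hu.mem_iff x).mp hx) ((hu.mem_iff y).mp hy) ?_ ?_) <;>
      simp only [LetterDistant, letterAt] at hd <;> lia

/-- The place of a position in a ladder: `0` before it, `1` on the first odd letters, `2` on the
even letters, `3` on the last odd letters, `4` after it. -/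
def ladderRank (L : ℤ → ℕ) (α β γ : ℕ → ℤ) (t : ℤ) : ℕ :=
  if L t % 2 = 1 then
    if t < α (L t / 2) then 0 else if t = α (L t / 2) then 1 else if t = γ (L t / 2) then 3 else 4
  else if t < β (L t / 2 - 1) then 0 else if t = β (L t / 2 - 1) then 2 else 4

theorem ladderRank_odd {α β γ : ℕ → ℤ} {i : ℕ} (h : Consecutive L (2 * i + 1) (α i) (γ i)) {t : ℤ}
    (ht : L t = 2 * i + 1) :
    (t < α i ∧ ladderRank L α β γ t = 0) ∨ (t = α i ∧ ladderRank L α β γ t = 1) ∨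
      (t = γ i ∧ ladderRank L α β γ t = 3) ∨ (γ i < t ∧ ladderRank L α β γ t = 4) := by
  have h1 : L t % 2 = 1 := by lia
  have h2 : L t / 2 = i := by lia
  have h3 := h.lt
  simp only [ladderRank, h1, h2, if_true]
  by_cases h4 : t < α i
  · simp [h4]
  by_cases h5 : t = α i
  · simp [h5]
  by_cases h6 : t = γ i
  · have h7 : ¬ γ i < α i := by lia
    simp [h6, h7, h3.ne']
  have h7 : γ i < t := by
    by_contra hlt
    exact h.between t (by lia) (by lia) ht
  simp [h4, h5, h6, h7]

theorem ladderRank_even {α β γ : ℕ → ℤ} {i : ℕ} {t : ℤ} (ht : L t = 2 * i + 2) :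
    (t < β i ∧ ladderRank L α β γ t = 0) ∨ (t = β i ∧ ladderRank L α β γ t = 2) ∨
      (β i < t ∧ ladderRank L α β γ t = 4) := by
  have h1 : L t % 2 ≠ 1 := by lia
  have h2 : L t / 2 - 1 = i := by lia
  simp only [ladderRank, h1, h2, if_false]
  grind

/-- A wrong order of two neighbouring letters would put a second even letter between paired odd
ones. This is excluded by `succ_unique` for the even letter above the pair and by `Ladder.unique`
for the one below. -/
theorem Ladder.rank_mono (hL : Spaced L) {j : ℕ} {α β γ : ℕ → ℤ} (h : Ladder L j α β γ) {x y : ℤ}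
    (hxy : x < y) (hx : 1 ≤ L x) (hy : 1 ≤ L y) (hx' : L x ≤ 2 * j + 2) (hy' : L y ≤ 2 * j + 2)
    (h1 : L x ≤ L y + 1) (h2 : L y ≤ L x + 1) :
    ladderRank L α β γ x ≤ ladderRank L α β γ y := by
  have odd_or_even : ∀ t, 1 ≤ L t → L t ≤ 2 * j + 2 →
      ∃ i ≤ j, L t = 2 * i + 1 ∨ L t = 2 * i + 2 := fun t _ _ ↦ ⟨(L t - 1) / 2, by lia, by lia⟩
  have key : ∀ i ≤ j, ∀ s, α i < s → s < γ i → L s = 2 * i + 2 → s = β i := fun i hi s s1 s2 s3 ↦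
    hL.succ_unique (by lia) (h.consecutive i hi) s1 s2 (h.lt i hi) (h.lt' i hi) s3 (h.even i hi)
  obtain ⟨i, hi, hix⟩ := odd_or_even x hx hx'
  obtain ⟨i', hi', hiy⟩ := odd_or_even y hy hy'
  have c1 := h.consecutive i hi
  have c2 := h.consecutive i' hi'
  have l1 := h.lt i hi
  have l2 := h.lt' i hi
  have l3 := c1.lt
  have l1' := h.lt i' hi'
  have l2' := h.lt' i' hi'
  have l3' := c2.lt
  rcases hix with hix | hix <;> rcases hiy with hiy | hiy
  · obtain rfl : i = i' := by lia
    have a1 := ladderRank_odd (β := β) c1 hix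
    have a2 := ladderRank_odd (β := β) c1 hiy
    lia
  · have a1 := ladderRank_odd (β := β) c1 hix
    have a2 := ladderRank_even (α := α) (β := β) (γ := γ) hiy
    obtain rfl | rfl : i = i' ∨ i = i' + 1 := by lia
    · have := key i hi y
      lia
    · have := h.unique i' (by lia) y
      have := h.succ_lt i' (by lia)
      have := h.succ_lt' i' (by lia)
      lia
  · have a1 := ladderRank_odd (β := β) c2 hiy
    have a2 := ladderRank_even (α := α) (β := β) (γ := γ) hix
    obtain rfl | rfl : i' = i ∨ i' = i + 1 := by lia
    · have := key i' hi x
      lia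
    · have := h.unique i (by lia) x
      have := h.succ_lt i (by lia)
      have := h.succ_lt' i (by lia)
      lia
  · obtain rfl : i = i' := by lia
    have a1 := ladderRank_even (α := α) (β := β) (γ := γ) hix
    have a2 := ladderRank_even (α := α) (β := β) (γ := γ) hiy
    lia

theorem Ladder.rank_eq_one_iff {j : ℕ} {α β γ : ℕ → ℤ} (h : Ladder L j α β γ) {t : ℤ} (ht : 1 ≤ L t)
    (ht' : L t ≤ 2 * j + 2) : ladderRank L α β γ t = 1 ↔ ∃ i < j + 1, t = α i := by
  constructor
  · intro hr
    refine ⟨(L t - 1) / 2, by lia, ?_⟩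
    obtain h1 | h1 : L t = 2 * ((L t - 1) / 2) + 1 ∨ L t = 2 * ((L t - 1) / 2) + 2 := by lia
    · have := ladderRank_odd (β := β) (h.consecutive _ (by lia)) h1
      lia
    · have := ladderRank_even (α := α) (β := β) (γ := γ) h1
      lia
  · rintro ⟨i, hi, rfl⟩
    have h1 := h.consecutive i (by lia)
    have := ladderRank_odd (β := β) h1 h1.left
    have := h1.lt
    lia

theorem Ladder.rank_eq_three_iff {j : ℕ} {α β γ : ℕ → ℤ} (h : Ladder L j α β γ) {t : ℤ}
    (ht : 1 ≤ L t) (ht' : L t ≤ 2 * j + 2) :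
    ladderRank L α β γ t = 3 ↔ ∃ i < j + 1, t = γ i := by
  constructor
  · intro hr
    refine ⟨(L t - 1) / 2, by lia, ?_⟩
    obtain h1 | h1 : L t = 2 * ((L t - 1) / 2) + 1 ∨ L t = 2 * ((L t - 1) / 2) + 2 := by lia
    · have := ladderRank_odd (β := β) (h.consecutive _ (by lia)) h1
      lia
    · have := ladderRank_even (α := α) (β := β) (γ := γ) h1
      lia
  · rintro ⟨i, hi, rfl⟩
    have h1 := h.consecutive i (by lia)
    have := ladderRank_odd (β := β) h1 h1.right
    have := h1.lt
    lia

theorem Ladder.rank_eq_two_iff {j : ℕ} {α β γ : ℕ → ℤ} (h : Ladder L j α β γ) {t : ℤ}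
    (ht : 1 ≤ L t) (ht' : L t ≤ 2 * j + 2) :
    ladderRank L α β γ t = 2 ↔ ∃ i < j + 1, t = β i := by
  constructor
  · intro hr
    refine ⟨(L t - 1) / 2, by lia, ?_⟩
    obtain h1 | h1 : L t = 2 * ((L t - 1) / 2) + 1 ∨ L t = 2 * ((L t - 1) / 2) + 2 := by lia
    · have := ladderRank_odd (β := β) (h.consecutive _ (by lia)) h1
      lia
    · have := ladderRank_even (α := α) (β := β) (γ := γ) h1
      lia
  · rintro ⟨i, hi, rfl⟩
    have := ladderRank_even (α := α) (β := β) (γ := γ) (h.even i (by lia))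
    lia

theorem ladderRank_le (L : ℤ → ℕ) (α β γ : ℕ → ℤ) (t : ℤ) : ladderRank L α β γ t ≤ 4 := by
  unfold ladderRank
  split_ifs <;> lia

theorem commEquiv_plain_filter (u : List ℤ) (p : ℤ → Bool) (hP : p P = false) :
    CommEquiv ((u.filter p).map (letterAt L P)) (plain ((u.filter p).map L)) := by
  rw [map_letterAt_eq_plain (by simp [hP])]
  exact .refl _

theorem commEquiv_letter_filter {u : List ℤ} (hu : Enumerates L u) (p : ℤ → Bool) {x : ℤ}
    (hx : 1 ≤ L x) (hmem : ∀ t, 1 ≤ L t → (p t = true ↔ t = x)) :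
    CommEquiv ((u.filter p).map (letterAt L P)) [(L x, decide (x = P))] := by
  rw [filter_eq_singleton hu.nodup p x]
  · exact .refl _
  · intro t
    rw [hu.mem_iff]
    constructor
    · rintro ⟨h1, h2⟩
      exact (hmem t h1).mp h2
    · rintro rfl
      exact ⟨hx, (hmem t hx).mpr rfl⟩

theorem commEquiv_ladder_filter {u : List ℤ} (hu : Enumerates L u) (p : ℤ → Bool) (k c : ℕ)
    (hc : 1 ≤ c) (α : ℕ → ℤ) (hα : ∀ i < k, L (α i) = 2 * i + c ∧ α i ≠ P)
    (hmem : ∀ t, 1 ≤ L t → (p t = true ↔ ∃ i < k, t = α i)) :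
    CommEquiv ((u.filter p).map (letterAt L P)) (plain ((List.range k).map fun i ↦ 2 * i + c)) := by
  refine commEquiv_layer hu.nodup _ _ k c α (fun t ↦ ?_) fun i hi ↦ by simp [letterAt, hα i hi]
  rw [hu.mem_iff]
  constructor
  · rintro ⟨h1, h2⟩
    exact (hmem t h1).mp h2
  · rintro ⟨i, hi, rfl⟩
    have h1 : 1 ≤ L (α i) := by rw [(hα i hi).1]; lia
    exact ⟨h1, (hmem _ h1).mpr ⟨i, hi, rfl⟩⟩

theorem TopPattern.parseI (hL : Spaced L) (h : TopPattern L P) {u : List ℤ} (hu : Enumerates L u) :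
    ParseI (L P) (u.map (letterAt L P)) := by
  obtain ⟨j, α, β, γ, hj, h, rfl⟩ := h
  have hP := h.even j le_rfl
  -- The even layer is split so that the barred letter comes last; letters above 2j + 2 go to w₁ or
  -- w₂ according to their side of it.
  set rank : ℤ → ℕ := fun t ↦ if 2 * j + 2 < L t then (if t < β j then 0 else 5) else
    if ladderRank L α β γ t = 2 then (if t = β j then 3 else 2) else
    if 3 ≤ ladderRank L α β γ t then ladderRank L α β γ t + 1 else ladderRank L α β γ t with hrank
  have hbig : ∀ t, 2 * j + 2 < L t → t < β j ∧ rank t = 0 ∨ β j < t ∧ rank t = 5 := by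
    intro t ht
    have : t ≠ β j := by rintro rfl; lia
    simp only [hrank, ht, if_true]
    split_ifs <;> lia
  have hsmall : ∀ t, L t ≤ 2 * j + 2 → rank t = if ladderRank L α β γ t = 2 then
      (if t = β j then 3 else 2) else
      if 3 ≤ ladderRank L α β γ t then ladderRank L α β γ t + 1 else ladderRank L α β γ t :=
    fun t ht ↦ by simp only [hrank, (by lia : ¬ 2 * j + 2 < L t), if_false]
  have hsort := hu.commEquiv_sort (P := β j) rank 6 (fun t ht ↦ by
      have := ladderRank_le L α β γ t
      simp only [hrank]
      split_ifs <;> lia) (by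
    intro x y hxy hx hy h1 h2
    rcases Nat.lt_or_ge (2 * j + 2) (L x) with hx' | hx' <;>
      rcases Nat.lt_or_ge (2 * j + 2) (L y) with hy' | hy'
    · have := hbig x hx'
      have := hbig y hy'
      lia
    · have := hbig x hx'
      have := ladderRank_even (L := L) (α := α) (β := β) (γ := γ) (i := j) (t := y) (by lia)
      have := hsmall y hy'
      grind
    · have := hbig y hy'
      have := ladderRank_even (L := L) (α := α) (β := β) (γ := γ) (i := j) (t := x) (by lia)
      have := hsmall x hx'
      grind
    · have h3 := h.rank_mono hL hxy hx hy hx' hy' h1 h2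
      rw [hsmall x hx', hsmall y hy']
      by_cases hxj : x = β j
      · subst hxj
        have a1 := ladderRank_even (α := α) (β := β) (γ := γ) hP
        by_cases hy2 : ladderRank L α β γ y = 2
        · exfalso
          obtain ⟨i, hi, rfl⟩ := (h.rank_eq_two_iff hy hy').mp hy2
          have a2 := h.even i (by lia)
          obtain rfl : i = j := by lia
          lia
        · grind
      · grind)
  refine ⟨j + 1, (u.filter fun t ↦ rank t = 0).map L, (u.filter fun t ↦ rank t = 5).map L, by lia,
    by lia, ?_⟩
  have hP3 : rank (β j) = 3 := by
    rw [hsmall _ (by lia)]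
    have := ladderRank_even (α := α) (β := β) (γ := γ) hP
    grind
  have e : ∀ g : ℕ → List ℤ, (List.range 6).flatMap g = g 0 ++ g 1 ++ g 2 ++ g 3 ++ g 4 ++ g 5 := by
    intro g
    simp [List.range_succ]
  rw [e] at hsort
  simp only [List.map_append] at hsort
  refine hsort.trans ?_
  have hγ : ∀ i < j + 1, L (γ i) = 2 * i + 1 ∧ γ i ≠ β j := fun i hi ↦ by
    have h1 := (h.consecutive i (by lia)).right
    exact ⟨h1, fun h2 ↦ by rw [h2] at h1; lia⟩
  have hα : ∀ i < j + 1, L (α i) = 2 * i + 1 ∧ α i ≠ β j := fun i hi ↦ by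
    have h1 := (h.consecutive i (by lia)).left
    exact ⟨h1, fun h2 ↦ by rw [h2] at h1; lia⟩
  have hβ : ∀ i < j, L (β i) = 2 * i + 2 ∧ β i ≠ β j := fun i hi ↦ by
    have h1 := h.even i (by lia)
    exact ⟨h1, fun h2 ↦ by rw [h2] at h1; lia⟩
  refine (((((commEquiv_plain_filter u _ (by simp [hP3])).append ?_).append ?_).append ?_).append
    ?_).append (commEquiv_plain_filter u _ (by simp [hP3]))
  · refine commEquiv_ladder_filter hu _ (j + 1) 1 le_rfl α hα fun t ht ↦ ?_
    simp only [decide_eq_true_eq]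
    rcases Nat.lt_or_ge (2 * j + 2) (L t) with ht' | ht'
    · have := hbig t ht'
      constructor
      · lia
      · rintro ⟨i, hi, rfl⟩
        have := hα i hi
        lia
    · rw [← h.rank_eq_one_iff ht ht', hsmall t ht']
      grind
  · refine commEquiv_ladder_filter hu _ j 2 (by lia) β hβ fun t ht ↦ ?_
    simp only [decide_eq_true_eq]
    rcases Nat.lt_or_ge (2 * j + 2) (L t) with ht' | ht'
    · have := hbig t ht'
      constructor
      · lia
      · rintro ⟨i, hi, rfl⟩
        have := hβ i hi
        lia
    · have h2 := h.rank_eq_two_iff ht ht'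
      have : (∃ i < j, t = β i) ↔ ladderRank L α β γ t = 2 ∧ t ≠ β j := by
        rw [h2]
        constructor
        · rintro ⟨i, hi, rfl⟩
          exact ⟨⟨i, by lia, rfl⟩, (hβ i hi).2⟩
        · rintro ⟨⟨i, hi, rfl⟩, hne⟩
          refine ⟨i, ?_, rfl⟩
          by_contra hij
          exact hne (by rw [(by lia : i = j)])
      rw [this, hsmall t ht']
      grind
  · have := commEquiv_letter_filter (P := β j) hu (fun t ↦ decide (rank t = 3)) (x := β j) (by lia)
      fun t ht ↦ ?_
    · rw [hP, (by lia : 2 * j + 2 = 2 * (j + 1))] at this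
      simpa [barred] using this
    · simp only [decide_eq_true_eq]
      refine ⟨fun h3 ↦ ?_, fun h3 ↦ by rw [h3, hP3]⟩
      rcases Nat.lt_or_ge (2 * j + 2) (L t) with ht' | ht'
      · have := hbig t ht'
        lia
      · rw [hsmall t ht'] at h3
        grind
  · refine commEquiv_ladder_filter hu _ (j + 1) 1 le_rfl γ hγ fun t ht ↦ ?_
    simp only [decide_eq_true_eq]
    rcases Nat.lt_or_ge (2 * j + 2) (L t) with ht' | ht'
    · have := hbig t ht'
      constructor
      · lia
      · rintro ⟨i, hi, rfl⟩
        have := hγ i hi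
        lia
    · rw [← h.rank_eq_three_iff ht ht', hsmall t ht']
      grind

end TypeH

end

/-! ### Forms (ii), (iii) and (iv) -/

noncomputable section

namespace TypeH

variable {L : ℤ → ℕ} {P : ℤ}

/-- The layers of the pattern of `ParseIII`. -/
def sideRank (L : ℤ → ℕ) (P : ℤ) (j : ℕ) (α β γ : ℕ → ℤ) (q q' t : ℤ) : ℕ :=
  if 2 * j + 3 < L t then (if t < q then 0 else if t < q' then 3 else 7)
  else if L t = 2 * j + 3 then (if t < q then 0 else if t = q then 1 else if t = q' then 6 else 7)
  else if t = P then 2 else ladderRank L α β γ t + 3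

/-- The values of `sideRank`. -/
structure SideRankSpec (L : ℤ → ℕ) (P : ℤ) (j : ℕ) (α β γ : ℕ → ℤ) (q q' : ℤ) (rank : ℤ → ℕ) :
    Prop where
  big : ∀ t, 2 * j + 3 < L t →
    t < q ∧ rank t = 0 ∨ q < t ∧ t < q' ∧ rank t = 3 ∨ q' < t ∧ rank t = 7
  mid : ∀ t, L t = 2 * j + 3 → t < q ∧ rank t = 0 ∨ t = q ∧ rank t = 1 ∨
    t = q' ∧ rank t = 6 ∨ q' < t ∧ rank t = 7
  at_P : rank P = 2
  small : ∀ t, L t ≤ 2 * j + 2 → t ≠ P → rank t = ladderRank L α β γ t + 3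
  top : ∀ t, L t = 2 * j + 2 → t = P ∧ rank t = 2 ∨ t = β j ∧ rank t = 5 ∨ q' < t ∧ rank t = 7

theorem SidePattern.sideRank_spec {j : ℕ} {α β γ : ℕ → ℤ} {q q' : ℤ}
    (h : SidePattern L P j α β γ q q') :
    SideRankSpec L P j α β γ q q' (sideRank L P j α β γ q q') := by
  obtain ⟨h, hP, hcons, hno, hqP, hPβ, hβq, hpred, hbefore⟩ := h
  have hβj := h.even j le_rfl
  have hq := hcons.left
  have hq' := hcons.right
  set rank : ℤ → ℕ := sideRank L P j α β γ q q' with hrank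
  have hbig : ∀ t, 2 * j + 3 < L t →
      t < q ∧ rank t = 0 ∨ q < t ∧ t < q' ∧ rank t = 3 ∨ q' < t ∧ rank t = 7 := by
    intro t ht
    have : t ≠ q := by rintro rfl; lia
    have : t ≠ q' := by rintro rfl; lia
    simp only [hrank, sideRank, ht, if_true]
    split_ifs <;> lia
  have hmid : ∀ t, L t = 2 * j + 3 → t < q ∧ rank t = 0 ∨ t = q ∧ rank t = 1 ∨
      t = q' ∧ rank t = 6 ∨ q' < t ∧ rank t = 7 := by
    intro t ht
    have := hcons.between t
    have := hcons.lt
    simp only [hrank, sideRank, ht, if_false, if_true, lt_irrefl]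
    split_ifs <;> lia
  have hrP : rank P = 2 := by
    simp only [hrank, sideRank, (by lia : ¬ 2 * j + 3 < L P), (by lia : L P ≠ 2 * j + 3), if_false, if_true]
  have hsmall : ∀ t, L t ≤ 2 * j + 2 → t ≠ P → rank t = ladderRank L α β γ t + 3 := fun t ht hne ↦ by
    simp only [hrank, sideRank, (by lia : ¬ 2 * j + 3 < L t), (by lia : L t ≠ 2 * j + 3), hne, if_false]
  have htop : ∀ t, L t = 2 * j + 2 → t = P ∧ rank t = 2 ∨ t = β j ∧ rank t = 5 ∨
      q' < t ∧ rank t = 7 := by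
    intro t ht
    by_cases htP : t = P
    · subst htP; exact .inl ⟨rfl, hrP⟩
    · have a1 := hsmall t (by lia) htP
      have a2 := ladderRank_even (L := L) (α := α) (β := β) (γ := γ) ht
      have a3 := hpred t
      have a4 := (hbefore t).mt (by lia)
      have : t ≠ q' := by rintro rfl; lia
      lia
  exact ⟨hbig, hmid, hrP, hsmall, htop⟩

/-- No 2j + 1 or 2j + 2 precedes P, so P can be placed directly after q and before all remaining
letters up to 2j + 2. No 2j + 4 lies between q and q', so the larger letters there can be placed
between these two. -/
theorem SidePattern.rank_mono (hL : Spaced L) {j : ℕ} {α β γ : ℕ → ℤ} {q q' : ℤ}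
    (h : SidePattern L P j α β γ q q') {rank : ℤ → ℕ}
    (hr : SideRankSpec L P j α β γ q q' rank) {x y : ℤ} (hxy : x < y)
    (hx : 1 ≤ L x) (hy : 1 ≤ L y) (h1 : L x ≤ L y + 1) (h2 : L y ≤ L x + 1) :
    rank x ≤ rank y := by
  obtain ⟨h, hP, hcons, hno, hqP, hPβ, hβq, hpred, hbefore⟩ := h
  have hβj := h.even j le_rfl
  have hq := hcons.left
  have hq' := hcons.right
  obtain ⟨hbig, hmid, hrP, hsmall, htop⟩ := hr
  have hx3 := lt_trichotomy (L x) (2 * j + 3)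
  have hy3 := lt_trichotomy (L y) (2 * j + 3)
  rcases hx3 with hx' | hx' | hx' <;> rcases hy3 with hy' | hy' | hy'
  · by_cases hxP : x = P
    · subst hxP
      have := hsmall y (by lia) (by lia)
      lia
    by_cases hyP : y = P
    · have a1 := (hbefore x).mt
      by_cases hx2 : L x = 2 * j + 3
      · lia
      · subst hyP
        have := hbefore x hxy
        lia
    · rw [hsmall x (by lia) hxP, hsmall y (by lia) hyP]
      have := h.rank_mono hL hxy hx hy (by lia) (by lia) h1 h2
      lia
  · have a1 := hmid y hy'
    have a2 := htop x (by lia)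
    lia
  · lia
  · have a1 := hmid x hx'
    have a2 := htop y (by lia)
    lia
  · have a1 := hmid x hx'
    have a2 := hmid y hy'
    lia
  · have a1 := hmid x hx'
    have a2 := hbig y hy'
    have a3 := hno y
    lia
  · lia
  · have a1 := hbig x hx'
    have a2 := hmid y hy'
    have a3 := hno x
    lia
  · have a1 := hbig x hx'
    have a2 := hbig y hy'
    have := hcons.lt
    lia

theorem SidePattern.layer_one {j : ℕ} {α β γ : ℕ → ℤ} {q q' : ℤ}
    (h : SidePattern L P j α β γ q q') {rank : ℤ → ℕ}
    (hr : SideRankSpec L P j α β γ q q' rank) {u : List ℤ} (hu : Enumerates L u) :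
    CommEquiv ((u.filter fun t ↦ rank t = 1).map (letterAt L P)) (plain [2 * (j + 1) + 1]) := by
  obtain ⟨h, hP, hcons, hno, hqP, hPβ, hβq, hpred, hbefore⟩ := h
  have hβj := h.even j le_rfl
  have hq := hcons.left
  have hq' := hcons.right
  obtain ⟨hbig, hmid, hrP, hsmall, htop⟩ := hr
  have := commEquiv_letter_filter (P := P) hu (fun t ↦ decide (rank t = 1)) (x := q) (by lia)
    fun t ht ↦ ?_
  · rw [hq, (by lia : 2 * j + 3 = 2 * (j + 1) + 1)] at this
    have hqne : q ≠ P := by lia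
    simpa [plain, hqne] using this
  · simp only [decide_eq_true_eq]
    constructor
    · intro h1
      rcases lt_trichotomy (L t) (2 * j + 3) with ht' | ht' | ht'
      · by_cases htP : t = P
        · subst htP; lia
        · have := hsmall t (by lia) htP
          lia
      · have := hmid t ht'
        lia
      · have := hbig t ht'
        lia
    · rintro rfl
      have := hmid t hq
      have := hcons.lt
      lia

theorem SidePattern.layer_two {j : ℕ} {α β γ : ℕ → ℤ} {q q' : ℤ}
    (h : SidePattern L P j α β γ q q') {rank : ℤ → ℕ}
    (hr : SideRankSpec L P j α β γ q q' rank) {u : List ℤ} (hu : Enumerates L u) :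
    CommEquiv ((u.filter fun t ↦ rank t = 2).map (letterAt L P)) [barred (2 * (j + 1))] := by
  obtain ⟨h, hP, hcons, hno, hqP, hPβ, hβq, hpred, hbefore⟩ := h
  have hβj := h.even j le_rfl
  have hq := hcons.left
  have hq' := hcons.right
  obtain ⟨hbig, hmid, hrP, hsmall, htop⟩ := hr
  have := commEquiv_letter_filter (P := P) hu (fun t ↦ decide (rank t = 2)) (x := P) (by lia)
    fun t ht ↦ ?_
  · rw [hP, (by lia : 2 * j + 2 = 2 * (j + 1))] at this
    simpa [barred] using this
  · simp only [decide_eq_true_eq]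
    refine ⟨fun h2 ↦ ?_, fun h2 ↦ by rw [h2, hrP]⟩
    by_contra htP
    rcases lt_trichotomy (L t) (2 * j + 3) with ht' | ht' | ht'
    · have := hsmall t (by lia) htP
      lia
    · have := hmid t ht'
      lia
    · have := hbig t ht'
      lia

theorem SidePattern.layer_four {j : ℕ} {α β γ : ℕ → ℤ} {q q' : ℤ}
    (h : SidePattern L P j α β γ q q') {rank : ℤ → ℕ}
    (hr : SideRankSpec L P j α β γ q q' rank) {u : List ℤ} (hu : Enumerates L u) :
    CommEquiv ((u.filter fun t ↦ rank t = 4).map (letterAt L P)) (plain (odds (j + 1))) := by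
  obtain ⟨h, hP, hcons, hno, hqP, hPβ, hβq, hpred, hbefore⟩ := h
  have hβj := h.even j le_rfl
  have hq := hcons.left
  have hq' := hcons.right
  obtain ⟨hbig, hmid, hrP, hsmall, htop⟩ := hr
  have hα : ∀ i < j + 1, L (α i) = 2 * i + 1 ∧ α i ≠ P := fun i hi ↦ by
    have h1 := (h.consecutive i (by lia)).left
    exact ⟨h1, fun h2 ↦ by rw [h2] at h1; lia⟩
  refine commEquiv_ladder_filter hu _ (j + 1) 1 le_rfl α hα fun t ht ↦ ?_
  simp only [decide_eq_true_eq]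
  have aux : (∃ i < j + 1, t = α i) → L t ≤ 2 * j + 2 ∧ t ≠ P := by
    rintro ⟨i, hi, rfl⟩
    have := hα i hi
    exact ⟨by lia, this.2⟩
  rcases lt_trichotomy (L t) (2 * j + 3) with ht' | ht' | ht'
  · by_cases htP : t = P
    · subst htP
      refine ⟨by lia, fun h1 ↦ absurd rfl (aux h1).2⟩
    · rw [hsmall t (by lia) htP, ← h.rank_eq_one_iff ht (by lia)]
      lia
  · have := hmid t ht'
    exact ⟨by lia, fun h1 ↦ by have := aux h1; lia⟩
  · have := hbig t ht'
    exact ⟨by lia, fun h1 ↦ by have := aux h1; lia⟩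

theorem SidePattern.layer_five {j : ℕ} {α β γ : ℕ → ℤ} {q q' : ℤ}
    (h : SidePattern L P j α β γ q q') {rank : ℤ → ℕ}
    (hr : SideRankSpec L P j α β γ q q' rank) {u : List ℤ} (hu : Enumerates L u) :
    CommEquiv ((u.filter fun t ↦ rank t = 5).map (letterAt L P)) (plain (evens (j + 1))) := by
  obtain ⟨h, hP, hcons, hno, hqP, hPβ, hβq, hpred, hbefore⟩ := h
  have hβj := h.even j le_rfl
  have hq := hcons.left
  have hq' := hcons.right
  obtain ⟨hbig, hmid, hrP, hsmall, htop⟩ := hr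
  have hβ : ∀ i < j + 1, L (β i) = 2 * i + 2 ∧ β i ≠ P := fun i hi ↦ by
    have h1 := h.even i (by lia)
    refine ⟨h1, fun h2 ↦ ?_⟩
    rw [h2] at h1
    obtain rfl : i = j := by lia
    lia
  refine commEquiv_ladder_filter hu _ (j + 1) 2 (by lia) β hβ fun t ht ↦ ?_
  simp only [decide_eq_true_eq]
  have aux : (∃ i < j + 1, t = β i) → L t ≤ 2 * j + 2 ∧ t ≠ P := by
    rintro ⟨i, hi, rfl⟩
    have := hβ i hi
    exact ⟨by lia, this.2⟩
  rcases lt_trichotomy (L t) (2 * j + 3) with ht' | ht' | ht'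
  · by_cases htP : t = P
    · subst htP
      refine ⟨by lia, fun h1 ↦ absurd rfl (aux h1).2⟩
    · rw [hsmall t (by lia) htP, ← h.rank_eq_two_iff ht (by lia)]
      lia
  · have := hmid t ht'
    exact ⟨by lia, fun h1 ↦ by have := aux h1; lia⟩
  · have := hbig t ht'
    exact ⟨by lia, fun h1 ↦ by have := aux h1; lia⟩

theorem SidePattern.layer_six {j : ℕ} {α β γ : ℕ → ℤ} {q q' : ℤ}
    (h : SidePattern L P j α β γ q q') {rank : ℤ → ℕ}
    (hr : SideRankSpec L P j α β γ q q' rank) {u : List ℤ} (hu : Enumerates L u) :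
    CommEquiv ((u.filter fun t ↦ rank t = 6).map (letterAt L P)) (plain (odds (j + 2))) := by
  obtain ⟨h, hP, hcons, hno, hqP, hPβ, hβq, hpred, hbefore⟩ := h
  have hβj := h.even j le_rfl
  have hq := hcons.left
  have hq' := hcons.right
  obtain ⟨hbig, hmid, hrP, hsmall, htop⟩ := hr
  have hγ : ∀ i < j + 1, L (γ i) = 2 * i + 1 ∧ γ i ≠ P := fun i hi ↦ by
    have h1 := (h.consecutive i (by lia)).right
    exact ⟨h1, fun h2 ↦ by rw [h2] at h1; lia⟩
  refine commEquiv_ladder_filter hu _ (j + 2) 1 le_rfl (fun i ↦ if i ≤ j then γ i else q') ?_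
    fun t ht ↦ ?_
  · intro i hi
    by_cases hij : i ≤ j
    · simp only [hij, if_true]
      exact hγ i (by lia)
    · obtain rfl : i = j + 1 := by lia
      simp only [hij, if_false]
      exact ⟨by lia, by lia⟩
  simp only [decide_eq_true_eq]
  have aux : (∃ i < j + 2, t = if i ≤ j then γ i else q') ↔ (∃ i < j + 1, t = γ i) ∨ t = q' := by
    constructor
    · rintro ⟨i, hi, hti⟩
      by_cases hij : i ≤ j
      · exact .inl ⟨i, by lia, by simpa [hij] using hti⟩
      · exact .inr (by simpa [hij] using hti)
    · rintro (⟨i, hi, hti⟩ | hti)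
      · exact ⟨i, by lia, by simpa [(by lia : i ≤ j)] using hti⟩
      · exact ⟨j + 1, by lia, by simpa using hti⟩
  rw [aux]
  have aux' : (∃ i < j + 1, t = γ i) → L t ≤ 2 * j + 2 ∧ t ≠ P := by
    rintro ⟨i, hi, rfl⟩
    have := hγ i hi
    exact ⟨by lia, this.2⟩
  rcases lt_trichotomy (L t) (2 * j + 3) with ht' | ht' | ht'
  · have htq : t ≠ q' := by rintro rfl; lia
    by_cases htP : t = P
    · subst htP
      refine ⟨by lia, fun h1 ↦ h1.elim (fun h1 ↦ absurd rfl (aux' h1).2) fun h1 ↦ absurd h1 htq⟩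
    · rw [hsmall t (by lia) htP, ← h.rank_eq_three_iff ht (by lia)]
      lia
  · have := hmid t ht'
    have := hcons.lt
    refine ⟨fun h6 ↦ .inr (by lia), fun h1 ↦ h1.elim (fun h1 ↦ ?_) fun h1 ↦ by lia⟩
    have := aux' h1
    lia
  · have := hbig t ht'
    refine ⟨by lia, fun h1 ↦ h1.elim (fun h1 ↦ ?_) fun h1 ↦ by subst h1; lia⟩
    have := aux' h1
    lia

theorem SidePattern.parseIII (hL : Spaced L) {j : ℕ} {α β γ : ℕ → ℤ} {q q' : ℤ}
    (h : SidePattern L P j α β γ q q') {u : List ℤ} (hu : Enumerates L u) :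
    ParseIII (L P) (u.map (letterAt L P)) := by
  have hr := h.sideRank_spec
  set rank := sideRank L P j α β γ q q' with hrank
  have hsort := hu.commEquiv_sort (P := P) rank 8 (fun t ht ↦ by
      have := ladderRank_le L α β γ t
      simp only [hrank, sideRank]
      split_ifs <;> lia) fun x y ↦ h.rank_mono hL hr
  refine ⟨j + 1, (u.filter fun t ↦ rank t = 0).map L, (u.filter fun t ↦ rank t = 3).map L,
    (u.filter fun t ↦ rank t = 7).map L, by have := h.letter; lia,
    by lia, ?_, ?_⟩
  -- A letter 2j + 2 has rank 2, 5 or 7, and no 2j + 4 lies between q and q'; so neither occurs in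
  -- layer 3, which is w₂.
  · intro x hx
    obtain ⟨t, ht, rfl⟩ := List.mem_map.mp hx
    simp only [List.mem_filter, decide_eq_true_eq] at ht
    constructor
    · intro h2
      have := hr.top t (by lia)
      have := h.lt
      have := h.lt_top
      have := h.top_lt
      lia
    · intro h4
      have a1 := hr.big t (by lia)
      have a2 := h.no_succ t
      lia
  have e : ∀ g : ℕ → List ℤ, (List.range 8).flatMap g =
      g 0 ++ g 1 ++ g 2 ++ g 3 ++ g 4 ++ g 5 ++ g 6 ++ g 7 := by
    intro g
    simp [List.range_succ]
  rw [e] at hsort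
  simp only [List.map_append] at hsort
  refine hsort.trans ?_
  have hrP := hr.at_P
  exact (((((((commEquiv_plain_filter u _ (by simp [hrP])).append (h.layer_one hr hu)).append
    (h.layer_two hr hu)).append (commEquiv_plain_filter u _ (by simp [hrP]))).append
    (h.layer_four hr hu)).append (h.layer_five hr hu)).append (h.layer_six hr hu)).append
    (commEquiv_plain_filter u _ (by simp [hrP]))

theorem parseIV_of_rank {u : List ℤ} (hu : Enumerates L u) (rank : ℤ → ℕ) {q q' : ℤ} {c : ℕ}
    (hc : ({L P, c} : Set ℕ) = {1, 2}) (hq : L q = c) (hq' : L q' = c) (hqP : q ≠ P) (hqP' : q' ≠ P)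
    (hc1 : 1 ≤ c) (hP : 1 ≤ L P)
    (hN : ∀ t, 1 ≤ L t → rank t < 5)
    (h1 : ∀ t, 1 ≤ L t → (rank t = 1 ↔ t = q)) (h2 : ∀ t, 1 ≤ L t → (rank t = 2 ↔ t = P))
    (h3 : ∀ t, 1 ≤ L t → (rank t = 3 ↔ t = q'))
    (hmono : ∀ x y, x < y → 1 ≤ L x → 1 ≤ L y → L x ≤ L y + 1 → L y ≤ L x + 1 → rank x ≤ rank y) :
    ParseIV (L P) (u.map (letterAt L P)) := by
  have hsort := hu.commEquiv_sort (P := P) rank 5 hN hmono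
  refine ⟨c, (u.filter fun t ↦ rank t = 0).map L, (u.filter fun t ↦ rank t = 4).map L, hc, ?_⟩
  have e : ∀ g : ℕ → List ℤ, (List.range 5).flatMap g = g 0 ++ g 1 ++ g 2 ++ g 3 ++ g 4 := by
    intro g
    simp [List.range_succ]
  rw [e] at hsort
  simp only [List.map_append] at hsort
  refine hsort.trans ?_
  have hrP := (h2 P hP).mpr rfl
  refine ((((commEquiv_plain_filter u _ (by simp [hrP])).append ?_).append ?_).append
    ?_).append (commEquiv_plain_filter u _ (by simp [hrP]))
  · have := commEquiv_letter_filter (P := P) hu (fun t ↦ decide (rank t = 1)) (x := q) (by lia)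
      fun t ht ↦ by simpa using h1 t ht
    simpa [plain, hqP, hq] using this
  · have := commEquiv_letter_filter (P := P) hu (fun t ↦ decide (rank t = 2)) (x := P) (by lia)
      fun t ht ↦ by simpa using h2 t ht
    simpa [barred] using this
  · have := commEquiv_letter_filter (P := P) hu (fun t ↦ decide (rank t = 3)) (x := q') (by lia)
      fun t ht ↦ by simpa using h3 t ht
    simpa [plain, hqP', hq'] using this

theorem BondPattern.parseIV (h : BondPattern L P) {u : List ℤ} (hu : Enumerates L u) :
    ParseIV (L P) (u.map (letterAt L P)) := by
  obtain ⟨q, q', hqP, hPq, ⟨hcons, hP, hu2⟩ | ⟨hcons, hP, hu1, hno⟩⟩ := h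
  · have hq := hcons.left
    have hq' := hcons.right
    set rank : ℤ → ℕ := fun t ↦ if L t = 1 then
        (if t < q then 0 else if t = q then 1 else if t = q' then 3 else 4)
      else if t < P then 0 else if t = P then 2 else 4 with hrank
    have hone : ∀ t, L t = 1 → t < q ∧ rank t = 0 ∨ t = q ∧ rank t = 1 ∨
        t = q' ∧ rank t = 3 ∨ q' < t ∧ rank t = 4 := by
      intro t ht
      have := hcons.between t
      have := hcons.lt
      simp only [hrank, ht, if_true]
      split_ifs <;> lia
    have hbig : ∀ t, 2 ≤ L t → t < P ∧ rank t = 0 ∨ t = P ∧ rank t = 2 ∨ P < t ∧ rank t = 4 := by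
      intro t ht
      simp only [hrank, (by lia : L t ≠ 1), if_false]
      split_ifs <;> lia
    have hcase : ∀ t, 1 ≤ L t → L t = 1 ∨ 2 ≤ L t := fun t ht ↦ by lia
    have hneq : ∀ t, 2 ≤ L t → t ≠ q ∧ t ≠ q' := fun t ht ↦
      ⟨by rintro rfl; lia, by rintro rfl; lia⟩
    refine parseIV_of_rank hu rank (q := q) (q' := q') (by rw [hP, Set.pair_comm]) hq hq' (by lia)
      (by lia) le_rfl (by lia) ?_ ?_ ?_ ?_ ?_
    · intro t _
      simp only [hrank]
      split_ifs <;> lia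
    · intro t ht
      rcases hcase t ht with h1 | h1
      · have := hone t h1; lia
      · have := hbig t h1; have := hneq t h1; lia
    · intro t ht
      rcases hcase t ht with h1 | h1
      · have := hone t h1; have : t ≠ P := (by rintro rfl; lia); lia
      · have := hbig t h1; lia
    · intro t ht
      rcases hcase t ht with h1 | h1
      · have := hone t h1; lia
      · have := hbig t h1; have := hneq t h1; lia
    · intro x y hxy hx hy h1 h2
      rcases hcase x hx with hx' | hx' <;> rcases hcase y hy with hy' | hy'
      · have := hone x hx'; have := hone y hy'; lia
      · have := hone x hx'; have := hbig y hy'; have := hu2 y; have := hneq y hy'; lia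
      · have := hbig x hx'; have := hone y hy'; have := hu2 x; have := hneq x hx'; lia
      · have := hbig x hx'; have := hbig y hy'; lia
  · have hq := hcons.left
    have hq' := hcons.right
    set rank : ℤ → ℕ := fun t ↦ if L t = 2 then
        (if t < q then 0 else if t = q then 1 else if t = q' then 3 else 4)
      else if L t = 1 then (if t < P then 0 else if t = P then 2 else 4)
      else if t < q then 0 else 4 with hrank
    have htwo : ∀ t, L t = 2 → t < q ∧ rank t = 0 ∨ t = q ∧ rank t = 1 ∨
        t = q' ∧ rank t = 3 ∨ q' < t ∧ rank t = 4 := by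
      intro t ht
      have := hcons.between t
      have := hcons.lt
      simp only [hrank, ht, if_true]
      split_ifs <;> lia
    have hone : ∀ t, L t = 1 → t < P ∧ rank t = 0 ∨ t = P ∧ rank t = 2 ∨ P < t ∧ rank t = 4 := by
      intro t ht
      simp only [hrank, ht, (by lia : 1 ≠ 2), if_false, if_true]
      split_ifs <;> lia
    have hbig : ∀ t, 3 ≤ L t → t < q ∧ rank t = 0 ∨ q < t ∧ rank t = 4 := by
      intro t ht
      have : t ≠ q := by rintro rfl; lia
      simp only [hrank, (by lia : L t ≠ 2), (by lia : L t ≠ 1), if_false]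
      split_ifs <;> lia
    have hcase : ∀ t, 1 ≤ L t → L t = 1 ∨ L t = 2 ∨ 3 ≤ L t := fun t ht ↦ by lia
    have hneq : ∀ t, L t ≠ 2 → t ≠ q ∧ t ≠ q' := fun t ht ↦
      ⟨by rintro rfl; lia, by rintro rfl; lia⟩
    have hneP : ∀ t, L t ≠ 1 → t ≠ P := fun t ht ↦ by rintro rfl; lia
    refine parseIV_of_rank hu rank (q := q) (q' := q') (by rw [hP]) hq hq' (by lia)
      (by lia) (by lia) (by lia) ?_ ?_ ?_ ?_ ?_
    · intro t _
      simp only [hrank]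
      split_ifs <;> lia
    · intro t ht
      rcases hcase t ht with h1 | h1 | h1
      · have := hone t h1; have := hneq t (by lia); lia
      · have := htwo t h1; lia
      · have := hbig t h1; have := hneq t (by lia); lia
    · intro t ht
      rcases hcase t ht with h1 | h1 | h1
      · have := hone t h1; lia
      · have := htwo t h1; have := hneP t (by lia); lia
      · have := hbig t h1; have := hneP t (by lia); lia
    · intro t ht
      rcases hcase t ht with h1 | h1 | h1
      · have := hone t h1; have := hneq t (by lia); lia
      · have := htwo t h1; lia
      · have := hbig t h1; have := hneq t (by lia); lia
    · intro x y hxy hx hy h1 h2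
      rcases hcase x hx with hx' | hx' | hx' <;> rcases hcase y hy with hy' | hy' | hy'
      · have := hone x hx'; have := hone y hy'; lia
      · have := hone x hx'; have := htwo y hy'; have := hu1 x; have := hneq x (by lia); lia
      · lia
      · have := htwo x hx'; have := hone y hy'; have := hu1 y; have := hneq y (by lia); lia
      · have := htwo x hx'; have := htwo y hy'; lia
      · have := htwo x hx'; have := hbig y hy'; have := hno y; have := hneq y (by lia); lia
      · lia
      · have := hbig x hx'; have := htwo y hy'; have := hno x; have := hneq x (by lia); lia
      · have := hbig x hx'; have := hbig y hy'; lia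

theorem commEquiv_reverse_plain (k c : ℕ) :
    CommEquiv (plain ((List.range k).map fun i ↦ 2 * i + c)).reverse
      (plain ((List.range k).map fun i ↦ 2 * i + c)) := by
  refine commEquiv_of_perm (List.reverse_perm _) ?_
  rw [List.pairwise_reverse]
  simp only [plain, List.map_map, List.pairwise_map]
  refine List.pairwise_lt_range.imp fun {a b} hab ↦ ?_
  simp [LetterDistant]
  lia

/-- Forms (ii) and (iii) are mirror images: the reversed blocks of odd or even letters consist of
commuting letters and can be put back in order. -/
theorem ParseIII.reverse {p : ℕ} {ω : List Letter} (h : ParseIII p ω) : ParseII p ω.reverse := by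
  obtain ⟨k, w₁, w₂, w₃, hp, hk, hcomm, h⟩ := h
  refine ⟨k, w₃.reverse, w₂.reverse, w₁.reverse, hp, hk, fun x hx ↦ hcomm x (by simpa using hx),
    h.reverse.trans ?_⟩
  have hrev : ∀ w : List ℕ, (plain w).reverse = plain w.reverse := fun w ↦ by simp [plain]
  have e1 := commEquiv_reverse_plain k 1
  have e2 := commEquiv_reverse_plain k 2
  have e3 := commEquiv_reverse_plain (k + 1) 1
  change CommEquiv (plain (odds k)).reverse (plain (odds k)) at e1
  change CommEquiv (plain (evens k)).reverse (plain (evens k)) at e2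
  change CommEquiv (plain (odds (k + 1))).reverse (plain (odds (k + 1))) at e3
  have key := ((((CommEquiv.refl (plain w₃.reverse)).append e3).append e2).append e1).append
    (CommEquiv.refl (plain w₂.reverse ++ [barred (2 * k)] ++ plain [2 * k + 1] ++ plain w₁.reverse))
  simp only [List.reverse_append, hrev, List.reverse_singleton, List.append_assoc] at key ⊢
  exact key

theorem Enumerates.flip {u : List ℤ} (hu : Enumerates L u) :
    Enumerates (flip L) (u.map (- ·)).reverse where
  sorted := by
    rw [List.pairwise_reverse, List.pairwise_map]
    exact hu.sorted.imp fun h ↦ by lia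
  mem_iff t := by
    simp only [List.mem_reverse, List.mem_map, TypeH.flip, ← hu.mem_iff]
    constructor
    · rintro ⟨s, hs, rfl⟩
      simpa using hs
    · intro ht
      exact ⟨-t, ht, by simp⟩

theorem SidePattern.parseII (hL : Spaced L) {j : ℕ} {α β γ : ℕ → ℤ} {q q' : ℤ}
    (h : SidePattern (flip L) (-P) j α β γ q q') {u : List ℤ} (hu : Enumerates L u) :
    ParseII (L P) (u.map (letterAt L P)) := by
  have := (h.parseIII hL.flip hu.flip).reverse
  rw [List.map_reverse, List.reverse_reverse, List.map_map] at this
  have e : letterAt (flip L) (-P) ∘ (fun t ↦ -t) = letterAt L P := by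
    ext t
    · simp [letterAt, flip]
    · simp [letterAt]
  rw [e] at this
  simpa [flip] using this

end TypeH

end

/-! ### From loops of matchings to closed strands -/

noncomputable section

namespace TypeH

variable {m : ℕ} {L : ℤ → ℕ}

/-- The two sides of the letters before position `n` that are passed by a strand with both ends
at position `n`, in the columns `X` and `Y`. -/
structure HalfClosed (L : ℤ → ℕ) (n : ℤ) (X Y : ℕ) (Cap Cup : Set ℤ) : Prop where
  one_le_cap : ∀ t ∈ Cap, 1 ≤ L t
  one_le_cup : ∀ t ∈ Cup, 1 ≤ L t
  cup_lt : ∀ t ∈ Cup, t < n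
  cap : ∀ t ∈ Cap, PrevIn L Cup t (L t) ∧ PrevIn L Cup t (L t + 1)
  cup : ∀ t ∈ Cup, ∀ z, z = L t ∨ z = L t + 1 → NextIn L Cap t z ∨
    (z = X ∨ z = Y) ∧ ∀ r, t < r → r < n → ¬ Touches L r z
  left : PrevIn L Cup n X
  right : PrevIn L Cup n Y

theorem PrevIn.mono {U V : Set ℤ} (hUV : U ⊆ V) {t : ℤ} {x : ℕ} (h : PrevIn L U t x) :
    PrevIn L V t x := by
  obtain ⟨s, h1, h2⟩ := h
  exact ⟨s, hUV h1, h2⟩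

theorem NextIn.mono {U V : Set ℤ} (hUV : U ⊆ V) {t : ℤ} {x : ℕ} (h : NextIn L U t x) :
    NextIn L V t x := by
  obtain ⟨s, h1, h2⟩ := h
  exact ⟨s, hUV h1, h2⟩

theorem PrevIn.step {U : Set ℤ} {n : ℤ} {x : ℕ} (h : PrevIn L U n x) (hn : ¬ Touches L n x) :
    PrevIn L U (n + 1) x := by
  obtain ⟨s, h1, h2, h3, h4⟩ := h
  refine ⟨s, h1, by lia, h3, fun r r1 r2 ↦ ?_⟩
  by_cases hr : r = n
  · rwa [hr]
  · exact h4 r r1 (by lia)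

namespace HalfClosed

variable {n : ℤ} {X Y : ℕ} {Cap Cup Cap' Cup' : Set ℤ}

theorem symm (h : HalfClosed L n X Y Cap Cup) : HalfClosed L n Y X Cap Cup where
  one_le_cap := h.one_le_cap
  one_le_cup := h.one_le_cup
  cup_lt := h.cup_lt
  cap := h.cap
  cup t ht z hz := (h.cup t ht z hz).imp_right fun h ↦ ⟨h.1.symm, h.2⟩
  left := h.right
  right := h.left

/-- The letter at n can miss a strand (`step`), open a new one (`create`), connect two (`join`) or
complete one to a loop (`close`). -/
theorem step (h : HalfClosed L n X Y Cap Cup) (hX : ¬ Touches L n X) (hY : ¬ Touches L n Y) :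
    HalfClosed L (n + 1) X Y Cap Cup where
  one_le_cap := h.one_le_cap
  one_le_cup := h.one_le_cup
  cup_lt t ht := by have := h.cup_lt t ht; lia
  cap := h.cap
  cup t ht z hz := by
    refine (h.cup t ht z hz).imp_right fun h ↦ ⟨h.1, fun r r1 r2 ↦ ?_⟩
    by_cases hr : r = n
    · subst hr
      rcases h.1 with rfl | rfl
      · exact hX
      · exact hY
    · exact h.2 r r1 (by lia)
  left := h.left.step hX
  right := h.right.step hY

theorem create (hn : 1 ≤ L n) : HalfClosed L (n + 1) (L n) (L n + 1) ∅ {n} where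
  one_le_cap t ht := ht.elim
  one_le_cup t ht := by rw [Set.mem_singleton_iff.mp ht]; exact hn
  cup_lt t ht := by rw [Set.mem_singleton_iff.mp ht]; lia
  cap t ht := ht.elim
  cup t ht z hz := by
    rw [Set.mem_singleton_iff.mp ht] at hz ⊢
    exact .inr ⟨hz, fun r r1 r2 ↦ by lia⟩
  left := ⟨n, rfl, by lia, ⟨hn, .inl rfl⟩, fun r r1 r2 ↦ by lia⟩
  right := ⟨n, rfl, by lia, ⟨hn, .inr rfl⟩, fun r r1 r2 ↦ by lia⟩

theorem join (h : HalfClosed L n X (L n) Cap Cup) (h' : HalfClosed L n (L n + 1) Y Cap' Cup')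
    (hn : 1 ≤ L n) (hX : ¬ Touches L n X) (hY : ¬ Touches L n Y) :
    HalfClosed L (n + 1) X Y (insert n (Cap ∪ Cap')) (Cup ∪ Cup') where
  one_le_cap t ht := by
    rcases ht with rfl | ht | ht
    · exact hn
    · exact h.one_le_cap t ht
    · exact h'.one_le_cap t ht
  one_le_cup t ht := by
    rcases ht with ht | ht
    · exact h.one_le_cup t ht
    · exact h'.one_le_cup t ht
  cup_lt t ht := by
    rcases ht with ht | ht
    · have := h.cup_lt t ht; lia
    · have := h'.cup_lt t ht; lia
  cap t ht := by
    rcases ht with rfl | ht | ht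
    · exact ⟨h.right.mono Set.subset_union_left, h'.left.mono Set.subset_union_right⟩
    · exact ⟨(h.cap t ht).1.mono Set.subset_union_left, (h.cap t ht).2.mono Set.subset_union_left⟩
    · exact ⟨(h'.cap t ht).1.mono Set.subset_union_right,
        (h'.cap t ht).2.mono Set.subset_union_right⟩
  cup t ht z hz := by
    rcases ht with ht | ht
    · rcases h.cup t ht z hz with h1 | ⟨rfl | rfl, h2⟩
      · exact .inl (h1.mono fun s hs ↦ .inr (.inl hs))
      · refine .inr ⟨.inl rfl, fun r r1 r2 ↦ ?_⟩
        by_cases hr : r = n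
        · rwa [hr]
        · exact h2 r r1 (by lia)
      · exact .inl ⟨n, Set.mem_insert _ _, h.cup_lt t ht, ⟨hn, .inl rfl⟩, h2⟩
    · rcases h'.cup t ht z hz with h1 | ⟨rfl | rfl, h2⟩
      · exact .inl (h1.mono fun s hs ↦ .inr (.inr hs))
      · exact .inl ⟨n, Set.mem_insert _ _, h'.cup_lt t ht, ⟨hn, .inr rfl⟩, h2⟩
      · refine .inr ⟨.inr rfl, fun r r1 r2 ↦ ?_⟩
        by_cases hr : r = n
        · rwa [hr]
        · exact h2 r r1 (by lia)
  left := (h.left.mono Set.subset_union_left).step hX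
  right := (h'.right.mono Set.subset_union_right).step hY

theorem close (h : HalfClosed L n (L n) (L n + 1) Cap Cup) (hn : 1 ≤ L n) :
    Closed L (insert n Cap) Cup where
  one_le_cap t ht := by
    rcases ht with rfl | ht
    · exact hn
    · exact h.one_le_cap t ht
  one_le_cup := h.one_le_cup
  cap t ht := by
    rcases ht with rfl | ht
    · exact ⟨h.left, h.right⟩
    · exact h.cap t ht
  cup t ht := by
    have key : ∀ z, z = L t ∨ z = L t + 1 → NextIn L (insert n Cap) t z := by
      intro z hz
      rcases h.cup t ht z hz with h1 | ⟨rfl | rfl, h2⟩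
      · exact h1.mono (Set.subset_insert _ _)
      · exact ⟨n, Set.mem_insert _ _, h.cup_lt t ht, ⟨hn, .inl rfl⟩, h2⟩
      · exact ⟨n, Set.mem_insert _ _, h.cup_lt t ht, ⟨hn, .inr rfl⟩, h2⟩
    exact ⟨key _ (.inl rfl), key _ (.inr rfl)⟩

end HalfClosed

/-- Every strand of the matching with both ends at the top comes from a half-closed strand. -/
def Traced (L : ℤ → ℕ) (n : ℤ) (S : Matching (Pt m)) : Prop :=
  ∀ x y : Fin (m + 1), S.mate (x, true) = (y, true) →
    ∃ Cap Cup, HalfClosed L n ((x : ℕ) + 1) ((y : ℕ) + 1) Cap Cup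

theorem traced_initial (L : ℤ → ℕ) (n : ℤ) : Traced L n (initial m) := by
  intro x y h
  simp [initial] at h

theorem Traced.blank {n : ℤ} {S : Matching (Pt m)} (h : Traced L n S) (hn : L n = 0) :
    Traced L (n + 1) S := by
  intro x y hxy
  obtain ⟨Cap, Cup, hc⟩ := h x y hxy
  exact ⟨Cap, Cup, hc.step (by simp [Touches, hn]) (by simp [Touches, hn])⟩

/-- An arc with both ends at the top is the new arc of the letter, an old arc that it misses, or the
union of two old arcs, each with both ends at the top. -/
theorem Traced.act {n : ℤ} {S : Matching (Pt m)} (h : Traced L n S) {i : Fin m}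
    (hn : L n = (i : ℕ) + 1) : Traced L (n + 1) (act i S) := by
  have i1 := S.mate_mate
  have hpos : 1 ≤ L n := by lia
  intro x y hxy
  have create := HalfClosed.create hpos
  by_cases hxa : x = i.castSucc
  · subst hxa
    have hy : y = i.succ := by
      simpa [TypeH.act, Matching.cut, eq_comm] using hxy
    subst hy
    exact ⟨_, _, by simpa [hn] using create⟩
  by_cases hxc : x = i.succ
  · subst hxc
    have hy : y = i.castSucc := by
      have : ((i.succ, true) : Pt m) ≠ leftLeg i := (leftLeg_ne_rightLeg i).symm
      simp only [TypeH.act, Matching.cut, this, if_false, if_true] at hxy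
      simpa [eq_comm] using hxy
    subst hy
    exact ⟨_, _, by simpa [hn] using create.symm⟩
  have hxa' : ((x, true) : Pt m) ≠ leftLeg i := by simpa using hxa
  have hxc' : ((x, true) : Pt m) ≠ rightLeg i := by simpa using hxc
  have hyleg : y ≠ i.castSucc ∧ y ≠ i.succ := by
    have k1 := (TypeH.act i S).mate_mate (x, true)
    rw [hxy] at k1
    constructor
    · rintro rfl
      rw [mate_act_leftLeg] at k1
      exact hxc' k1.symm
    · rintro rfl
      have k2 : (i.succ, true) = (TypeH.act i S).mate (leftLeg i) := (mate_act_leftLeg S i).symm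
      rw [k2, Matching.mate_mate] at k1
      exact hxa' k1.symm
  have touch : ∀ z : Fin (m + 1), z ≠ i.castSucc → z ≠ i.succ → ¬ Touches L n ((z : ℕ) + 1) := by
    intro z hz1 hz2
    simp only [Fin.ext_iff, Fin.val_castSucc, Fin.val_succ, ne_eq] at hz1 hz2
    simp only [Touches, hn]
    lia
  have tx := touch x hxa hxc
  have ty := touch y hyleg.1 hyleg.2
  simp only [TypeH.act, Matching.cut, hxa', hxc', if_false] at hxy
  have e1 : ((i.castSucc : Fin (m + 1)) : ℕ) + 1 = L n := by simp [hn]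
  have e2 : ((i.succ : Fin (m + 1)) : ℕ) + 1 = L n + 1 := by simp [hn]
  split_ifs at hxy with g1 g2
  · have k1 : S.mate (x, true) = (i.castSucc, true) := by rw [g1, i1]
    obtain ⟨C1, U1, h1⟩ := h _ _ k1
    obtain ⟨C2, U2, h2⟩ := h _ _ hxy
    rw [e1] at h1
    rw [e2] at h2
    exact ⟨_, _, h1.join h2 hpos tx ty⟩
  · have k1 : S.mate (x, true) = (i.succ, true) := by rw [g2, i1]
    obtain ⟨C1, U1, h1⟩ := h _ _ k1
    obtain ⟨C2, U2, h2⟩ := h _ _ hxy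
    rw [e2] at h1
    rw [e1] at h2
    exact ⟨_, _, (h2.symm.join h1.symm hpos ty tx).symm⟩
  · obtain ⟨C, U, h1⟩ := h _ _ hxy
    exact ⟨_, _, h1.step tx ty⟩

/-- The word `ω` stands in `L` from position `n` on. -/
def Reads (L : ℤ → ℕ) : ℤ → List (Fin m) → Prop
  | _, [] => True
  | n, i :: ω => L n = (i : ℕ) + 1 ∧ Reads L (n + 1) ω

theorem Traced.run {n : ℤ} {S : Matching (Pt m)} (h : Traced L n S) {ω : List (Fin m)}
    (hω : Reads L n ω) : Traced L (n + ω.length) (run ω S) := by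
  induction ω generalizing n S with
  | nil => simpa [TypeH.run] using h
  | cons i ω ih =>
    have := ih (h.act hω.1) hω.2
    rw [List.length_cons, TypeH.run]
    convert this using 1
    push_cast
    ring

theorem Traced.exists_closed {n : ℤ} {S : Matching (Pt m)} (h : Traced L n S) {ω : List (Fin m)}
    (hω : Reads L n ω) (hl : loops ω S ≠ 0) :
    ∃ Cap Cup, Closed L Cap Cup ∧ ∃ t, t ∈ Cap ∨ t ∈ Cup := by
  induction ω generalizing n S with
  | nil => exact absurd rfl hl
  | cons i ω ih =>
    by_cases hc : S.mate (leftLeg i) = rightLeg i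
    · obtain ⟨Cap, Cup, hh⟩ := h _ _ hc
      have e1 : ((i.castSucc : Fin (m + 1)) : ℕ) + 1 = L n := by simp [hω.1]
      have e2 : ((i.succ : Fin (m + 1)) : ℕ) + 1 = L n + 1 := by simp [hω.1]
      rw [e1, e2] at hh
      exact ⟨_, _, hh.close (by rw [hω.1]; lia), n, .inl (Set.mem_insert _ _)⟩
    · refine ih (h.act hω.1) hω.2 ?_
      simpa [loops, hc] using hl

end TypeH

end

/-! ### Fully commutative words are spaced -/

noncomputable section

namespace TypeH

variable {m : ℕ}

theorem wordEquiv_cons_append {x : Fin m} {α : List (Fin m)} (h : ∀ y ∈ α, Distant x y)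
    (β : List (Fin m)) : WordEquiv (x :: α ++ β) (α ++ x :: β) := by
  induction α with
  | nil => exact .refl
  | cons y α ih =>
    have h1 : WordEquiv (x :: y :: (α ++ β)) (y :: x :: (α ++ β)) :=
      .single (WordStep.swap [] (α ++ β) x y (h y (by simp)))
    have h2 := (ih fun z hz ↦ h z (by simp [hz])).append [y] []
    simp only [List.append_nil] at h2
    exact h1.trans h2

theorem WordEquiv.symm {α β : List (Fin m)} (h : WordEquiv α β) : WordEquiv β α := by
  induction h with
  | refl => exact .refl
  | tail _ hs ih =>
    obtain ⟨u, v, i, j, hd⟩ := hs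
    exact Relation.ReflTransGen.head (WordStep.swap u v j i hd.symm) ih

theorem not_hasSquare_of_isReduced {ω : List (Fin m)} (h : (cs m).IsReduced ω) :
    ¬ HasSquare ω := by
  rintro ⟨u, v, i, hω⟩
  have h1 := hω.isReduced h
  have h2 := CoxeterSystem.isReduced_of_append_left h1
  have h3 := CoxeterSystem.isReduced_of_append_right h2
  have h4 := h3.eq
  rw [CoxeterSystem.wordProd_cons, CoxeterSystem.wordProd_singleton,
    CoxeterSystem.simple_mul_simple_self, CoxeterSystem.length_one] at h4
  simp at h4

theorem not_hasBraid_of_mem_Wc {ω : List (Fin m)} (h : (cs m).IsReduced ω)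
    (hω : (cs m).wordProd ω ∈ Wc m) : ¬ HasBraid ω := by
  rintro ⟨u, v, i, j, hM, he⟩
  have h1 := he.isReduced h
  have h2 := CoxeterSystem.isReduced_of_append_left h1
  have h3 := CoxeterSystem.isReduced_of_append_right h1
  have h4 := CoxeterSystem.isReduced_of_append_left h2
  have h5 := CoxeterSystem.isReduced_of_append_right h2
  refine hω ⟨(cs m).wordProd u, (cs m).wordProd v, i, j, hM, ?_, ?_⟩
  · rw [he.wordProd_eq, CoxeterSystem.wordProd_append, CoxeterSystem.wordProd_append]
  · rw [he.wordProd_eq, h1.eq, h4.eq, h5.eq, h3.eq]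
    simp only [List.length_append]

/-- The word `ω`, placed from position `n` on. -/
def wordFrom : ℤ → List (Fin m) → ℤ → ℕ
  | _, [], _ => 0
  | n, i :: ω, t => if t = n then (i : ℕ) + 1 else wordFrom (n + 1) ω t

theorem wordFrom_of_lt {n t : ℤ} (ω : List (Fin m)) (h : t < n) : wordFrom n ω t = 0 := by
  induction ω generalizing n with
  | nil => rfl
  | cons i ω ih => simp [wordFrom, h.ne, ih (by lia : t < n + 1)]

theorem wordFrom_le (n t : ℤ) (ω : List (Fin m)) : wordFrom n ω t ≤ m := by
  induction ω generalizing n with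
  | nil => simp [wordFrom]
  | cons i ω ih =>
    simp only [wordFrom]
    split_ifs
    · exact i.2
    · exact ih _

theorem exists_split {n t : ℤ} {ω : List (Fin m)} (h : 1 ≤ wordFrom n ω t) :
    ∃ (u : List (Fin m)) (i : Fin m) (v : List (Fin m)), ω = u ++ i :: v ∧ wordFrom n ω t = (i : ℕ) + 1 ∧
      (∀ x ∈ u, ∃ s, n ≤ s ∧ s < t ∧ wordFrom n ω s = (x : ℕ) + 1) ∧
      ∀ s, t < s → wordFrom n ω s = wordFrom (t + 1) v s := by
  induction ω generalizing n with
  | nil => simp [wordFrom] at h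
  | cons i ω ih =>
    by_cases ht : t = n
    · subst ht
      exact ⟨[], i, ω, rfl, by simp [wordFrom], by simp, fun s hs ↦ by simp [wordFrom, hs.ne']⟩
    · have h' : 1 ≤ wordFrom (n + 1) ω t := by simpa [wordFrom, ht] using h
      have hn : n + 1 ≤ t := by
        by_contra hlt
        rw [wordFrom_of_lt ω (by lia)] at h'
        lia
      obtain ⟨u, k, v, rfl, h1, h2, h3⟩ := ih h'
      refine ⟨i :: u, k, v, rfl, by simpa [wordFrom, ht] using h1, fun x hx ↦ ?_, fun s hs ↦ ?_⟩
      · rcases List.mem_cons.mp hx with rfl | hx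
        · exact ⟨n, le_rfl, by lia, by simp [wordFrom]⟩
        · obtain ⟨s, s1, s2, s3⟩ := h2 x hx
          exact ⟨s, by lia, s2, by simpa [wordFrom, (by lia : s ≠ n)] using s3⟩
      · rw [← h3 s hs]
        simp [wordFrom, (by lia : s ≠ n)]

theorem distant_iff {i j : Fin m} : Distant i j ↔ (i : ℕ) + 1 < j ∨ (j : ℕ) + 1 < i := Iff.rfl

/-- A reduced word of a fully commutative element is spaced. -/
theorem spaced_wordFrom {ω : List (Fin m)} (h : (cs m).IsReduced ω)
    (hω : (cs m).wordProd ω ∈ Wc m) : Spaced (wordFrom 0 ω) where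
  exists_adjacent {c q q'} hc hcons := by
    by_contra! hcon
    have hlt := hcons.lt
    obtain ⟨u, j, v, hsplit, hj, -, hv⟩ := exists_split (n := 0) (t := q) (ω := ω)
      (by rw [hcons.left]; exact hc)
    rw [hcons.left] at hj
    have hq' := hcons.right
    by_cases hadj : ∃ s, q < s ∧ s < q' ∧ 1 ≤ wordFrom 0 ω s ∧
        (wordFrom 0 ω s = c + 1 ∨ wordFrom 0 ω s + 1 = c)
    -- With a single neighbour k between two letters j, everything else between them commutes with
    -- j, so j k j can be collected; the bond has strength 3 because it is not {1, 2}.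
    · obtain ⟨s, s1, s2, s3, s4⟩ := hadj
      obtain ⟨k1, k2⟩ := hcon s s1 s2 s3 s4
      rw [hv s s1] at s3
      obtain ⟨x, k, v', rfl, hk, hx, hv'⟩ := exists_split s3
      rw [hv q' hlt] at hq'
      rw [hv' q' s2] at hq'
      obtain ⟨y, j', w, rfl, hj', hy, -⟩ := exists_split (by rw [hq']; exact hc)
      rw [hq'] at hj'
      obtain rfl : j = j' := Fin.ext (by lia)
      rw [← hv s s1] at hk
      have dx : ∀ z ∈ x, Distant j z := by
        intro z hz
        obtain ⟨r, r1, r2, r3⟩ := hx z hz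
        rw [← hv r (by lia)] at r3
        have a1 := hcons.between r (by lia) (by lia)
        have a2 := k2 r (by lia) (by lia) (by lia) (by lia)
        rw [distant_iff]
        lia
      have dy : ∀ z ∈ y, Distant j z := by
        intro z hz
        obtain ⟨r, r1, r2, r3⟩ := hy z hz
        rw [← hv' r (by lia), ← hv r (by lia)] at r3
        have a1 := hcons.between r (by lia) (by lia)
        have a2 := k2 r (by lia) (by lia) (by lia) (by lia)
        rw [distant_iff]
        lia
      have hM : coxeterMatrix m k j = 3 := by
        rw [coxeterMatrix_apply]
        have := Fin.ext_iff (a := k) (b := j)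
        grind
      refine not_hasBraid_of_mem_Wc h hω ⟨u ++ x, y ++ w, k, j, by rw [hM], ?_⟩
      have e1 := (wordEquiv_cons_append dx (k :: (y ++ j :: w))).append u []
      have e2 := (wordEquiv_cons_append dy w).symm.append (u ++ x ++ [j, k]) []
      simp only [CoxeterSystem.braidWord, hM, CoxeterSystem.alternatingWord,
        List.concat_eq_append, List.nil_append, List.append_assoc, List.cons_append,
        List.append_nil] at e1 e2 ⊢
      rw [hsplit]
      exact Relation.ReflTransGen.trans e1 e2
    -- Without a neighbour in between, the two letters j can be moved together to a square.
    · rw [hv q' hlt] at hq'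
      obtain ⟨y, j', w, rfl, hj', hy, -⟩ := exists_split (by rw [hq']; exact hc)
      rw [hq'] at hj'
      obtain rfl : j = j' := Fin.ext (by lia)
      have dy : ∀ z ∈ y, Distant j z := by
        intro z hz
        obtain ⟨r, r1, r2, r3⟩ := hy z hz
        rw [← hv r (by lia)] at r3
        have a1 := hcons.between r (by lia) (by lia)
        have a2 : ¬ _ := fun hh ↦ hadj ⟨r, by lia, by lia, by lia, hh⟩
        rw [distant_iff]
        lia
      refine not_hasSquare_of_isReduced h ⟨u ++ y, w, j, ?_⟩
      have e1 := (wordEquiv_cons_append dy (j :: w)).append u []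
      rw [hsplit]
      simpa using e1
  no_alternating {a q o q' e} h1 h2 hq hq' l1 l2 l3 l4 hu h3 := by
    obtain ⟨u, i1, v1, hsplit, hi1, -, hv1⟩ := exists_split (n := 0) (t := a) (ω := ω)
      (by rw [h1.left])
    have ho := h1.right
    have he := h2.right
    have hb1 := h1.between
    have hb2 := h2.between
    rw [h1.left] at hi1
    have t1 := hv1 q l1
    obtain ⟨x1, j1, v2, rfl, hj1, hx1, hv2⟩ := exists_split (by rw [← t1, hq]; lia)
    have t2 := hv2 o l2
    rw [← hv1 o (by lia)] at t2
    obtain ⟨x2, i2, v3, rfl, hi2, hx2, hv3⟩ := exists_split (by rw [← t2, ho])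
    have t3 := hv3 q' l3
    rw [← hv2 q' (by lia), ← hv1 q' (by lia)] at t3
    obtain ⟨x3, j2, v4, rfl, hj2, hx3, hv4⟩ := exists_split (by rw [← t3, hq']; lia)
    have t4 := hv4 e l4
    rw [← hv3 e (by lia), ← hv2 e (by lia), ← hv1 e (by lia)] at t4
    obtain ⟨x4, i3, v5, rfl, hi3, hx4, -⟩ := exists_split (by rw [← t4, he])
    rw [← t1, hq] at hj1
    rw [← t2, ho] at hi2
    rw [← t3, hq'] at hj2
    rw [← t4, he] at hi3
    obtain rfl : i1 = i2 := Fin.ext (by lia)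
    obtain rfl : i1 = i3 := Fin.ext (by lia)
    obtain rfl : j1 = j2 := Fin.ext (by lia)
    have d1 : ∀ z ∈ x1, Distant i1 z := by
      intro z hz
      obtain ⟨r, r1, r2, r3⟩ := hx1 z hz
      rw [← hv1 r (by lia)] at r3
      have := hb1 r
      have := hu r
      rw [distant_iff]
      lia
    have d2 : ∀ z ∈ x2, Distant i1 z ∧ Distant j1 z := by
      intro z hz
      obtain ⟨r, r1, r2, r3⟩ := hx2 z hz
      rw [← hv2 r (by lia), ← hv1 r (by lia)] at r3
      have := hb1 r
      have := hu r
      have := h3 r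
      rw [distant_iff, distant_iff]
      lia
    have d3 : ∀ z ∈ x3, Distant i1 z ∧ Distant j1 z := by
      intro z hz
      obtain ⟨r, r1, r2, r3⟩ := hx3 z hz
      rw [← hv3 r (by lia), ← hv2 r (by lia), ← hv1 r (by lia)] at r3
      have := hb2 r
      have := hu r
      have := h3 r
      rw [distant_iff, distant_iff]
      lia
    have d4 : ∀ z ∈ x4, Distant i1 z := by
      intro z hz
      obtain ⟨r, r1, r2, r3⟩ := hx4 z hz
      rw [← hv4 r (by lia), ← hv3 r (by lia), ← hv2 r (by lia), ← hv1 r (by lia)] at r3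
      have := hb2 r
      have := hu r
      rw [distant_iff]
      lia
    have hM : coxeterMatrix m j1 i1 = 5 := by
      rw [coxeterMatrix_apply]
      have := Fin.ext_iff (a := j1) (b := i1)
      grind
    refine not_hasBraid_of_mem_Wc h hω ⟨u ++ x1 ++ x2 ++ x3, x4 ++ v5, j1, i1, by lia, ?_⟩
    -- The leading letters 1 and 2 are moved one at a time to the right over x₁, x₂ and x₃, and the
    -- last 1 is moved left over x₄; this collects 1 2 1 2 1.
    have e1 := (wordEquiv_cons_append d1
      (j1 :: (x2 ++ i1 :: (x3 ++ j1 :: (x4 ++ i1 :: v5))))).append u []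
    have e2 := (wordEquiv_cons_append (fun z hz ↦ (d2 z hz).2)
      (i1 :: (x3 ++ j1 :: (x4 ++ i1 :: v5)))).append (u ++ x1 ++ [i1]) []
    have e3 := (wordEquiv_cons_append (fun z hz ↦ (d2 z hz).1)
      (j1 :: i1 :: (x3 ++ j1 :: (x4 ++ i1 :: v5)))).append (u ++ x1) []
    have e4 := (wordEquiv_cons_append (fun z hz ↦ (d3 z hz).1)
      (j1 :: (x4 ++ i1 :: v5))).append (u ++ x1 ++ x2 ++ [i1, j1]) []
    have e5 := (wordEquiv_cons_append (fun z hz ↦ (d3 z hz).2)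
      (i1 :: j1 :: (x4 ++ i1 :: v5))).append (u ++ x1 ++ x2 ++ [i1]) []
    have e6 := (wordEquiv_cons_append (fun z hz ↦ (d3 z hz).1)
      (j1 :: i1 :: j1 :: (x4 ++ i1 :: v5))).append (u ++ x1 ++ x2) []
    have e7 := (wordEquiv_cons_append d4 v5).symm.append
      (u ++ x1 ++ x2 ++ x3 ++ [i1, j1, i1, j1]) []
    simp only [CoxeterSystem.braidWord, hM, CoxeterSystem.alternatingWord,
      List.concat_eq_append, List.nil_append, List.append_assoc, List.cons_append,
      List.append_nil] at e1 e2 e3 e4 e5 e6 e7 ⊢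
    rw [hsplit]
    exact (((((e1.trans e2).trans e3).trans e4).trans e5).trans e6).trans e7

end TypeH

end

/-! ### Loops force the four forms, and the four forms produce δ -/

noncomputable section

namespace TypeH

variable {m : ℕ}

theorem Reads.congr {L L' : ℤ → ℕ} {n : ℤ} {ω : List (Fin m)} (h : Reads L n ω)
    (hL : ∀ t, n ≤ t → t < n + ω.length → L t = L' t) : Reads L' n ω := by
  induction ω generalizing n with
  | nil => trivial
  | cons i ω ih =>
    rw [List.length_cons] at hL
    push_cast at hL
    exact ⟨(hL n le_rfl (by lia)).symm.trans h.1, ih h.2 fun t h1 h2 ↦ hL t (by lia) (by lia)⟩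

theorem reads_append {L : ℤ → ℕ} {n : ℤ} {u v : List (Fin m)} :
    Reads L n (u ++ v) ↔ Reads L n u ∧ Reads L (n + u.length) v := by
  induction u generalizing n with
  | nil => simp [Reads]
  | cons i u ih =>
    have e : n + ((i :: u).length : ℤ) = n + 1 + u.length := by
      rw [List.length_cons]; push_cast; ring
    rw [List.cons_append, Reads, Reads, ih, e, and_assoc]

theorem reads_wordFrom (n : ℤ) (ω : List (Fin m)) : Reads (wordFrom n ω) n ω := by
  induction ω generalizing n with
  | nil => trivial
  | cons i ω ih =>
    refine ⟨by simp [wordFrom], (ih (n + 1)).congr fun t h1 _ ↦ ?_⟩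
    simp [wordFrom, (by lia : t ≠ n)]

/-- The positions of the letters of a word that starts at `n`. -/
def positions : ℤ → List (Fin m) → List ℤ
  | _, [] => []
  | n, _ :: ω => n :: positions (n + 1) ω

theorem mem_positions {n t : ℤ} {ω : List (Fin m)} :
    t ∈ positions n ω ↔ n ≤ t ∧ t < n + ω.length := by
  induction ω generalizing n with
  | nil => simp [positions]
  | cons i ω ih =>
    rw [positions, List.mem_cons, ih, List.length_cons]
    push_cast
    lia

theorem pairwise_positions (n : ℤ) (ω : List (Fin m)) : (positions n ω).Pairwise (· < ·) := by
  induction ω generalizing n with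
  | nil => exact .nil
  | cons i ω ih =>
    refine List.pairwise_cons.mpr ⟨fun t ht ↦ ?_, ih _⟩
    have := (mem_positions.mp ht).1
    lia

theorem one_le_wordFrom {n t : ℤ} {ω : List (Fin m)} :
    1 ≤ wordFrom n ω t ↔ n ≤ t ∧ t < n + ω.length := by
  induction ω generalizing n with
  | nil => simp [wordFrom]
  | cons i ω ih =>
    rw [wordFrom, List.length_cons]
    push_cast
    split_ifs with h
    · lia
    · rw [ih]
      lia

theorem enumerates_positions (ω : List (Fin m)) : Enumerates (wordFrom 0 ω) (positions 0 ω) where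
  sorted := pairwise_positions 0 ω
  mem_iff t := by rw [mem_positions, one_le_wordFrom]

theorem positions_append (n : ℤ) (u v : List (Fin m)) :
    positions n (u ++ v) = positions n u ++ positions (n + u.length) v := by
  induction u generalizing n with
  | nil => simp [positions]
  | cons i u ih =>
    have e : n + ((i :: u).length : ℤ) = n + 1 + u.length := by
      rw [List.length_cons]; push_cast; ring
    rw [List.cons_append, positions, positions, ih, e, List.cons_append]

theorem map_positions {L : ℤ → ℕ} {n : ℤ} {ω : List (Fin m)} (h : Reads L n ω) :
    (positions n ω).map L = indices ω := by
  induction ω generalizing n with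
  | nil => rfl
  | cons i ω ih =>
    rw [positions, List.map_cons, ih h.2, h.1]
    rfl

/-- A loop in a fully commutative word with one letter removed forces one of the four forms. -/
theorem exists_parse {l r : List (Fin m)} {p : Fin m} (hred : (cs m).IsReduced (l ++ p :: r))
    (hW : (cs m).wordProd (l ++ p :: r) ∈ Wc m) (hloops : loops (l ++ r) (initial m) ≠ 0) :
    ParseI ((p : ℕ) + 1) (plain (indices l) ++ [barred ((p : ℕ) + 1)] ++ plain (indices r)) ∨
    ParseII ((p : ℕ) + 1) (plain (indices l) ++ [barred ((p : ℕ) + 1)] ++ plain (indices r)) ∨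
    ParseIII ((p : ℕ) + 1) (plain (indices l) ++ [barred ((p : ℕ) + 1)] ++ plain (indices r)) ∨
    ParseIV ((p : ℕ) + 1) (plain (indices l) ++ [barred ((p : ℕ) + 1)] ++ plain (indices r)) := by
  have hL := spaced_wordFrom hred hW
  have hu := enumerates_positions (l ++ p :: r)
  have hread := reads_wordFrom 0 (l ++ p :: r)
  set L := wordFrom 0 (l ++ p :: r) with hLdef
  obtain ⟨hl, hp, hr⟩ := reads_append.mp hread
  rw [zero_add] at hp hr
  have hl' : Reads (blank L l.length) 0 l :=
    hl.congr fun t h1 h2 ↦ (blank_of_ne (by lia)).symm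
  have hr' : Reads (blank L l.length) (l.length + 1) r :=
    hr.congr fun t h1 h2 ↦ (blank_of_ne (by lia)).symm
  -- The loop closes while reading l or while reading r; the blank position between them touches no
  -- strand.
  have hclosed : ∃ Cap Cup, Closed (blank L l.length) Cap Cup ∧ ∃ t, t ∈ Cap ∨ t ∈ Cup := by
    have h0 := traced_initial (m := m) (blank L l.length) 0
    rw [loops_append] at hloops
    by_cases hl0 : loops l (initial m) = 0
    · have h1 := h0.run hl'
      rw [zero_add] at h1
      exact (h1.blank (by simp [blank])).exists_closed hr' (by lia)
    · exact h0.exists_closed hl' hl0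
  obtain ⟨Cap, Cup, hC, hne⟩ := hclosed
  have hword : (positions 0 (l ++ p :: r)).map (letterAt L l.length) =
      plain (indices l) ++ [barred ((p : ℕ) + 1)] ++ plain (indices r) := by
    rw [positions_append, positions, List.map_append, List.map_cons, zero_add,
      map_letterAt_eq_plain (by rw [mem_positions]; lia),
      map_letterAt_eq_plain (by rw [mem_positions]; lia), map_positions hl, map_positions hr]
    simp [letterAt, barred, hp]
  have hM : ∀ t, L t ≤ m := fun t ↦ wordFrom_le _ _ _
  rw [← hword, ← hp]
  rcases exists_pattern hL hM hC hne with h | ⟨j, α, β, γ, q, q', h⟩ | ⟨j, α, β, γ, q, q', h⟩ | h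
  · exact .inl (h.parseI hL hu)
  · exact .inr (.inl (h.parseII hL hu))
  · exact .inr (.inr (.inl (h.parseIII hL hu)))
  · exact .inr (.inr (.inr (h.parseIV hu)))

/-- The word of a fully commutative element closes no loop. -/
theorem loops_eq_zero {ω : List (Fin m)} (hred : (cs m).IsReduced ω)
    (hW : (cs m).wordProd ω ∈ Wc m) : loops ω (initial m) = 0 := by
  by_contra hl
  obtain ⟨Cap, Cup, hC, hne⟩ :=
    (traced_initial (wordFrom 0 ω) 0).exists_closed (reads_wordFrom 0 ω) hl
  exact (spaced_wordFrom hred hW).not_closed (P := -1) (wordFrom_of_lt ω (by lia))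
    (fun t ↦ wordFrom_le _ _ _) hC hne

/-- The generator `b_j`, which is `0` if there is no such generator. -/
def bNat (m j : ℕ) : TL m := if h : 1 ≤ j ∧ j ≤ m then b ⟨j - 1, by lia⟩ else 0

/-- The product of the generators of a word of indices. -/
def evalNat (m : ℕ) (w : List ℕ) : TL m := (w.map (bNat m)).prod

/-- The monomial of a word in which the letters with a bar are left out. -/
def evalLetters (m : ℕ) (w : List Letter) : TL m :=
  (w.map fun x ↦ if x.2 then 1 else bNat m x.1).prod

theorem bNat_mul_self (j : ℕ) : bNat m j * bNat m j = δ • bNat m j := by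
  unfold bNat
  split_ifs
  · exact b_mul_self _
  · simp

theorem bNat_commute {i j : ℕ} (h : i + 1 < j ∨ j + 1 < i) : Commute (bNat m i) (bNat m j) := by
  unfold bNat
  split_ifs with h1 h2 h2
  · exact b_mul_b_comm (by rw [distant_iff]; dsimp only; lia)
  · exact Commute.zero_right _
  · exact Commute.zero_left _
  · exact Commute.zero_left _

/-- The default value 0 of `bNat` keeps the relation valid without an upper bound on the index. -/
theorem bNat_bond {i : ℕ} (hi : 2 ≤ i) :
    bNat m (i + 1) * bNat m i * bNat m (i + 1) = bNat m (i + 1) := by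
  unfold bNat
  split_ifs with h1 h2 h2
  · refine b_mul_b_mul_b ?_
    rw [coxeterMatrix_apply]
    simp only [Fin.ext_iff]
    grind
  · lia
  · simp
  · simp

theorem CommEquiv.eval_eq {α β : List Letter} (h : CommEquiv α β) :
    evalLetters m α = evalLetters m β := by
  induction h with
  | refl => rfl
  | tail _ h ih =>
    obtain ⟨u, v, x, y, h⟩ := h
    refine ih.trans ?_
    have hc : Commute (if x.2 then 1 else bNat m x.1) (if y.2 then 1 else bNat m y.1) := by
      split_ifs
      · exact Commute.one_left _
      · exact Commute.one_left _
      · exact Commute.one_right _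
      · exact bNat_commute h
    simp only [evalLetters, List.map_append, List.map_cons, List.prod_append, List.prod_cons]
    rw [← mul_assoc (if x.2 then 1 else bNat m x.1), hc.eq, mul_assoc]

theorem evalLetters_append (u v : List Letter) :
    evalLetters m (u ++ v) = evalLetters m u * evalLetters m v := by
  simp [evalLetters]

theorem evalNat_append (u v : List ℕ) : evalNat m (u ++ v) = evalNat m u * evalNat m v := by
  simp [evalNat]

theorem evalLetters_plain (w : List ℕ) : evalLetters m (plain w) = evalNat m w := by
  simp only [evalLetters, plain, List.map_map, evalNat]
  rfl

theorem evalLetters_barred (j : ℕ) : evalLetters m [barred j] = 1 := by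
  simp [evalLetters, barred]

theorem evalNat_singleton (j : ℕ) : evalNat m [j] = bNat m j := by
  simp [evalNat]

theorem indices_eq (ω : List (Fin m)) : indices ω = List.map (fun i : Fin m ↦ (i : ℕ) + 1) ω := by
  induction ω with
  | nil => rfl
  | cons i ω ih =>
    rw [List.map_cons, ← ih]
    rfl

theorem evalNat_indices (ω : List (Fin m)) : evalNat m (indices ω) = monomial ω := by
  simp only [evalNat, indices_eq, monomial, List.map_map]
  congr 1
  refine List.map_congr_left fun i _ ↦ ?_
  simp [bNat]

theorem evalNat_eq_zero_or_monomial (w : List ℕ) :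
    evalNat m w = 0 ∨ ∃ ω : List (Fin m), evalNat m w = monomial ω := by
  by_cases h : ∀ j ∈ w, 1 ≤ j ∧ j ≤ m
  · right
    refine ⟨w.pmap (fun j hj ↦ ⟨j - 1, by lia⟩) h, ?_⟩
    rw [← evalNat_indices]
    congr 1
    rw [indices_eq, List.map_pmap]
    conv_lhs => rw [← List.map_id w]
    rw [← List.pmap_eq_map h]
    refine List.pmap_congr_left w fun j _ h1 _ ↦ ?_
    simp
    lia
  · left
    push Not at h
    obtain ⟨j, hj, hjm⟩ := h
    refine List.prod_eq_zero ?_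
    refine List.mem_map.mpr ⟨j, hj, ?_⟩
    rw [bNat, dif_neg]
    lia

theorem evalNat_commute {j : ℕ} {w : List ℕ} (h : CommutesWith j w) :
    Commute (bNat m j) (evalNat m w) := by
  refine Commute.list_prod_right _ _ fun x hx ↦ ?_
  obtain ⟨k, hk, rfl⟩ := List.mem_map.mp hx
  have := h k hk
  by_cases hjk : j = k
  · rw [hjk]; exact Commute.refl _
  · exact bNat_commute (by lia)

theorem odds_succ (k : ℕ) : odds (k + 1) = odds k ++ [2 * k + 1] := by
  simp [odds, List.range_succ]

theorem evens_succ (k : ℕ) : evens (k + 1) = evens k ++ [2 * k + 2] := by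
  simp [evens, List.range_succ]

theorem mem_odds {k x : ℕ} (h : x ∈ odds k) : x + 1 ≤ 2 * k := by
  simp only [odds, List.mem_map, List.mem_range] at h
  obtain ⟨i, hi, rfl⟩ := h
  lia

theorem mem_evens {k x : ℕ} (h : x ∈ evens k) : x ≤ 2 * k := by
  simp only [evens, List.mem_map, List.mem_range] at h
  obtain ⟨i, hi, rfl⟩ := h
  lia

/-- The largest odd generator z commutes with the smaller odd and even blocks, so its two copies
meet around the largest even generator y and z y z = z removes both y and one z. This leads down to
b_1² = δ b_1; the bond of strength 5 is never used. -/
theorem evalNat_odds_evens_odds (k : ℕ) :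
    evalNat m (odds (k + 1)) * evalNat m (evens k) * evalNat m (odds (k + 1)) =
      δ • evalNat m (odds (k + 1)) := by
  induction k with
  | zero =>
    have h1 : odds 1 = [1] := rfl
    have h2 : evens 0 = [] := rfl
    have h3 : evalNat m [] = 1 := by simp [evalNat]
    rw [h1, h2, h3, evalNat_singleton, mul_one, bNat_mul_self]
  | succ k ih =>
    have c1 : Commute (bNat m (2 * (k + 1) + 1)) (evalNat m (odds (k + 1))) :=
      evalNat_commute fun x hx ↦ by have := mem_odds hx; lia
    have c2 : Commute (bNat m (2 * (k + 1) + 1)) (evalNat m (evens k)) :=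
      evalNat_commute fun x hx ↦ by have := mem_evens hx; lia
    have hb := bNat_bond (m := m) (i := 2 * k + 2) (by lia)
    rw [odds_succ (k + 1), evens_succ, evalNat_append, evalNat_append, evalNat_singleton,
      evalNat_singleton]
    set O := evalNat m (odds (k + 1))
    set E := evalNat m (evens k)
    change bNat m (2 * (k + 1) + 1) * bNat m (2 * k + 2) * bNat m (2 * (k + 1) + 1) =
      bNat m (2 * (k + 1) + 1) at hb
    set z := bNat m (2 * (k + 1) + 1)
    set y := bNat m (2 * k + 2)
    calc O * z * (E * y) * (O * z) = O * (z * E) * y * (z * O) := by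
          rw [c1.eq]; simp only [mul_assoc]
      _ = O * E * (z * y * z) * O := by rw [c2.eq]; simp only [mul_assoc]
      _ = O * E * (z * O) := by rw [hb, mul_assoc]
      _ = O * E * O * z := by rw [c1.eq, ← mul_assoc]
      _ = δ • (O * z) := by rw [ih, smul_mul_assoc]

theorem monomial_eq_of_commEquiv {l r : List (Fin m)} {j : ℕ} {ω : List Letter}
    (h : CommEquiv (plain (indices l) ++ [barred j] ++ plain (indices r)) ω) :
    monomial (l ++ r) = evalLetters m ω := by
  rw [← h.eval_eq, evalLetters_append, evalLetters_append, evalLetters_barred, evalLetters_plain,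
    evalLetters_plain, evalNat_indices, evalNat_indices, mul_one, monomial_append]

theorem ParseI.monomial_eq {l r : List (Fin m)} {j p : ℕ}
    (h : ParseI p (plain (indices l) ++ [barred j] ++ plain (indices r))) :
    ∃ w, monomial (l ++ r) = δ • evalNat m w := by
  obtain ⟨k, w₁, w₂, hp, hk, h⟩ := h
  obtain ⟨k, rfl⟩ : ∃ k', k = k' + 1 := ⟨k - 1, by lia⟩
  refine ⟨w₁ ++ odds (k + 1) ++ w₂, ?_⟩
  have key := evalNat_odds_evens_odds (m := m) k
  rw [monomial_eq_of_commEquiv h]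
  simp only [evalLetters_append, evalLetters_barred, evalLetters_plain, evalNat_append, mul_one,
    Nat.add_sub_cancel]
  rw [mul_assoc (evalNat m w₁), mul_assoc (evalNat m w₁), key, mul_smul_comm, smul_mul_assoc]

/-- Once the barred letter is gone, s_{2k+1} moves back over w₂ and completes the second block of
odd letters. -/
theorem ParseII.monomial_eq {l r : List (Fin m)} {j p : ℕ}
    (h : ParseII p (plain (indices l) ++ [barred j] ++ plain (indices r))) :
    ∃ w, monomial (l ++ r) = δ • evalNat m w := by
  obtain ⟨k, w₁, w₂, w₃, hp, hk, hcomm, h⟩ := h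
  refine ⟨w₁ ++ odds (k + 1) ++ w₂ ++ w₃, ?_⟩
  have key := evalNat_odds_evens_odds (m := m) k
  have c := evalNat_commute (m := m) hcomm
  rw [monomial_eq_of_commEquiv h]
  simp only [evalLetters_append, evalLetters_barred, evalLetters_plain, evalNat_append, mul_one,
    evalNat_singleton]
  have hO : evalNat m (odds (k + 1)) = evalNat m (odds k) * bNat m (2 * k + 1) := by
    rw [odds_succ, evalNat_append, evalNat_singleton]
  calc evalNat m w₁ * evalNat m (odds (k + 1)) * evalNat m (evens k) * evalNat m (odds k) *
        evalNat m w₂ * bNat m (2 * k + 1) * evalNat m w₃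
      = evalNat m w₁ * (evalNat m (odds (k + 1)) * evalNat m (evens k) *
          evalNat m (odds (k + 1))) * evalNat m w₂ * evalNat m w₃ := by
        rw [mul_assoc _ (evalNat m w₂), ← c.eq]
        conv_rhs => rw [hO]
        conv_lhs => rw [hO]
        simp only [mul_assoc]
    _ = _ := by
        rw [key, mul_smul_comm, smul_mul_assoc, smul_mul_assoc]

theorem ParseIII.monomial_eq {l r : List (Fin m)} {j p : ℕ}
    (h : ParseIII p (plain (indices l) ++ [barred j] ++ plain (indices r))) :
    ∃ w, monomial (l ++ r) = δ • evalNat m w := by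
  obtain ⟨k, w₁, w₂, w₃, hp, hk, hcomm, h⟩ := h
  refine ⟨w₁ ++ w₂ ++ odds (k + 1) ++ w₃, ?_⟩
  have key := evalNat_odds_evens_odds (m := m) k
  have c := evalNat_commute (m := m) hcomm
  rw [monomial_eq_of_commEquiv h]
  simp only [evalLetters_append, evalLetters_barred, evalLetters_plain, evalNat_append, mul_one,
    evalNat_singleton]
  have c' : Commute (bNat m (2 * k + 1)) (evalNat m (odds k)) :=
    evalNat_commute fun x hx ↦ by have := mem_odds hx; lia
  have hO : evalNat m (odds (k + 1)) = bNat m (2 * k + 1) * evalNat m (odds k) := by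
    rw [odds_succ, evalNat_append, evalNat_singleton, c'.eq]
  calc evalNat m w₁ * bNat m (2 * k + 1) * evalNat m w₂ * evalNat m (odds k) *
        evalNat m (evens k) * evalNat m (odds (k + 1)) * evalNat m w₃
      = evalNat m w₁ * evalNat m w₂ * (evalNat m (odds (k + 1)) * evalNat m (evens k) *
          evalNat m (odds (k + 1))) * evalNat m w₃ := by
        rw [mul_assoc _ (bNat m (2 * k + 1)) (evalNat m w₂), c.eq]
        conv_rhs => rw [hO]
        conv_lhs => rw [hO]
        simp only [mul_assoc]
    _ = _ := by
        rw [key, mul_smul_comm, smul_mul_assoc]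

theorem ParseIV.monomial_eq {l r : List (Fin m)} {j p : ℕ}
    (h : ParseIV p (plain (indices l) ++ [barred j] ++ plain (indices r))) :
    ∃ w, monomial (l ++ r) = δ • evalNat m w := by
  obtain ⟨q, w₁, w₂, -, h⟩ := h
  refine ⟨w₁ ++ [q] ++ w₂, ?_⟩
  rw [monomial_eq_of_commEquiv h]
  simp only [evalLetters_append, evalLetters_barred, evalLetters_plain, evalNat_append, mul_one,
    evalNat_singleton]
  rw [mul_assoc (evalNat m w₁), bNat_mul_self, mul_smul_comm, smul_mul_assoc]

theorem monomial_notMem_lattice {ω : List (Fin m)} {w : List ℕ}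
    (h : monomial ω = δ • evalNat m w) : monomial ω ∉ lattice m := by
  have hloop : ∀ ω : List (Fin m), (cs m).IsReduced ω → (cs m).wordProd ω ∈ Wc m →
      loops ω (initial m) = 0 := fun _ ↦ loops_eq_zero
  rcases evalNat_eq_zero_or_monomial (m := m) w with h0 | ⟨ω', hω'⟩
  -- An index out of range would make the monomial of ω zero, but then δ times it would lie in the
  -- lattice, against `δ_smul_monomial_notMem`.
  · rw [h0, smul_zero] at h
    refine absurd ?_ (δ_smul_monomial_notMem hloop ω)
    rw [h, smul_zero]
    exact zero_mem _
  · rw [h, hω']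
    exact δ_smul_monomial_notMem hloop ω'

end TypeH

end

theorem proposition3p1p9 (m : ℕ) (w : TypeH.W m) (hw : w ∈ TypeH.Wc m)
    (l r : List (Fin m)) (p : Fin m)
    (hred : (TypeH.cs m).IsReduced (l ++ p :: r))
    (hprod : (TypeH.cs m).wordProd (l ++ p :: r) = w) :
    TypeH.monomial (l ++ r) ∉ TypeH.lattice m ↔
      TypeH.ParseI ((p : ℕ) + 1)
          (TypeH.plain (TypeH.indices l) ++ [TypeH.barred ((p : ℕ) + 1)]
            ++ TypeH.plain (TypeH.indices r)) ∨
      TypeH.ParseII ((p : ℕ) + 1)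
          (TypeH.plain (TypeH.indices l) ++ [TypeH.barred ((p : ℕ) + 1)]
            ++ TypeH.plain (TypeH.indices r)) ∨
      TypeH.ParseIII ((p : ℕ) + 1)
          (TypeH.plain (TypeH.indices l) ++ [TypeH.barred ((p : ℕ) + 1)]
            ++ TypeH.plain (TypeH.indices r)) ∨
      TypeH.ParseIV ((p : ℕ) + 1)
          (TypeH.plain (TypeH.indices l) ++ [TypeH.barred ((p : ℕ) + 1)]
            ++ TypeH.plain (TypeH.indices r)) := by
  subst hprod
  constructor
  · intro h
    exact TypeH.exists_parse hred hw fun h0 ↦ h (TypeH.monomial_mem_lattice _ h0)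
  · rintro (h | h | h | h)
    · obtain ⟨_, h⟩ := h.monomial_eq
      exact TypeH.monomial_notMem_lattice h
    · obtain ⟨_, h⟩ := h.monomial_eq
      exact TypeH.monomial_notMem_lattice h
    · obtain ⟨_, h⟩ := h.monomial_eq
      exact TypeH.monomial_notMem_lattice h
    · obtain ⟨_, h⟩ := h.monomial_eq
      exact TypeH.monomial_notMem_lattice h
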